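/- Let $n\ge 0$, let $F_n$ be the free group on $a_1,\dots,a_n$, let $M_n=F_n/F_n''$ be the free metabelian group and $A_n=F_n/F_n'$ the free abelian group of rank $n$, and let $x\mapsto\bar x$ be the natural epimorphism $M_n\to A_n$. Write $|\cdot|$ for the word length in $M_n$ and in $A_n$ with respect to the images of $a_1,\dots,a_n$. Let $\Gamma_n$ be the Cayley graph of $A_n$; for $x\in M_n$ let $\sigma(x)\in C_1(\Gamma_n;\mathbb Z)$ be the algebraic sum of the edges traversed by the path in $\Gamma_n$ that starts at $1$ and is labelled by a word representing $x$ (it depends only on $x$). For a tuple $Q=(c_1,\dots,c_m)\in M_n^m$ let $L_Q=\langle\bar c_1,\dots,\bar c_m\rangle\le A_n$, and let $\tau_Q(x)$ be the image of $\sigma(x)$ in $C_1(\Gamma_n/L_Q;\mathbb Z)$, on which $A_n$ acts by shifts. A spherical equation in $M_n$ is an equation $z_1c_1z_1^{-1}\cdots z_mc_mz_m^{-1}=1$ with $m\ge 1$, constants $c_i\in M_n$ and unknowns $z_1,\dots,z_m$. It is given as input by a tuple of words $w_1,\dots,w_m$ in $a_1^{\pm1},\dots,a_n^{\pm1}$ representing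 $c_1,\dots,c_m$, written as a string with separators; $n$ is fixed and $m$ is part of the input. **Corollary.** For every fixed $n$: 1. The Diophantine problem for spherical equations in $M_n$ (given the equation, does it have a solution in $M_n$?) is in NP. 2. For all $c_1,\dots,c_m\in M_n$, the equation $z_1c_1z_1^{-1}\cdots z_mc_mz_m^{-1}=1$ has a solution in $M_n$ if and only if there is a tuple $(\alpha_1,\dots,\alpha_m)\in A_n^m$ with $$\sum_{i=1}^m\alpha_i\,\tau_Q(c_i)=0\qquad\text{and}\qquad|\alpha_i|\le 2\sum_{j=1}^m|c_j|\quad(i=1,\dots,m).$$ 3. Such tuples are NP-certificates: the relation "$v_1,\dots,v_m$ are words representing elements $\alpha_i\in A_n$ such that $|\alpha_i|\le 2\sum_j|w_j|$ for all $i$ and $\sum_i\alpha_i\,\tau_Q(c_i)=0$", where $|w_j|$ is the length of the given word $w_j$, between inputs $(w_1,\dots,w_m)$ and tuples of words $(v_1,\dots,v_m)$, is decidable by a Turing machine in time polynomial in the total length of the two strings, and there is a polynomial $p$ such that an input string of length $N$ represents a solvable equation if and only if it is related to some string of length at most $p(N)$. -/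

import Mathlib

open scoped BigOperators

namespace FreeMetab

/-! ### Equations in a group and their solvability -/

section Equations

variable {G : Type*} [Group G] {X : Type*}

/-- A solution of the equation `W = 1`, `W ∈ G * F_X`: a homomorphism `G * F_X → G` that is the
identity on `G` and maps `W` to `1`. -/
def IsSolution (W : Monoid.Coprod G (FreeGroup X)) (φ : Monoid.Coprod G (FreeGroup X) →* G) :
    Prop :=
  (∀ g : G, φ (Monoid.Coprod.inl g) = g) ∧ φ W = 1

/-- The equation `W = 1` has a solution in `G`. -/
def Solvable (W : Monoid.Coprod G (FreeGroup X)) : Prop :=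
  ∃ φ : Monoid.Coprod G (FreeGroup X) →* G, IsSolution W φ

/-- The spherical word `z₁ c₁ z₁⁻¹ ⋯ z_m c_m z_m⁻¹`. -/
def sphericalWord {m : ℕ} (c : Fin m → G) : Monoid.Coprod G (FreeGroup (Fin m)) :=
  (List.ofFn fun i : Fin m =>
    Monoid.Coprod.inr (FreeGroup.of i) * Monoid.Coprod.inl (c i) *
      (Monoid.Coprod.inr (FreeGroup.of i))⁻¹).prod

end Equations

/-! ### The free metabelian group -/

/-- Letters `a_i` (as `(i, true)`) and `a_i⁻¹` (as `(i, false)`). -/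
abbrev Letter (n : ℕ) : Type := Fin n × Bool

/-- The free metabelian group `M_n = F_n / F_n''` of rank `n`. -/
abbrev M (n : ℕ) : Type := FreeGroup (Fin n) ⧸ derivedSeries (FreeGroup (Fin n)) 2

/-- The free abelian group `A_n = F_n / F_n'` (written multiplicatively). -/
abbrev A (n : ℕ) : Type := Abelianization (FreeGroup (Fin n))

/-- The element of `M_n` represented by a word. -/
def wordM {n : ℕ} (w : List (Letter n)) : M n :=
  QuotientGroup.mk (FreeGroup.mk w)

/-- The element of `A_n` represented by a word. -/
def wordA {n : ℕ} (w : List (Letter n)) : A n :=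
  Abelianization.of (FreeGroup.mk w)

/-- The generators of `A_n`. -/
def genA {n : ℕ} (i : Fin n) : A n := Abelianization.of (FreeGroup.of i)

/-- The natural epimorphism `M_n → A_n`, `x ↦ x̄`. -/
def bar {n : ℕ} : M n →* A n :=
  QuotientGroup.lift _ Abelianization.of (by
    intro x hx
    change x ∈ (Abelianization.of (G := FreeGroup (Fin n))).ker
    rw [Abelianization.ker_of, ← derivedSeries_one]
    exact derivedSeries_antitone (G := FreeGroup (Fin n)) (by norm_num : 1 ≤ 2) hx)

/-- The word length of `x ∈ M_n`: the least length of a word that represents `x`. -/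
noncomputable def lengthM {n : ℕ} (x : M n) : ℕ :=
  sInf {k | ∃ w : List (Letter n), wordM w = x ∧ w.length = k}

/-- The word length of `a ∈ A_n`: the least length of a word that represents `a`. -/
noncomputable def lengthA {n : ℕ} (a : A n) : ℕ :=
  sInf {k | ∃ w : List (Letter n), wordA w = a ∧ w.length = k}

/-! ### Chains in the Cayley graph `Γ_n` of `A_n` and in its quotient -/

/-- `C₁(Γ_n)`: the pair `(g, i)` is the edge of `Γ_n` from `g` to `g a_i`. -/
abbrev Chain (n : ℕ) : Type := (A n × Fin n) →₀ ℤ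

/-- The algebraic sum of the edges traversed by the path in `Γ_n` that starts at `g` and is
labelled by the given word. -/
noncomputable def pathChain {n : ℕ} : A n → List (Letter n) → Chain n
  | _, [] => 0
  | g, (i, true) :: w => Finsupp.single (g, i) 1 + pathChain (g * genA i) w
  | g, (i, false) :: w =>
      -Finsupp.single (g * (genA i)⁻¹, i) 1 + pathChain (g * (genA i)⁻¹) w

/-- The shift action of `A_n` on `C₁(Γ_n)`, as automorphisms. -/
noncomputable def shiftAut (n : ℕ) : A n →* MulAut (Multiplicative (Chain n)) where
  toFun g := AddEquiv.toMultiplicative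
    (Finsupp.domCongr ((Equiv.mulLeft g).prodCongr (Equiv.refl (Fin n))))
  map_one' := by
    ext x : 1
    apply Multiplicative.toAdd.injective
    ext e
    obtain ⟨a, i⟩ := e
    simp [Finsupp.domCongr, Finsupp.equivMapDomain_apply, Equiv.Perm.one_def]
  map_mul' g h := by
    ext x : 1
    apply Multiplicative.toAdd.injective
    ext e
    obtain ⟨a, i⟩ := e
    simp [Finsupp.domCongr, Finsupp.equivMapDomain_apply, Equiv.Perm.mul_def, mul_assoc]

/-- The Magnus homomorphism; used only to show that the chain of a path labelled by a word depends
only on the element of `M_n` represented by the word. -/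
noncomputable def magnus (n : ℕ) :
    FreeGroup (Fin n) →* Multiplicative (Chain n) ⋊[shiftAut n] A n :=
  FreeGroup.lift fun i => ⟨Multiplicative.ofAdd (Finsupp.single (1, i) 1), genA i⟩

theorem magnus_eq_one {n : ℕ} {x : FreeGroup (Fin n)}
    (hx : x ∈ derivedSeries (FreeGroup (Fin n)) 2) : magnus n x = 1 := by
  have h1 : magnus n x ∈ derivedSeries (Multiplicative (Chain n) ⋊[shiftAut n] A n) 2 :=
    map_derivedSeries_le_derivedSeries (magnus n) 2 ⟨x, hx, rfl⟩
  have h2 : derivedSeries (Multiplicative (Chain n) ⋊[shiftAut n] A n) 1 ≤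
      (SemidirectProduct.rightHom (φ := shiftAut n)).ker := by
    rw [derivedSeries_one]
    exact Abelianization.commutator_subset_ker _
  have h3 : derivedSeries (Multiplicative (Chain n) ⋊[shiftAut n] A n) 2 = ⊥ := by
    rw [eq_bot_iff, derivedSeries_succ, Subgroup.commutator_le]
    intro a ha b hb
    have ha' : a.right = 1 := h2 ha
    have hb' : b.right = 1 := h2 hb
    rw [Subgroup.mem_bot, commutatorElement_eq_one_iff_mul_comm]
    ext1
    · simp [ha', hb', mul_comm]
    · simp [ha', hb']
  rw [h3] at h1
  exact h1

theorem pathChain_eq_magnus {n : ℕ} (w : List (Letter n)) (g : A n) :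
    pathChain g w =
      Multiplicative.toAdd (shiftAut n g (magnus n (FreeGroup.mk w)).left) := by
  induction w generalizing g with
  | nil => simp [pathChain, ← FreeGroup.one_eq_mk]
  | cons l w ih =>
    obtain ⟨i, b⟩ := l
    have hs : ∀ (a : A n) (j : Fin n) (k : ℤ),
        Multiplicative.toAdd (shiftAut n a (Multiplicative.ofAdd (Finsupp.single (1, j) k))) =
          Finsupp.single (a, j) k := by
      intro a j k
      simp [shiftAut, Finsupp.domCongr]
    have hcons : (FreeGroup.mk ((i, b) :: w)) = FreeGroup.mk [(i, b)] * FreeGroup.mk w := by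
      simp [FreeGroup.mul_mk]
    rw [hcons, map_mul]
    cases b with
    | true =>
      have : (FreeGroup.mk [(i, true)]) = FreeGroup.of i := rfl
      rw [this]
      simp only [pathChain, ih, magnus, FreeGroup.lift_apply_of, SemidirectProduct.mul_left,
        map_mul, toAdd_mul, hs, MulAut.mul_apply]
    | false =>
      have : (FreeGroup.mk [(i, false)]) = (FreeGroup.of i)⁻¹ := by
        simp [FreeGroup.of, FreeGroup.invRev]
      rw [this]
      simp only [pathChain, ih, magnus, FreeGroup.lift_apply_of, map_inv,
        SemidirectProduct.mul_left, SemidirectProduct.inv_left, SemidirectProduct.inv_right,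
        map_mul, toAdd_mul, MulAut.mul_apply, toAdd_inv]
      congr 2
      rw [← hs (g * (genA i)⁻¹) i 1, map_mul, MulAut.mul_apply, map_inv]

/-- The chain `σ(x) ∈ C₁(Γ_n)` of `x ∈ M_n`: the chain of the path that starts at `1` and is
labelled by a word representing `x`. -/
noncomputable def sigma {n : ℕ} (x : M n) : Chain n :=
  Quotient.liftOn x (fun f => pathChain 1 f.toWord) (by
    intro f g hfg
    have h : f⁻¹ * g ∈ derivedSeries (FreeGroup (Fin n)) 2 := QuotientGroup.leftRel_apply.mp hfg
    have h' := magnus_eq_one h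
    rw [map_mul, map_inv, inv_mul_eq_one] at h'
    simp only [pathChain_eq_magnus, FreeGroup.mk_toWord, h'])

/-- `σ` may be computed from any word, reduced or not, representing the element. -/
theorem sigma_wordM {n : ℕ} (w : List (Letter n)) : sigma (wordM w) = pathChain 1 w := by
  change pathChain 1 (FreeGroup.mk w).toWord = _
  simp only [pathChain_eq_magnus, FreeGroup.mk_toWord]

/-- The subgroup `L_Q` of `A_n` generated by the images of the coefficients. -/
def LQ {n m : ℕ} (c : Fin m → M n) : Subgroup (A n) :=
  Subgroup.closure (Set.range fun i => bar (c i))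

/-- `C₁(Γ_n / L)`. The group `L` acts freely on the vertices of `Γ_n` and preserves the labels and
directions of edges, so the edges of the quotient graph are the pairs of a coset and a label. -/
abbrev QuotChain {n : ℕ} (L : Subgroup (A n)) : Type := ((A n ⧸ L) × Fin n) →₀ ℤ

/-- The natural projection `C₁(Γ_n) → C₁(Γ_n / L)`. -/
noncomputable def proj {n : ℕ} (L : Subgroup (A n)) (s : Chain n) : QuotChain L :=
  s.mapDomain fun e => ((e.1 : A n ⧸ L), e.2)

/-- The shift action of `A_n` on `C₁(Γ_n / L)`. -/
noncomputable def shift {n : ℕ} {L : Subgroup (A n)} (a : A n) (s : QuotChain L) : QuotChain L :=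
  s.mapDomain fun e => ((a : A n ⧸ L) * e.1, e.2)

/-- `τ_Q(x)`, the image of `σ(x)` in `C₁(Γ_n / L_Q)`. -/
noncomputable def tau {n m : ℕ} (c : Fin m → M n) (x : M n) : QuotChain (LQ c) :=
  proj (LQ c) (sigma x)

/-- The equation `α₁ τ_Q(c₁) + ⋯ + α_m τ_Q(c_m) = 0`. -/
def LatticeEq {n m : ℕ} (c : Fin m → M n) (α : Fin m → A n) : Prop :=
  ∑ i, shift (α i) (tau c (c i)) = 0

end FreeMetab

/-! ### Polynomial time and NP -/

namespace Complexity

open Classical in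
/-- The language `L` is decided in polynomial time by a (multi-stack) Turing machine. -/
def InP {Γ : Type} (L : Set (List Γ)) : Prop :=
  Nonempty (Turing.TM2ComputableInPolyTime (id : List Γ → List Γ) Computability.encodeBool
    (fun w => decide (w ∈ L)))

/-- The string `x#y`, with `none` for the separator `#`. -/
def pairString {Γ Δ : Type} (x : List Γ) (y : List Δ) : List (Option (Γ ⊕ Δ)) :=
  x.map (fun a => some (Sum.inl a)) ++ none :: y.map (fun b => some (Sum.inr b))

/-- The language `{x#y | R(x, y)}` of a relation between strings. -/
def pairLanguage {Γ Δ : Type} (R : List Γ → List Δ → Prop) : Set (List (Option (Γ ⊕ Δ))) :=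
  {w | ∃ x y, R x y ∧ w = pairString x y}

/-- `R` is a polynomial time checking relation for `L`: `R` is decidable in polynomial time, and
`x ∈ L` if and only if `x` has a certificate `y` of polynomially bounded length with `R(x, y)`. -/
def IsNPVerifier {Γ Δ : Type} (L : Set (List Γ)) (R : List Γ → List Δ → Prop) : Prop :=
  InP (pairLanguage R) ∧
    ∃ p : Polynomial ℕ, ∀ x, x ∈ L ↔ ∃ y, y.length ≤ p.eval x.length ∧ R x y

/-- The language `L` is in NP. -/
def InNP {Γ : Type} (L : Set (List Γ)) : Prop :=
  ∃ (Δ : Type) (_ : Fintype Δ) (R : List Γ → List Δ → Prop), IsNPVerifier L R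

end Complexity

/-! ### The Diophantine problem for spherical equations as a language -/

namespace FreeMetab

/-- A tuple of words is written as the string `w₁,w₂,…,w_m`, with `none` for the comma. On
non-empty tuples this is a bijection onto all strings. -/
def encodeWords {n : ℕ} (ws : List (List (Letter n))) : List (Option (Letter n)) :=
  List.intercalate [none] (ws.map (List.map some))

/-- The Diophantine problem for spherical equations in `M_n`: the instances are the non-empty tuples
of words (the coefficients), of any length `m ≥ 1`, and the question is whether
`z₁ c₁ z₁⁻¹ ⋯ z_m c_m z_m⁻¹ = 1` has a solution in `M_n`. -/
def sphericalProblem (n : ℕ) : Set (List (Option (Letter n))) :=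
  {x | ∃ ws : List (List (Letter n)), ws ≠ [] ∧ x = encodeWords ws ∧
    Solvable (sphericalWord fun i : Fin ws.length => wordM (ws.get i))}

/-- The certificate relation: `x` is a tuple of words `w₁, …, w_m`, `m ≥ 1`, and `y` is a tuple of
words that represent `α₁, …, α_m ∈ A_n` with `|α_i| ≤ 2 ∑ |w_j|` (the lengths of the given words)
and `∑ α_i τ_Q(c_i) = 0`, where `c_i ∈ M_n` is represented by `w_i`. -/
def certificate (n : ℕ) (x y : List (Option (Letter n))) : Prop :=
  ∃ (m : ℕ) (w v : Fin m → List (Letter n)), 0 < m ∧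
    x = encodeWords (List.ofFn w) ∧ y = encodeWords (List.ofFn v) ∧
    (∀ i, lengthA (wordA (v i)) ≤ 2 * ∑ j, (w j).length) ∧
    LatticeEq (fun i => wordM (w i)) (fun i => wordA (v i))

end FreeMetab

/-! Solvability. Write L for `LQ c` and H for the preimage of L in M_n. The chain map `quotSigma L`
is a crossed homomorphism from M_n to C₁(Γ_n / L). Since L acts trivially on C₁(Γ_n / L), it is
additive on H, and conjugating an element of H by z shifts its chain by `bar z` (`quotSigma_conj`).
So a solution z yields α_i = `bar (z i)`. Conversely, lift the α_i arbitrarily to z_i and let P be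
the product of the conjugates z_i c_i z_i⁻¹. Then P lies in H and has chain zero, hence P lies in
[H, H] (`mem_commutator_of_quotSigma`). Because M_n is metabelian, multiplication of such a product
by an element of [H, H] can be realised by changing the conjugating elements
(`commutator_le_absorbed`). Doing this for P⁻¹ makes the product trivial. This is
`solvable_iff_exists_latticeEq`.

Short solutions. Join two indices when the supports of α_i τ(c_i) and α_j τ(c_j) share an edge. The
lattice equation splits over the connected components of this graph, so each component may be
shifted separately and one of its members moved to the origin. Along a path in a component,
neighbouring α's differ, modulo L, by at most |c_i| + |c_j|. A path without repeated vertices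
therefore costs at most twice the sum of all |c_j| (`exists_short_latticeEq`).

Checking in polynomial time. The lattice equation says that every edge of the quotient graph is
traversed equally often in both directions, so only equality of cosets of L has to be decided. By a
determinant estimate, characters ℤⁿ → ℤ/d with d bounded by a polynomial in the lengths separate
short vectors from a lattice generated by short vectors (`Lattice.exists_separating_character`). As
n is fixed, there are polynomially many such characters and all of them can be tried. The
certificate relation thus becomes a formula built from bounded sums, bounded quantifiers and
arithmetic of polynomially bounded numbers. Such formulas are evaluated by stack programs with unary
registers (`Rep.sum` is the main closure property), and these programs run on multi-stack Turing
machines (`Cmd.Exec.runs`, `InP.of_cmd`). -/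

/-! ### Stack programs and their compilation to Turing machines -/

namespace Complexity

/-- Structured programs acting on an input stack, an auxiliary stack and unary registers. -/
inductive Cmd (α : Type) : Type
  | skip : Cmd α
  | inc (r : ℕ) : Cmd α
  | dec (r : ℕ) : Cmd α
  | right : Cmd α
  | test (a : α) (r : ℕ) : Cmd α
  | seq (c d : Cmd α) : Cmd α
  | loop (r : ℕ) (c : Cmd α) : Cmd α
  | forth (c : Cmd α) : Cmd α
  | back (c : Cmd α) : Cmd α

/-- The memory of a stack program. -/
structure Mem (α : Type) where
  inp : List α
  aux : List α
  reg : ℕ → ℕ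

namespace Cmd

variable {α : Type}

/-- `Exec c S S' t`: the program `c` transforms the memory `S` into `S'` in `t` steps. -/
inductive Exec : Cmd α → Mem α → Mem α → ℕ → Prop
  | skip (S) : Exec skip S S 1
  | inc (r s u ρ) : Exec (inc r) ⟨s, u, ρ⟩ ⟨s, u, Function.update ρ r (ρ r + 1)⟩ 1
  | dec (r s u ρ) : Exec (dec r) ⟨s, u, ρ⟩ ⟨s, u, Function.update ρ r (ρ r - 1)⟩ 1
  | right_nil (u ρ) : Exec right ⟨[], u, ρ⟩ ⟨[], u, ρ⟩ 1
  | right_cons (a s u ρ) : Exec right ⟨a :: s, u, ρ⟩ ⟨s, a :: u, ρ⟩ 1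
  | test_pos (a r s u ρ) (h : s.head? = some a) :
      Exec (test a r) ⟨s, u, ρ⟩ ⟨s, u, Function.update ρ r (ρ r + 1)⟩ 1
  | test_neg (a r s u ρ) (h : s.head? ≠ some a) : Exec (test a r) ⟨s, u, ρ⟩ ⟨s, u, ρ⟩ 1
  | seq {c d S S' S'' t t'} (h : Exec c S S' t) (h' : Exec d S' S'' t') :
      Exec (seq c d) S S'' (t + t')
  | loop_zero (r c s u ρ) (h : ρ r = 0) : Exec (loop r c) ⟨s, u, ρ⟩ ⟨s, u, ρ⟩ 1
  | loop_succ {r k c s u ρ S S' t t'} (hk : ρ r = k + 1)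
      (h : Exec c ⟨s, u, Function.update ρ r k⟩ S t) (h' : Exec (loop r c) S S' t') :
      Exec (loop r c) ⟨s, u, ρ⟩ S' (1 + t + t')
  | forth_nil (c u ρ) : Exec (forth c) ⟨[], u, ρ⟩ ⟨[], u, ρ⟩ 1
  | forth_cons {c a s u ρ S S' t t'} (h : Exec c ⟨s, a :: u, ρ⟩ S t)
      (h' : Exec (forth c) S S' t') : Exec (forth c) ⟨a :: s, u, ρ⟩ S' (1 + t + t')
  | back_nil (c s ρ) : Exec (back c) ⟨s, [], ρ⟩ ⟨s, [], ρ⟩ 1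
  | back_cons {c a s u ρ S S' t t'} (h : Exec c ⟨a :: s, u, ρ⟩ S t)
      (h' : Exec (back c) S S' t') : Exec (back c) ⟨s, a :: u, ρ⟩ S' (1 + t + t')

/-- The labels of the machine that runs a program. -/
def Lab : Cmd α → Type
  | skip | inc _ | dec _ | right | test _ _ => Unit
  | seq c d => c.Lab ⊕ d.Lab
  | loop _ c | forth c | back c => Unit ⊕ c.Lab

noncomputable instance labFintype : (c : Cmd α) → Fintype c.Lab
  | skip | inc _ | dec _ | right | test _ _ => inferInstanceAs (Fintype Unit)
  | seq c d =>
    have := labFintype c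
    have := labFintype d
    inferInstanceAs (Fintype (c.Lab ⊕ d.Lab))
  | loop _ c | forth c | back c =>
    have := labFintype c
    inferInstanceAs (Fintype (Unit ⊕ c.Lab))

/-- The label at which a program starts. -/
def entry : (c : Cmd α) → c.Lab
  | skip | inc _ | dec _ | right | test _ _ => ()
  | seq c _ => Sum.inl c.entry
  | loop _ _ | forth _ | back _ => Sum.inl ()

/-- All registers of the program are at most `R`. -/
def Within (R : ℕ) : Cmd α → Prop
  | skip | right => True
  | inc r | dec r | test _ r => r ≤ R
  | seq c d => c.Within R ∧ d.Within R
  | loop r c => r ≤ R ∧ c.Within R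
  | forth c | back c => c.Within R

theorem Within.mono {R R' : ℕ} (h : R ≤ R') : ∀ {c : Cmd α}, c.Within R → c.Within R'
  | skip, _ | right, _ => trivial
  | inc _, hr | dec _, hr | test _ _, hr => le_trans (b := R) hr h
  | seq _ _, hr => ⟨hr.1.mono h, hr.2.mono h⟩
  | loop _ _, hr => ⟨hr.1.trans h, hr.2.mono h⟩
  | forth c, hr | back c, hr => Within.mono (c := c) h hr

theorem exists_within : ∀ c : Cmd α, ∃ R, c.Within R
  | skip | right => ⟨0, trivial⟩
  | inc r | dec r | test _ r => ⟨r, le_refl r⟩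
  | seq c d =>
    let ⟨R, h⟩ := exists_within c
    let ⟨R', h'⟩ := exists_within d
    ⟨max R R', h.mono (le_max_left _ _), h'.mono (le_max_right _ _)⟩
  | loop r c =>
    let ⟨R, h⟩ := exists_within c
    ⟨max r R, le_max_left _ _, h.mono (le_max_right _ _)⟩
  | forth c | back c => exists_within c

end Cmd

/-- The stacks of the machine of a program with registers at most `R`. -/
inductive Stk (R : ℕ) : Type
  | inp
  | aux
  | out
  | reg (r : Fin (R + 1))
  deriving DecidableEq, Fintype

/-- The stack alphabets. -/
abbrev Stk.Alph (α : Type) (R : ℕ) : Stk R → Type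
  | inp | aux => α
  | out => Bool
  | reg _ => Unit

/-- The stacks of a memory. -/
def Mem.stk {α : Type} (R : ℕ) (S : Mem α) : (k : Stk R) → List (k.Alph α R)
  | .inp => S.inp
  | .aux => S.aux
  | .out => []
  | .reg r => List.replicate (S.reg r) ()

/-! ### Translation of stack programs into multi-stack machines. -/

section Compile

variable {α : Type} {R : ℕ}

open Turing.TM2 (Stmt Cfg)

theorem Mem.stk_inp (s s' u : List α) (ρ : ℕ → ℕ) :
    Function.update (Mem.stk R ⟨s, u, ρ⟩) .inp s' = Mem.stk R ⟨s', u, ρ⟩ := by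
  funext k
  cases k <;> simp [Mem.stk]

theorem Mem.stk_aux (s u u' : List α) (ρ : ℕ → ℕ) :
    Function.update (Mem.stk R ⟨s, u, ρ⟩) .aux u' = Mem.stk R ⟨s, u', ρ⟩ := by
  funext k
  cases k <;> simp [Mem.stk]

theorem Mem.stk_reg (s u : List α) (ρ : ℕ → ℕ) {r k : ℕ} (hr : r ≤ R) :
    Function.update (Mem.stk R ⟨s, u, ρ⟩) (.reg (Fin.ofNat (R + 1) r)) (List.replicate k ()) =
      Mem.stk R ⟨s, u, Function.update ρ r k⟩ := by
  funext j
  cases j with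
  | reg i =>
    have hv : (Fin.ofNat (R + 1) r : ℕ) = r := Nat.mod_eq_of_lt (Nat.lt_succ_of_le hr)
    by_cases h : i = Fin.ofNat (R + 1) r
    · subst h
      simp only [Function.update_self, Mem.stk, hv]
    · have h' : (i : ℕ) ≠ r := fun e => h (Fin.ext (e.trans hv.symm))
      rw [Function.update_of_ne (by simpa using h)]
      simp [Mem.stk, Function.update_of_ne h']
  | _ => simp [Mem.stk]

theorem Mem.stk_reg_eq (s u : List α) (ρ : ℕ → ℕ) {r : ℕ} (hr : r ≤ R) :
    Mem.stk R ⟨s, u, ρ⟩ (.reg (Fin.ofNat (R + 1) r)) = List.replicate (ρ r) () := by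
  have hv : (Fin.ofNat (R + 1) r : ℕ) = r := Nat.mod_eq_of_lt (Nat.lt_succ_of_le hr)
  simp only [Mem.stk, hv]

/-- The machine reaches the second configuration from the first in exactly `t` steps. -/
def RunsIn {Λ : Type} (m : Λ → Stmt (Stk.Alph α R) Λ (Option α)) (t : ℕ)
    (a b : Cfg (Stk.Alph α R) Λ (Option α)) : Prop :=
  (flip bind (Turing.TM2.step m))^[t] (some a) = some b

theorem RunsIn.trans {Λ : Type} {m : Λ → Stmt (Stk.Alph α R) Λ (Option α)} {t t' : ℕ}
    {a b c : Cfg (Stk.Alph α R) Λ (Option α)} (h : RunsIn m t a b) (h' : RunsIn m t' b c) :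
    RunsIn m (t + t') a c := by
  unfold RunsIn at *
  rw [add_comm, Function.iterate_add_apply, h, h']

theorem RunsIn.one {Λ : Type} {m : Λ → Stmt (Stk.Alph α R) Λ (Option α)} {l : Λ} {v : Option α}
    {S : (k : Stk R) → List (k.Alph α R)} {b : Cfg (Stk.Alph α R) Λ (Option α)}
    (h : Turing.TM2.stepAux (m l) v S = b) : RunsIn m 1 ⟨some l, v, S⟩ b := by
  simp [RunsIn, flip, Turing.TM2.step, h]

variable [Inhabited α]

/-- Pop a register and record in the state whether it was non-empty. -/
def popReg {Λ : Type} (r : ℕ) (q q' : Stmt (Stk.Alph α R) Λ (Option α)) :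
    Stmt (Stk.Alph α R) Λ (Option α) :=
  -- The machine state has type `Option α`, so an arbitrary letter serves as the mark for a
  -- non-empty register.
  .pop (.reg (Fin.ofNat (R + 1) r)) (fun _ o => o.map fun _ => default)
    (.branch Option.isSome q q')

open Classical in
/-- The code of a program, with the labels embedded by `emb`, that ends at the label `ex`. -/
noncomputable def Cmd.code {Λ : Type} : (c : Cmd α) → (emb : c.Lab → Λ) → (ex : Λ) → c.Lab →
    Stmt (Stk.Alph α R) Λ (Option α)
  | skip, _, ex, _ => .goto fun _ => ex
  | inc r, _, ex, _ => .push (.reg (Fin.ofNat (R + 1) r)) (fun _ => ()) (.goto fun _ => ex)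
  | dec r, _, ex, _ => .pop (.reg (Fin.ofNat (R + 1) r)) (fun v _ => v) (.goto fun _ => ex)
  | right, _, ex, _ =>
    .pop .inp (fun _ o => o) (.branch Option.isSome
      (.push .aux (fun v => v.getD default) (.goto fun _ => ex)) (.goto fun _ => ex))
  | test a r, _, ex, _ =>
    .peek .inp (fun _ o => o) (.branch (fun v => decide (v = some a))
      (.push (.reg (Fin.ofNat (R + 1) r)) (fun _ => ()) (.goto fun _ => ex)) (.goto fun _ => ex))
  | seq c d, emb, _, Sum.inl l => c.code (emb ∘ Sum.inl) (emb (Sum.inr d.entry)) l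
  | seq _ d, emb, ex, Sum.inr l => d.code (emb ∘ Sum.inr) ex l
  | loop r c, emb, ex, Sum.inl _ =>
    popReg r (.goto fun _ => emb (Sum.inr c.entry)) (.goto fun _ => ex)
  | loop _ c, emb, _, Sum.inr l => c.code (emb ∘ Sum.inr) (emb (Sum.inl ())) l
  | forth c, emb, ex, Sum.inl _ =>
    .pop .inp (fun _ o => o) (.branch Option.isSome
      (.push .aux (fun v => v.getD default) (.goto fun _ => emb (Sum.inr c.entry)))
      (.goto fun _ => ex))
  | forth c, emb, _, Sum.inr l => c.code (emb ∘ Sum.inr) (emb (Sum.inl ())) l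
  | back c, emb, ex, Sum.inl _ =>
    .pop .aux (fun _ o => o) (.branch Option.isSome
      (.push .inp (fun v => v.getD default) (.goto fun _ => emb (Sum.inr c.entry)))
      (.goto fun _ => ex))
  | back c, emb, _, Sum.inr l => c.code (emb ∘ Sum.inr) (emb (Sum.inl ())) l

theorem stepAux_popReg_zero {Λ : Type} {r : ℕ} (hr : r ≤ R)
    (q q' : Stmt (Stk.Alph α R) Λ (Option α)) (v : Option α) (s u : List α) (ρ : ℕ → ℕ)
    (h : ρ r = 0) : Turing.TM2.stepAux (popReg r q q') v (Mem.stk R ⟨s, u, ρ⟩) =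
      Turing.TM2.stepAux q' none (Mem.stk R ⟨s, u, ρ⟩) := by
  simp only [popReg, Turing.TM2.stepAux, Mem.stk_reg_eq s u ρ hr, h, List.replicate_zero,
    List.head?_nil, Option.map_none, Option.isSome_none, cond_false, List.tail_nil]
  congr 1
  rw [Function.update_eq_self_iff, Mem.stk_reg_eq s u ρ hr, h, List.replicate_zero]

theorem stepAux_popReg_succ {Λ : Type} {r k : ℕ} (hr : r ≤ R)
    (q q' : Stmt (Stk.Alph α R) Λ (Option α)) (v : Option α) (s u : List α) (ρ : ℕ → ℕ)
    (h : ρ r = k + 1) : Turing.TM2.stepAux (popReg r q q') v (Mem.stk R ⟨s, u, ρ⟩) =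
      Turing.TM2.stepAux q (some default) (Mem.stk R ⟨s, u, Function.update ρ r k⟩) := by
  simp only [popReg, Turing.TM2.stepAux, Mem.stk_reg_eq s u ρ hr, h, List.replicate_succ,
    List.head?_cons, Option.map_some, Option.isSome_some, cond_true, List.tail_cons,
    Mem.stk_reg s u ρ hr]

/-- Induction on the execution. The label type, the embedding and the exit label are arbitrary so
that the code of a subprogram can run inside a larger machine. The initial state `v` is arbitrary
and the final one uncontrolled, because every branch follows a read that overwrites the state. -/
theorem Cmd.Exec.runs {c : Cmd α} {S S' : Mem α} {t : ℕ} (h : c.Exec S S' t) :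
    ∀ {Λ : Type} (m : Λ → Stmt (Stk.Alph α R) Λ (Option α)) (emb : c.Lab → Λ) (ex : Λ),
      (∀ l, m (emb l) = c.code emb ex l) → c.Within R → ∀ v : Option α, ∃ v',
        RunsIn m t ⟨some (emb c.entry), v, S.stk R⟩ ⟨some ex, v', S'.stk R⟩ := by
  induction h with
  | skip S =>
    intro Λ m emb ex hm hw v
    exact ⟨v, RunsIn.one (by rw [hm]; rfl)⟩
  | inc r s u ρ =>
    intro Λ m emb ex hm hw v
    refine ⟨v, RunsIn.one ?_⟩
    rw [hm, Cmd.code]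
    simp only [Turing.TM2.stepAux, Mem.stk_reg_eq s u ρ hw]
    rw [← Mem.stk_reg s u ρ hw, List.replicate_succ]
  | dec r s u ρ =>
    intro Λ m emb ex hm hw v
    refine ⟨v, RunsIn.one ?_⟩
    rw [hm, Cmd.code]
    simp only [Turing.TM2.stepAux, Mem.stk_reg_eq s u ρ hw]
    rw [← Mem.stk_reg s u ρ hw, List.tail_replicate]
  | right_nil u ρ =>
    intro Λ m emb ex hm hw v
    refine ⟨none, RunsIn.one ?_⟩
    rw [hm, Cmd.code]
    have e : Mem.stk R (⟨[], u, ρ⟩ : Mem α) .inp = [] := rfl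
    simp only [Turing.TM2.stepAux, e, List.head?_nil, Option.isSome_none, cond_false,
      List.tail_nil, Mem.stk_inp]
  | right_cons a s u ρ =>
    intro Λ m emb ex hm hw v
    refine ⟨some a, RunsIn.one ?_⟩
    rw [hm, Cmd.code]
    have e : Mem.stk R (⟨a :: s, u, ρ⟩ : Mem α) .inp = a :: s := rfl
    have e' : Mem.stk R (⟨s, u, ρ⟩ : Mem α) .aux = u := rfl
    simp only [Turing.TM2.stepAux, e, List.head?_cons, Option.isSome_some, cond_true,
      List.tail_cons, Mem.stk_inp, e', Mem.stk_aux, Option.getD_some]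
  | test_pos a r s u ρ h =>
    intro Λ m emb ex hm hw v
    refine ⟨some a, RunsIn.one ?_⟩
    rw [hm, Cmd.code]
    have e : (Mem.stk R (⟨s, u, ρ⟩ : Mem α) .inp).head? = some a := h
    simp only [Turing.TM2.stepAux, e, decide_true, cond_true, Mem.stk_reg_eq s u ρ hw]
    rw [← Mem.stk_reg s u ρ hw, List.replicate_succ]
  | test_neg a r s u ρ h =>
    intro Λ m emb ex hm hw v
    refine ⟨s.head?, RunsIn.one ?_⟩
    rw [hm, Cmd.code]
    have e : (Mem.stk R (⟨s, u, ρ⟩ : Mem α) .inp).head? = s.head? := rfl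
    simp only [Turing.TM2.stepAux, e, h, decide_false, cond_false]
  | @seq c d S S' S'' t t' _ _ ih ih' =>
    intro Λ m emb ex hm hw v
    obtain ⟨v₁, h₁⟩ := ih m (emb ∘ Sum.inl) (emb (Sum.inr d.entry))
      (fun l => hm (Sum.inl l)) hw.1 v
    obtain ⟨v₂, h₂⟩ := ih' m (emb ∘ Sum.inr) ex (fun l => hm (Sum.inr l)) hw.2 v₁
    exact ⟨v₂, h₁.trans h₂⟩
  | loop_zero r c s u ρ h =>
    intro Λ m emb ex hm hw v
    refine ⟨none, RunsIn.one ?_⟩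
    have := hm (Sum.inl ())
    rw [Cmd.entry, this, Cmd.code, stepAux_popReg_zero hw.1 _ _ _ _ _ _ h]
    rfl
  | @loop_succ r k c s u ρ S S' t t' hk _ _ ih ih' =>
    intro Λ m emb ex hm hw v
    have := hm (Sum.inl ())
    have h₀ : RunsIn m 1 ⟨some (emb (Sum.inl ())), v, Mem.stk R ⟨s, u, ρ⟩⟩
        ⟨some (emb (Sum.inr c.entry)), some default,
          Mem.stk R ⟨s, u, Function.update ρ r k⟩⟩ := by
      refine RunsIn.one ?_
      rw [this, Cmd.code, stepAux_popReg_succ hw.1 _ _ _ _ _ _ hk]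
      rfl
    obtain ⟨v₁, h₁⟩ := ih m (emb ∘ Sum.inr) (emb (Sum.inl ()))
      (fun l => hm (Sum.inr l)) hw.2 (some default)
    obtain ⟨v₂, h₂⟩ := ih' m emb ex hm hw v₁
    exact ⟨v₂, (h₀.trans h₁).trans h₂⟩
  | forth_nil c u ρ =>
    intro Λ m emb ex hm hw v
    refine ⟨none, RunsIn.one ?_⟩
    have := hm (Sum.inl ())
    rw [Cmd.entry, this, Cmd.code]
    have e : Mem.stk R (⟨[], u, ρ⟩ : Mem α) .inp = [] := rfl
    simp only [Turing.TM2.stepAux, e, List.head?_nil, Option.isSome_none, cond_false,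
      List.tail_nil, Mem.stk_inp]
  | @forth_cons c a s u ρ S S' t t' _ _ ih ih' =>
    intro Λ m emb ex hm hw v
    have := hm (Sum.inl ())
    have h₀ : RunsIn m 1 ⟨some (emb (Sum.inl ())), v, Mem.stk R ⟨a :: s, u, ρ⟩⟩
        ⟨some (emb (Sum.inr c.entry)), some a, Mem.stk R ⟨s, a :: u, ρ⟩⟩ := by
      refine RunsIn.one ?_
      rw [this, Cmd.code]
      have e : Mem.stk R (⟨a :: s, u, ρ⟩ : Mem α) .inp = a :: s := rfl
      have e' : Mem.stk R (⟨s, u, ρ⟩ : Mem α) .aux = u := rfl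
      simp only [Turing.TM2.stepAux, e, List.head?_cons, Option.isSome_some, cond_true,
        List.tail_cons, Mem.stk_inp, e', Mem.stk_aux, Option.getD_some]
    obtain ⟨v₁, h₁⟩ := ih m (emb ∘ Sum.inr) (emb (Sum.inl ()))
      (fun l => hm (Sum.inr l)) hw (some a)
    obtain ⟨v₂, h₂⟩ := ih' m emb ex hm hw v₁
    exact ⟨v₂, (h₀.trans h₁).trans h₂⟩
  | back_nil c s ρ =>
    intro Λ m emb ex hm hw v
    refine ⟨none, RunsIn.one ?_⟩
    have := hm (Sum.inl ())
    rw [Cmd.entry, this, Cmd.code]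
    have e : Mem.stk R (⟨s, [], ρ⟩ : Mem α) .aux = [] := rfl
    simp only [Turing.TM2.stepAux, e, List.head?_nil, Option.isSome_none, cond_false,
      List.tail_nil, Mem.stk_aux]
  | @back_cons c a s u ρ S S' t t' _ _ ih ih' =>
    intro Λ m emb ex hm hw v
    have := hm (Sum.inl ())
    have h₀ : RunsIn m 1 ⟨some (emb (Sum.inl ())), v, Mem.stk R ⟨s, a :: u, ρ⟩⟩
        ⟨some (emb (Sum.inr c.entry)), some a, Mem.stk R ⟨a :: s, u, ρ⟩⟩ := by
      refine RunsIn.one ?_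
      rw [this, Cmd.code]
      have e : Mem.stk R (⟨s, a :: u, ρ⟩ : Mem α) .aux = a :: u := rfl
      have e' : Mem.stk R (⟨s, u, ρ⟩ : Mem α) .inp = s := rfl
      simp only [Turing.TM2.stepAux, e, List.head?_cons, Option.isSome_some, cond_true,
        List.tail_cons, Mem.stk_aux, e', Mem.stk_inp, Option.getD_some]
    obtain ⟨v₁, h₁⟩ := ih m (emb ∘ Sum.inr) (emb (Sum.inl ()))
      (fun l => hm (Sum.inr l)) hw (some a)
    obtain ⟨v₂, h₂⟩ := ih' m emb ex hm hw v₁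
    exact ⟨v₂, (h₀.trans h₁).trans h₂⟩

/-- The labels of the machine that decides by a program: run the program, read the result, clear the
input. -/
abbrev DecLab (c : Cmd α) : Type := c.Lab ⊕ Option Bool

/-- The code of the machine that decides by the value left by a program in register `0`. -/
noncomputable def decCode (c : Cmd α) (R : ℕ) :
    DecLab c → Stmt (Stk.Alph α R) (DecLab c) (Option α)
  | Sum.inl l => c.code Sum.inl (Sum.inr none) l
  | Sum.inr none => popReg 0 (.goto fun _ => Sum.inr (some true))
      (.goto fun _ => Sum.inr (some false))
  | Sum.inr (some b) => .pop .inp (fun _ o => o) (.branch Option.isSome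
      (.goto fun _ => Sum.inr (some b)) (.push .out (fun _ => b) .halt))

/-- The machine that decides by the value left by a program in register `0`. -/
noncomputable def decMachine [Fintype α] (c : Cmd α) (R : ℕ) : Turing.FinTM2 where
  K := Stk R
  k₀ := .inp
  k₁ := .out
  Γ := Stk.Alph α R
  Λ := DecLab c
  main := Sum.inl c.entry
  σ := Option α
  initialState := none
  Γk₀Fin := inferInstanceAs (Fintype α)
  m := decCode c R

/-- A final configuration in the sense of `Turing.haltList` has all stacks empty except the output,
so the input that the program has preserved must be discarded. -/
theorem runsIn_clear (c : Cmd α) (R : ℕ) (b : Bool) (s : List α) (v : Option α) :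
    RunsIn (decCode c R) (s.length + 1)
      ⟨some (Sum.inr (some b)), v, Mem.stk R ⟨s, [], fun _ => 0⟩⟩
      ⟨none, none, Function.update (Mem.stk R ⟨[], [], fun _ => 0⟩) .out [b]⟩ := by
  induction s generalizing v with
  | nil =>
    refine RunsIn.one ?_
    rw [decCode]
    have e : Mem.stk R (⟨[], [], fun _ => 0⟩ : Mem α) .inp = [] := rfl
    have e' : Mem.stk R (⟨[], [], fun _ => 0⟩ : Mem α) .out = [] := rfl
    simp only [Turing.TM2.stepAux, e, List.head?_nil, Option.isSome_none, cond_false,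
      List.tail_nil, Mem.stk_inp, e']
  | cons a s ih =>
    rw [List.length_cons, add_comm]
    refine RunsIn.trans (RunsIn.one ?_) (ih (some a))
    rw [decCode]
    have e : Mem.stk R (⟨a :: s, [], fun _ => 0⟩ : Mem α) .inp = a :: s := rfl
    simp only [Turing.TM2.stepAux, e, List.head?_cons, Option.isSome_some, cond_true,
      List.tail_cons, Mem.stk_inp]

open Classical in
/-- A language is decided in polynomial time if a stack program computes its indicator in register
`0` in polynomial time. -/
theorem InP.of_cmd [Fintype α] {L : Set (List α)} (c : Cmd α) (p : Polynomial ℕ)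
    (h : ∀ s : List α, ∃ t ≤ p.eval s.length, c.Exec ⟨s, [], fun _ => 0⟩
      ⟨s, [], Function.update (fun _ => 0) 0 (if s ∈ L then 1 else 0)⟩ t) : InP L := by
  obtain ⟨R, hR⟩ := c.exists_within
  -- Besides the run of the program, one step reads register `0` and `s.length + 1` steps empty the
  -- input and write the answer.
  refine ⟨⟨⟨decMachine c R, Equiv.refl α, Equiv.refl Bool⟩, p + Polynomial.X + 2, fun s => ?_⟩⟩
  have key : ∃ t ≤ (p + Polynomial.X + 2).eval s.length, RunsIn (decCode c R) t
      ⟨some (Sum.inl c.entry), none, Mem.stk R ⟨s, [], fun _ => 0⟩⟩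
      ⟨none, none, Function.update (Mem.stk R ⟨[], [], fun _ => 0⟩) .out [decide (s ∈ L)]⟩ := by
    obtain ⟨t, ht, he⟩ := h s
    obtain ⟨v, hv⟩ := he.runs (R := R) (decCode c R) Sum.inl (Sum.inr none) (fun _ => rfl) hR none
    have h₁ : RunsIn (decCode c R) 1 ⟨some (Sum.inr none), v,
        Mem.stk R ⟨s, [], Function.update (fun _ => 0) 0 (if s ∈ L then 1 else 0)⟩⟩
        ⟨some (Sum.inr (some (decide (s ∈ L)))), (if s ∈ L then some default else none),
          Mem.stk R ⟨s, [], fun _ => 0⟩⟩ := by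
      refine RunsIn.one ?_
      rw [decCode]
      by_cases hs : s ∈ L
      · rw [stepAux_popReg_succ (k := 0) (Nat.zero_le _) _ _ _ _ _ _ (by simp [hs])]
        simp [hs, Turing.TM2.stepAux]
      · rw [stepAux_popReg_zero (Nat.zero_le _) _ _ _ _ _ _ (by simp [hs])]
        simp [hs, Turing.TM2.stepAux]
    refine ⟨t + 1 + (s.length + 1), ?_, (hv.trans h₁).trans (runsIn_clear c R _ s _)⟩
    simp only [Polynomial.eval_add, Polynomial.eval_X, Polynomial.eval_ofNat]
    omega
  have e₁ : Turing.initList (decMachine c R) (List.map (Equiv.refl α).invFun (id s)) =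
      ⟨some (Sum.inl c.entry), none, Mem.stk R ⟨s, [], fun _ => 0⟩⟩ := by
    have : List.map (Equiv.refl α).invFun (id s) = s := List.map_id s
    refine (congrArg (Turing.initList (decMachine c R)) this).trans ?_
    unfold Turing.initList
    congr 1
    funext k
    cases k <;> rfl
  have e₂ : Turing.haltList (decMachine c R)
      (List.map (Equiv.refl Bool).invFun (Computability.encodeBool (decide (s ∈ L)))) =
      ⟨none, none, Function.update (Mem.stk R ⟨[], [], fun _ => 0⟩) .out [decide (s ∈ L)]⟩ := by
    unfold Turing.haltList
    congr 1
    funext k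
    cases k <;> rfl
  refine ⟨⟨key.choose, ?_⟩, ?_⟩
  · refine (congrArg _ (congrArg some e₁)).trans
      (Eq.trans key.choose_spec.2 (congrArg some e₂.symm))
  · exact key.choose_spec.1

end Compile

end Complexity

/-! ### Functions computed with unary registers in polynomial time -/

namespace Complexity

open Function (update update_apply)

variable {α : Type}

/-- Execution in at most `T` steps. -/
def Cmd.ExecLe (c : Cmd α) (S S' : Mem α) (T : ℕ) : Prop := ∃ t ≤ T, c.Exec S S' t

/-! ### Time bounds for elementary programs. -/

namespace Cmd.ExecLe

variable {c d : Cmd α} {S S' S'' : Mem α} {T T' r : ℕ} {s u : List α} {ρ : ℕ → ℕ}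

theorem mono (h : c.ExecLe S S' T) (hT : T ≤ T') : c.ExecLe S S' T' :=
  let ⟨t, ht, he⟩ := h
  ⟨t, ht.trans hT, he⟩

theorem cast {s' u' : List α} {ρ₁ ρ' ρ₁' : ℕ → ℕ} (h : c.ExecLe ⟨s, u, ρ⟩ ⟨s', u', ρ'⟩ T)
    (e : ρ₁ = ρ) (e' : ρ₁' = ρ') (hT : T ≤ T') : c.ExecLe ⟨s, u, ρ₁⟩ ⟨s', u', ρ₁'⟩ T' := by
  rw [e, e']
  exact h.mono hT

theorem seq (h : c.ExecLe S S' T) (h' : d.ExecLe S' S'' T') :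
    (Cmd.seq c d).ExecLe S S'' (T + T') :=
  let ⟨t, ht, he⟩ := h
  let ⟨t', ht', he'⟩ := h'
  ⟨t + t', add_le_add ht ht', .seq he he'⟩

theorem skip : (Cmd.skip : Cmd α).ExecLe S S 1 := ⟨1, le_rfl, .skip S⟩

theorem inc : (Cmd.inc r).ExecLe ⟨s, u, ρ⟩ ⟨s, u, update ρ r (ρ r + 1)⟩ 1 :=
  ⟨1, le_rfl, .inc r s u ρ⟩

theorem dec : (Cmd.dec r).ExecLe ⟨s, u, ρ⟩ ⟨s, u, update ρ r (ρ r - 1)⟩ 1 :=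
  ⟨1, le_rfl, .dec r s u ρ⟩

/-- `I k` is the memory at the head of the loop when `k` rounds remain. The head decrements the
register before the body starts, hence the update in the hypothesis on the body. -/
theorem loop (I : ℕ → Mem α) (n : ℕ) (hI : ∀ k, (I k).reg r = k)
    (h : ∀ k < n, c.ExecLe ⟨(I (k + 1)).inp, (I (k + 1)).aux, update (I (k + 1)).reg r k⟩ (I k) T) :
    (Cmd.loop r c).ExecLe (I n) (I 0) (n * (T + 1) + 1) := by
  induction n with
  | zero => exact ⟨1, by simp, .loop_zero r c (I 0).inp (I 0).aux (I 0).reg (hI 0)⟩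
  | succ n ih =>
    obtain ⟨t, ht, he⟩ := h n (Nat.lt_succ_self n)
    obtain ⟨t', ht', he'⟩ := ih fun k hk => h k (Nat.lt_succ_of_lt hk)
    refine ⟨1 + t + t', ?_, .loop_succ (hI (n + 1)) he he'⟩
    rw [Nat.succ_mul]
    omega

/-- Moving the contents of a register. -/
theorem moveReg {a b : ℕ} (hab : a ≠ b) :
    (Cmd.loop a (.inc b)).ExecLe ⟨s, u, ρ⟩
      ⟨s, u, update (update ρ b (ρ b + ρ a)) a 0⟩ (ρ a * 2 + 1) := by
  have := loop (r := a) (c := .inc b) (T := 1)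
    (fun k => ⟨s, u, update (update ρ b (ρ b + ρ a - k)) a k⟩) (ρ a) (by simp) (fun k hk => by
      refine (inc (r := b)).cast rfl (funext fun j => ?_) le_rfl
      simp only [update_apply]
      split_ifs <;> grind)
  refine this.cast (funext fun j => ?_) (funext fun j => ?_) le_rfl <;>
  · simp only [update_apply]
    split_ifs <;> grind

/-- Subtracting a register from another one. -/
theorem subReg {a b : ℕ} (hab : a ≠ b) :
    (Cmd.loop a (.dec b)).ExecLe ⟨s, u, ρ⟩
      ⟨s, u, update (update ρ b (ρ b - ρ a)) a 0⟩ (ρ a * 2 + 1) := by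
  have := loop (r := a) (c := .dec b) (T := 1)
    (fun k => ⟨s, u, update (update ρ b (ρ b - (ρ a - k))) a k⟩) (ρ a) (by simp) (fun k hk => by
      refine (dec (r := b)).cast rfl (funext fun j => ?_) le_rfl
      simp only [update_apply]
      split_ifs <;> grind)
  refine this.cast (funext fun j => ?_) (funext fun j => ?_) le_rfl <;>
  · simp only [update_apply]
    split_ifs <;> grind

theorem clearReg {a : ℕ} :
    (Cmd.loop a .skip).ExecLe ⟨s, u, ρ⟩ ⟨s, u, update ρ a 0⟩ (ρ a * 2 + 1) := by
  have := loop (r := a) (c := .skip) (T := 1)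
    (fun k => ⟨s, u, update ρ a k⟩) (ρ a) (by simp) (fun k hk => by
      simpa using skip)
  simpa using this

theorem right_iter {a : ℕ} :
    (Cmd.loop a .right).ExecLe ⟨s, u, ρ⟩
      ⟨s.drop (ρ a), (s.take (ρ a)).reverse ++ u, update ρ a 0⟩ (ρ a * 2 + 1) := by
  have := loop (r := a) (c := .right) (T := 1)
    (fun k => ⟨s.drop (ρ a - k), (s.take (ρ a - k)).reverse ++ u, update ρ a k⟩) (ρ a) (by simp)
    (fun k hk => by
      have e : ρ a - k = (ρ a - (k + 1)) + 1 := by omega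
      generalize ρ a - (k + 1) = j at e
      simp only [e, Function.update_idem]
      by_cases hj : j < s.length
      · rw [List.drop_eq_getElem_cons hj, List.take_succ_eq_append_getElem hj]
        rw [List.reverse_append, List.reverse_singleton]
        exact ⟨1, le_rfl, Exec.right_cons _ _ _ _⟩
      · rw [List.drop_eq_nil_of_le (by omega), List.drop_eq_nil_of_le (by omega),
          List.take_of_length_le (by omega), List.take_of_length_le (by omega)]
        exact ⟨1, le_rfl, .right_nil _ _⟩)
  simpa using this

theorem restore : (Cmd.back .skip).ExecLe ⟨s, u, ρ⟩ ⟨u.reverse ++ s, [], ρ⟩ (u.length * 2 + 1) := by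
  induction u generalizing s with
  | nil => exact ⟨1, by simp, .back_nil _ _ _⟩
  | cons a u ih =>
    obtain ⟨t, ht, he⟩ := ih (s := a :: s)
    refine ⟨1 + 1 + t, by rw [List.length_cons]; omega, ?_⟩
    simpa using Exec.back_cons (.skip _) he

theorem count {a : ℕ} : (Cmd.forth (.inc a)).ExecLe ⟨s, u, ρ⟩
    ⟨[], s.reverse ++ u, update ρ a (ρ a + s.length)⟩ (s.length * 2 + 1) := by
  induction s generalizing u ρ with
  | nil => simpa using ⟨1, le_rfl, Exec.forth_nil _ _ _⟩
  | cons x s ih =>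
    obtain ⟨t, ht, he⟩ := ih (u := x :: u) (ρ := update ρ a (ρ a + 1))
    refine ⟨1 + 1 + t, by rw [List.length_cons]; omega, ?_⟩
    have := Exec.forth_cons (.inc a s (x :: u) ρ) he
    simp only [Function.update_self, Function.update_idem] at this
    simpa [add_assoc, add_comm 1] using this

end Cmd.ExecLe

/-- `f`, a function of a string and of numbers, is computed in polynomial time by a stack program
whose registers hold the numbers. -/
def Rep {X ι : Type} (str : X → List α) (V : ι → X → ℕ) (f : X → ℕ) : Prop :=
  -- The bound `B` on the value is needed because values later serve as numbers of loop rounds. The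
  -- program depends only on the register assignment `r` and on `b`. Registers from `b` on are
  -- scratch: they are zero at the start, and at the end all but `b` are zero again, so programs can
  -- be chained.
  ∃ B T : Polynomial ℕ,
    (∀ x N, (str x).length ≤ N → (∀ i, V i x ≤ N) → f x ≤ B.eval N) ∧
    ∀ (r : ι → ℕ) (b : ℕ), (∀ i, r i < b) → ∃ c : Cmd α,
      ∀ (x : X) (ρ : ℕ → ℕ) (N : ℕ), (∀ i, ρ (r i) = V i x) → (∀ j, b ≤ j → ρ j = 0) →
        (str x).length ≤ N → (∀ i, V i x ≤ N) →
        c.ExecLe ⟨str x, [], ρ⟩ ⟨str x, [], update ρ b (f x)⟩ (T.eval N)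

/-- The variables of a context extended by one number. -/
def consVar {X ι : Type} (V : ι → X → ℕ) : Option ι → X × ℕ → ℕ
  | none => Prod.snd
  | some i => V i ∘ Prod.fst

/-! ### Basic functions, arithmetic and bounded sums. -/

namespace Rep

variable {X ι : Type} {str : X → List α} {V : ι → X → ℕ} {f g : X → ℕ}

theorem congr (h : Rep str V f) (e : ∀ x, g x = f x) : Rep str V g := by
  rwa [show g = f from funext e]

theorem comp {Y κ : Type} {W : κ → Y → ℕ} (h : Rep str V f) (φ : Y → X) (e : ι → κ)
    (he : ∀ i y, V i (φ y) = W (e i) y) : Rep (str ∘ φ) W (f ∘ φ) := by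
  obtain ⟨B, T, hB, hT⟩ := h
  refine ⟨B, T, fun y N hs hW => hB _ _ hs fun i => by rw [he]; exact hW _, fun r b hr => ?_⟩
  obtain ⟨c, hc⟩ := hT (r ∘ e) b fun i => hr _
  exact ⟨c, fun y ρ N h₁ h₂ h₃ h₄ => hc (φ y) ρ N (fun i => by rw [he]; exact h₁ _) h₂ h₃
    fun i => by rw [he]; exact h₄ _⟩

theorem weaken (h : Rep str V f) : Rep (str ∘ Prod.fst) (consVar V) (fun p => f p.1) :=
  h.comp Prod.fst some fun _ _ => rfl

theorem const (k : ℕ) : Rep str V fun _ => k := by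
  refine ⟨Polynomial.C k, Polynomial.C (k + 1), by simp, fun r b hr => ?_⟩
  have : ∃ c : Cmd α, ∀ s u ρ, c.ExecLe ⟨s, u, ρ⟩ ⟨s, u, update ρ b (ρ b + k)⟩ (k + 1) := by
    induction k with
    | zero => exact ⟨.skip, fun s u ρ => by simpa using Cmd.ExecLe.skip⟩
    | succ k ih =>
      obtain ⟨c, hc⟩ := ih
      refine ⟨.seq c (.inc b), fun s u ρ => ?_⟩
      refine ((hc s u ρ).seq Cmd.ExecLe.inc).cast rfl ?_ le_rfl
      simp [add_assoc]
  obtain ⟨c, hc⟩ := this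
  refine ⟨c, fun x ρ N h₁ h₂ h₃ h₄ => ?_⟩
  simpa [h₂ b le_rfl] using hc (str x) [] ρ

/-- Registers can only be read destructively: the value is moved to `b` and `b + 1` simultaneously
and then restored from `b + 1`. -/
theorem var (i : ι) : Rep str V (V i) := by
  refine ⟨Polynomial.X, Polynomial.X * 5 + 2, by simp; tauto, fun r b hr => ?_⟩
  refine ⟨.seq (.loop (r i) (.seq (.inc b) (.inc (b + 1)))) (.loop (b + 1) (.inc (r i))),
    fun x ρ N h₁ h₂ h₃ h₄ => ?_⟩
  have hi := hr i
  have hb := h₂ b le_rfl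
  have hb' := h₂ (b + 1) (by omega)
  have A : (Cmd.loop (r i) (.seq (.inc b) (.inc (b + 1)))).ExecLe ⟨str x, [], ρ⟩
      ⟨str x, [], update (update (update ρ b (V i x)) (b + 1) (V i x)) (r i) 0⟩
      (V i x * (1 + 1 + 1) + 1) := by
    have := Cmd.ExecLe.loop (r := r i) (c := .seq (.inc b) (.inc (b + 1))) (T := 1 + 1)
      (fun k => ⟨str x, [], update (update (update ρ b (V i x - k)) (b + 1) (V i x - k)) (r i) k⟩)
      (V i x) (by simp) (fun k hk => by
        refine ((Cmd.ExecLe.inc (r := b)).seq (Cmd.ExecLe.inc (r := b + 1))).cast rfl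
          (funext fun j => ?_) le_rfl
        simp only [update_apply]
        split_ifs <;> grind)
    have := h₁ i
    refine Cmd.ExecLe.cast ‹_› (funext fun j => ?_) (funext fun j => ?_) le_rfl <;>
    · simp only [update_apply]
      split_ifs <;> grind
  have h := A.seq (Cmd.ExecLe.moveReg (a := b + 1) (b := r i) (by omega))
  have hx := h₁ i
  have hN := h₄ i
  refine h.cast rfl (funext fun j => ?_) ?_
  · simp only [update_apply]
    split_ifs <;> grind
  · have e : update (update (update ρ b (V i x)) (b + 1) (V i x)) (r i) 0 (b + 1) = V i x := by
      simp only [update_apply]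
      split_ifs <;> grind
    rw [e]
    simp
    omega

theorem add (hf : Rep str V f) (hg : Rep str V g) : Rep str V fun x => f x + g x := by
  obtain ⟨B, T, hB, hT⟩ := hf
  obtain ⟨B', T', hB', hT'⟩ := hg
  refine ⟨B + B', T + T' + (B' * 2 + 1), fun x N h h' => ?_, fun r b hr => ?_⟩
  · simpa using add_le_add (hB x N h h') (hB' x N h h')
  obtain ⟨c, hc⟩ := hT r b hr
  obtain ⟨c', hc'⟩ := hT' r (b + 1) fun i => (hr i).trans (Nat.lt_succ_self b)
  refine ⟨.seq (.seq c c') (.loop (b + 1) (.inc b)), fun x ρ N h₁ h₂ h₃ h₄ => ?_⟩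
  have A := hc x ρ N h₁ h₂ h₃ h₄
  have A' := hc' x (update ρ b (f x)) N
    (fun i => by rw [Function.update_of_ne (hr i).ne]; exact h₁ i)
    (fun j hj => by rw [Function.update_of_ne (by omega)]; exact h₂ j (by omega)) h₃ h₄
  have h := (A.seq A').seq (Cmd.ExecLe.moveReg (a := b + 1) (b := b) (by omega))
  have hb' := h₂ (b + 1) (by omega)
  have hx := hB' x N h₃ h₄
  have e : update (update ρ b (f x)) (b + 1) (g x) (b + 1) = g x := by simp
  rw [e] at h
  refine h.cast rfl (funext fun j => ?_) ?_
  · simp only [update_apply]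
    split_ifs <;> grind
  · simp only [Polynomial.eval_add, Polynomial.eval_mul, Polynomial.eval_ofNat, Polynomial.eval_one]
    omega

theorem sub (hf : Rep str V f) (hg : Rep str V g) : Rep str V fun x => f x - g x := by
  obtain ⟨B, T, hB, hT⟩ := hf
  obtain ⟨B', T', hB', hT'⟩ := hg
  refine ⟨B, T + T' + (B' * 2 + 1), fun x N h h' => (Nat.sub_le _ _).trans (hB x N h h'),
    fun r b hr => ?_⟩
  obtain ⟨c, hc⟩ := hT r b hr
  obtain ⟨c', hc'⟩ := hT' r (b + 1) fun i => (hr i).trans (Nat.lt_succ_self b)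
  refine ⟨.seq (.seq c c') (.loop (b + 1) (.dec b)), fun x ρ N h₁ h₂ h₃ h₄ => ?_⟩
  have A := hc x ρ N h₁ h₂ h₃ h₄
  have A' := hc' x (update ρ b (f x)) N
    (fun i => by rw [Function.update_of_ne (hr i).ne]; exact h₁ i)
    (fun j hj => by rw [Function.update_of_ne (by omega)]; exact h₂ j (by omega)) h₃ h₄
  have h := (A.seq A').seq (Cmd.ExecLe.subReg (a := b + 1) (b := b) (by omega))
  have hb' := h₂ (b + 1) (by omega)
  have hx := hB' x N h₃ h₄
  have e : update (update ρ b (f x)) (b + 1) (g x) (b + 1) = g x := by simp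
  rw [e] at h
  refine h.cast rfl (funext fun j => ?_) ?_
  · simp only [update_apply]
    split_ifs <;> grind
  · simp only [Polynomial.eval_add, Polynomial.eval_mul, Polynomial.eval_ofNat, Polynomial.eval_one]
    omega

theorem length : Rep str V fun x => (str x).length := by
  refine ⟨Polynomial.X, Polynomial.X * 2 + 1 + (Polynomial.X * 2 + 1), by simp; tauto,
    fun r b hr => ?_⟩
  refine ⟨.seq (.forth (.inc b)) (.back .skip), fun x ρ N h₁ h₂ h₃ h₄ => ?_⟩
  have h := (Cmd.ExecLe.count (s := str x) (u := []) (ρ := ρ) (a := b)).seq Cmd.ExecLe.restore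
  simp only [List.append_nil, List.reverse_reverse, h₂ b le_rfl, zero_add,
    List.length_reverse] at h
  refine h.mono ?_
  simp
  omega

-- The head walks `f x` places to the right, tests the letter and returns. Past the end `right` does
-- nothing and the test fails, in accordance with `getElem?`.
open Classical in
theorem letter (a : α) (hf : Rep str V f) :
    Rep str V fun x => if (str x)[f x]? = some a then 1 else 0 := by
  obtain ⟨B, T, hB, hT⟩ := hf
  refine ⟨1, T + (B * 2 + 1) + 1 + (Polynomial.X * 2 + 1), fun x N h h' => ?_, fun r b hr => ?_⟩
  · simp only [Polynomial.eval_one]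
    split_ifs <;> simp
  obtain ⟨c, hc⟩ := hT r (b + 1) fun i => (hr i).trans (Nat.lt_succ_self b)
  refine ⟨.seq (.seq (.seq c (.loop (b + 1) .right)) (.test a b)) (.back .skip),
    fun x ρ N h₁ h₂ h₃ h₄ => ?_⟩
  have hb := h₂ b le_rfl
  have hb' := h₂ (b + 1) (by omega)
  have A := hc x ρ N h₁ (fun j hj => h₂ j (by omega)) h₃ h₄
  have A₁ := A.seq (Cmd.ExecLe.right_iter (a := b + 1))
  simp only [Function.update_self, Function.update_idem, List.append_nil] at A₁
  have e : update ρ (b + 1) 0 = ρ := by rw [← hb', Function.update_eq_self]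
  rw [e] at A₁
  have A₂ : (Cmd.test a b).ExecLe ⟨(str x).drop (f x), ((str x).take (f x)).reverse, ρ⟩
      ⟨(str x).drop (f x), ((str x).take (f x)).reverse,
        update ρ b (if (str x)[f x]? = some a then 1 else 0)⟩ 1 := by
    by_cases h : (str x)[f x]? = some a
    · have := Cmd.Exec.test_pos a b ((str x).drop (f x)) ((str x).take (f x)).reverse ρ
        (by rw [List.head?_drop, h])
      simp only [hb, zero_add] at this
      simpa [h] using ⟨1, le_rfl, this⟩
    · have := Cmd.Exec.test_neg a b ((str x).drop (f x)) ((str x).take (f x)).reverse ρ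
        (by rwa [List.head?_drop])
      have e : update ρ b 0 = ρ := by rw [← hb, Function.update_eq_self]
      simpa [h, e] using ⟨1, le_rfl, this⟩
  have A₃ := (A₁.seq A₂).seq Cmd.ExecLe.restore
  simp only [List.reverse_reverse, List.take_append_drop] at A₃
  refine A₃.mono ?_
  have := hB x N h₃ h₄
  simp only [Polynomial.eval_add, Polynomial.eval_mul, Polynomial.eval_ofNat, Polynomial.eval_one,
    List.length_reverse, List.length_take, Polynomial.eval_X]
  omega

/-- A loop with the accumulator in `b`, the number of remaining rounds in `b + 1`, the summation
index in `b + 2` and the current summand in `b + 3`. The index is a variable of the extended context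
bounded only by `B`, which is why the polynomials of `g` are composed with `X + B`. -/
theorem sum {g : X → ℕ → ℕ} (hf : Rep str V f)
    (hg : Rep (str ∘ Prod.fst) (consVar V) fun p : X × ℕ => g p.1 p.2) :
    Rep str V fun x => ∑ i ∈ Finset.range (f x), g x i := by
  obtain ⟨B, T, hB, hT⟩ := hf
  obtain ⟨B', T', hB', hT'⟩ := hg
  have hbd : ∀ x N i, (str x).length ≤ N → (∀ i, V i x ≤ N) → i ≤ f x →
      (∀ j, consVar V j (x, i) ≤ N + B.eval N) := by
    intro x N i h h' hi j
    cases j with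
    | none => exact (hi.trans (hB x N h h')).trans (Nat.le_add_left _ _)
    | some j => exact (h' j).trans (Nat.le_add_right _ _)
  have hv : ∀ x N i, (str x).length ≤ N → (∀ i, V i x ≤ N) → i ≤ f x →
      g x i ≤ (B'.comp (Polynomial.X + B)).eval N := by
    intro x N i h h' hi
    simp only [Polynomial.eval_comp, Polynomial.eval_add, Polynomial.eval_X]
    exact hB' (x, i) _ (h.trans (Nat.le_add_right _ _)) (hbd x N i h h' hi)
  refine ⟨B * B'.comp (Polynomial.X + B),
    T + (B * (T'.comp (Polynomial.X + B) + (B'.comp (Polynomial.X + B) * 2 + 1) + 1 + 1) + 1) +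
      (B * 2 + 1), fun x N h h' => ?_, fun r b hr => ?_⟩
  · rw [Polynomial.eval_mul]
    calc ∑ i ∈ Finset.range (f x), g x i
        ≤ (Finset.range (f x)).card • (B'.comp (Polynomial.X + B)).eval N :=
          Finset.sum_le_card_nsmul _ _ _ fun i hi =>
            hv x N i h h' (Finset.mem_range.mp hi).le
      _ ≤ _ := by
          rw [Finset.card_range, smul_eq_mul]
          exact Nat.mul_le_mul_right _ (hB x N h h')
  obtain ⟨c, hc⟩ := hT r (b + 1) fun i => (hr i).trans (Nat.lt_succ_self b)
  obtain ⟨c', hc'⟩ := hT' (fun o => o.elim (b + 2) r) (b + 3) (fun o => by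
    cases o with
    | none => exact Nat.lt_succ_self _
    | some i => exact (hr i).trans (by omega))
  refine ⟨.seq (.seq c (.loop (b + 1)
    (.seq (.seq c' (.loop (b + 3) (.inc b))) (.inc (b + 2))))) (.loop (b + 2) .skip),
    fun x ρ N h₁ h₂ h₃ h₄ => ?_⟩
  have hb := h₂ b le_rfl
  have hb₁ := h₂ (b + 1) (by omega)
  have hb₂ := h₂ (b + 2) (by omega)
  have hb₃ := h₂ (b + 3) (by omega)
  have A := hc x ρ N h₁ (fun j hj => h₂ j (by omega)) h₃ h₄
  -- The loop invariant: `k` rounds remain and the summands with index below `i` have been added.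
  let st : ℕ → ℕ → ℕ → ℕ := fun k i => update (update (update ρ b
    (∑ j ∈ Finset.range i, g x j)) (b + 2) i) (b + 1) k
  have body : ∀ k < f x, (Cmd.seq (.seq c' (.loop (b + 3) (.inc b))) (.inc (b + 2))).ExecLe
      ⟨str x, [], st k (f x - (k + 1))⟩ ⟨str x, [], st k (f x - k)⟩
      ((T'.comp (Polynomial.X + B)).eval N + ((B'.comp (Polynomial.X + B)).eval N * 2 + 1) + 1) := by
    intro k hk
    have e : f x - k = (f x - (k + 1)) + 1 := by omega
    have hi : f x - (k + 1) ≤ f x := by omega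
    rw [e]
    generalize f x - (k + 1) = i at hi
    have A₁ := hc' (x, i) (st k i) (N + B.eval N) (fun o => by
        cases o with
        | none => simp [st, consVar]
        | some j =>
          have := hr j
          simp only [st, consVar, Option.elim, Function.comp]
          rw [Function.update_of_ne (by omega), Function.update_of_ne (by omega),
            Function.update_of_ne (by omega), h₁])
      (fun j hj => by
        simp only [st]
        rw [Function.update_of_ne (by omega), Function.update_of_ne (by omega),
          Function.update_of_ne (by omega), h₂ j (by omega)])
      (h₃.trans (Nat.le_add_right _ _)) (hbd x N i h₃ h₄ hi)
    have A₂ := (A₁.seq (Cmd.ExecLe.moveReg (a := b + 3) (b := b) (by omega))).seq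
      (Cmd.ExecLe.inc (r := b + 2))
    simp only [Function.comp, Function.update_self] at A₂
    refine A₂.cast rfl (funext fun j => ?_) ?_
    · simp only [st, update_apply, Finset.sum_range_succ]
      split_ifs <;> grind
    · have := hv x N i h₃ h₄ hi
      simp only [Polynomial.eval_comp, Polynomial.eval_add, Polynomial.eval_X] at this ⊢
      omega
  have A₁ := Cmd.ExecLe.loop (r := b + 1) (fun k => ⟨str x, [], st k (f x - k)⟩) (f x)
    (by simp [st]) (fun k hk => by
      convert body k hk using 2
      simp only [st, Function.update_idem])
  have e₀ : st (f x) (f x - f x) = update ρ (b + 1) (f x) := by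
    funext j
    simp only [st, update_apply, Nat.sub_self, Finset.range_zero, Finset.sum_empty]
    split_ifs <;> grind
  simp only [e₀] at A₁
  have A₂ := (A.seq A₁).seq (Cmd.ExecLe.clearReg (a := b + 2))
  have e₁ : st 0 (f x - 0) (b + 2) = f x := by simp [st]
  rw [e₁] at A₂
  refine A₂.cast rfl (funext fun j => ?_) ?_
  · simp only [st, update_apply, Nat.sub_zero]
    split_ifs <;> grind
  · have := hB x N h₃ h₄
    simp only [Polynomial.eval_add, Polynomial.eval_mul, Polynomial.eval_ofNat,
      Polynomial.eval_one]
    gcongr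

end Rep

open Classical in
theorem InP.of_rep [Fintype α] [Inhabited α] {L : Set (List α)} {ι : Type} [IsEmpty ι]
    {V : ι → List α → ℕ} (h : Rep id V fun s : List α => if s ∈ L then 1 else 0) : InP L := by
  obtain ⟨B, T, -, hT⟩ := h
  obtain ⟨c, hc⟩ := hT isEmptyElim 0 isEmptyElim
  exact InP.of_cmd c T fun s => hc s (fun _ => 0) _ isEmptyElim (fun _ _ => rfl) le_rfl isEmptyElim

end Complexity

/-! ### Closure properties of the class of polynomial time functions and predicates -/

namespace Complexity

variable {α X ι : Type} {str : X → List α} {V : ι → X → ℕ} {f g : X → ℕ} {P Q : X → Prop}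

open Classical in
/-- The indicator function of `P` is computed in polynomial time. -/
def RepP (str : X → List α) (V : ι → X → ℕ) (P : X → Prop) : Prop :=
  Rep str V fun x => if P x then 1 else 0

theorem RepP.congr (h : RepP str V P) (e : ∀ x, Q x ↔ P x) : RepP str V Q := by
  rwa [show Q = P from funext fun x => propext (e x)]

theorem Rep.newVar : Rep (str ∘ Prod.fst) (consVar V) Prod.snd := Rep.var (V := consVar V) none

/-- Truncated subtraction makes 1 - (f - g) the indicator of f ≤ g; the Boolean connectives are
likewise arithmetic of indicators. -/
theorem RepP.le (hf : Rep str V f) (hg : Rep str V g) : RepP str V fun x => f x ≤ g x :=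
  ((Rep.const 1).sub (hf.sub hg)).congr fun x => by split_ifs <;> omega

theorem RepP.not (h : RepP str V P) : RepP str V fun x => ¬ P x :=
  ((Rep.const 1).sub h).congr fun x => by by_cases hx : P x <;> simp [hx]

theorem RepP.and (h : RepP str V P) (h' : RepP str V Q) : RepP str V fun x => P x ∧ Q x :=
  ((Rep.add h h').sub (Rep.const 1)).congr fun x => by
    by_cases hx : P x <;> by_cases hx' : Q x <;> simp [hx, hx']

theorem RepP.or (h : RepP str V P) (h' : RepP str V Q) : RepP str V fun x => P x ∨ Q x :=
  (h.not.and h'.not).not.congr fun x => by tauto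

theorem RepP.imp (h : RepP str V P) (h' : RepP str V Q) : RepP str V fun x => P x → Q x :=
  (h.not.or h').congr fun x => by tauto

theorem RepP.const (p : Prop) : RepP str V fun _ => p := Rep.const _

theorem RepP.lt (hf : Rep str V f) (hg : Rep str V g) : RepP str V fun x => f x < g x :=
  (RepP.le hg hf).not.congr fun _ => not_le.symm

theorem RepP.eq (hf : Rep str V f) (hg : Rep str V g) : RepP str V fun x => f x = g x :=
  ((RepP.le hf hg).and (RepP.le hg hf)).congr fun _ => le_antisymm_iff

theorem Rep.mul (hf : Rep str V f) (hg : Rep str V g) : Rep str V fun x => f x * g x :=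
  (Rep.sum (g := fun x _ => g x) hf hg.weaken).congr fun x => by simp

theorem Rep.pow (hf : Rep str V f) : ∀ k : ℕ, Rep str V fun x => f x ^ k
  | 0 => (Rep.const 1).congr fun _ => pow_zero _
  | k + 1 => ((hf.pow k).mul hf).congr fun _ => pow_succ _ _

open Classical in
theorem Rep.ite (h : RepP str V P) (hf : Rep str V f) (hg : Rep str V g) :
    Rep str V fun x => if P x then f x else g x :=
  ((Rep.mul h hf).add (Rep.mul h.not hg)).congr fun x => by by_cases hx : P x <;> simp [hx]

theorem RepP.exists_lt {P : X → ℕ → Prop} (hf : Rep str V f)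
    (h : RepP (str ∘ Prod.fst) (consVar V) fun p : X × ℕ => P p.1 p.2) :
    RepP str V fun x => ∃ i < f x, P x i := by
  classical
  refine (RepP.lt (Rep.const 0) (Rep.sum (g := fun x i => if P x i then 1 else 0) hf h)).congr
    fun x => ?_
  rw [Finset.sum_boole, Nat.cast_id, Finset.card_pos]
  simp [Finset.Nonempty]

theorem RepP.forall_lt {P : X → ℕ → Prop} (hf : Rep str V f)
    (h : RepP (str ∘ Prod.fst) (consVar V) fun p : X × ℕ => P p.1 p.2) :
    RepP str V fun x => ∀ i < f x, P x i :=
  (RepP.exists_lt (P := fun x i => ¬ P x i) hf h.not).not.congr fun x => by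
    push Not
    rfl

theorem Rep.finsum {β : Type} (S : Finset β) {F : β → X → ℕ} (h : ∀ b, Rep str V (F b)) :
    Rep str V fun x => ∑ b ∈ S, F b x := by
  classical
  induction S using Finset.induction_on with
  | empty => exact (Rep.const 0).congr fun x => by simp
  | insert b S hb ih => exact ((h b).add ih).congr fun x => by rw [Finset.sum_insert hb]

theorem RepP.exists_fin {β : Type} [Fintype β] {F : β → X → Prop} (h : ∀ b, RepP str V (F b)) :
    RepP str V fun x => ∃ b, F b x := by
  classical
  refine (RepP.lt (Rep.const 0) (Rep.finsum Finset.univ h)).congr fun x => ?_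
  rw [Finset.sum_boole, Nat.cast_id, Finset.card_pos]
  simp [Finset.Nonempty]

theorem RepP.forall_fin {β : Type} [Fintype β] {F : β → X → Prop} (h : ∀ b, RepP str V (F b)) :
    RepP str V fun x => ∀ b, F b x :=
  (RepP.exists_fin fun b => (h b).not).not.congr fun x => by
    push Not
    rfl

theorem RepP.indicator [DecidablePred P] (h : RepP str V P) :
    Rep str V fun x => if P x then 1 else 0 :=
  Rep.congr h fun x => by congr

/-- For positive g the quotient counts the i < f with (i + 1) g ≤ f, so it is a bounded sum of
indicators. -/
theorem Rep.div (hf : Rep str V f) (hg : Rep str V g) : Rep str V fun x => f x / g x := by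
  classical
  have h : RepP (str ∘ Prod.fst) (consVar V) fun p => (p.2 + 1) * g p.1 ≤ f p.1 :=
    RepP.le ((Rep.newVar.add (Rep.const 1)).mul hg.weaken) hf.weaken
  refine (Rep.ite (RepP.lt (Rep.const 0) hg) (Rep.sum hf (g := fun x i =>
    if (i + 1) * g x ≤ f x then 1 else 0) h.indicator) (Rep.const 0)).congr fun x => ?_
  by_cases hx : 0 < g x
  · simp only [hx, if_true, Finset.sum_boole, Nat.cast_id]
    have : (Finset.range (f x)).filter (fun i => (i + 1) * g x ≤ f x) =
        Finset.range (f x / g x) := by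
      ext i
      simp only [Finset.mem_filter, Finset.mem_range, ← Nat.le_div_iff_mul_le hx,
        Nat.succ_le_iff]
      exact ⟨fun h => h.2, fun h => ⟨h.trans_le (Nat.div_le_self _ _), h⟩⟩
    rw [this, Finset.card_range]
  · simp [Nat.eq_zero_of_not_pos hx]

theorem Rep.mod (hf : Rep str V f) (hg : Rep str V g) : Rep str V fun x => f x % g x :=
  (hf.sub (hg.mul (hf.div hg))).congr fun x => by
    have := Nat.div_add_mod (f x) (g x)
    omega

theorem RepP.dvd (hf : Rep str V f) (hg : Rep str V g) : RepP str V fun x => f x ∣ g x :=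
  (RepP.eq (hg.mod hf) (Rep.const 0)).congr fun _ => Nat.dvd_iff_mod_eq_zero

theorem RepP.modEq {d : X → ℕ} (hd : Rep str V d) (hf : Rep str V f) (hg : Rep str V g) :
    RepP str V fun x => f x ≡ g x [MOD d x] :=
  RepP.eq (hf.mod hd) (hg.mod hd)

/-- The letter at a given position belongs to a given set. -/
theorem RepP.letter [Fintype α] (S : α → Prop) (hf : Rep str V f) :
    RepP str V fun x => ∃ a, (str x)[f x]? = some a ∧ S a :=
  RepP.exists_fin fun a => RepP.and ((Rep.letter a hf).congr fun x => by congr) (RepP.const (S a))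

end Complexity

/-! ### Separating integer vectors from lattices by characters of small order -/

namespace Lattice

open Matrix

/-- A bound for the order of the characters that separate vectors of norm at most `N` from a lattice
generated by such vectors. -/
def sepBound (n N : ℕ) : ℕ :=
  (n.factorial * N ^ n) * ((n.factorial * N ^ n) * N * (1 + n * n * N) + 1)

variable {n : ℕ} {ι : Type*}

/-- A maximal non-vanishing minor of a family of integer vectors. -/
theorem exists_maximal_minor (c : ι → Fin n → ℤ) :
    ∃ (r : ℕ) (i : Fin r → ι) (J : Fin r → Fin n), r ≤ n ∧
      (Matrix.of fun a b => c (i a) (J b)).det ≠ 0 ∧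
      ∀ (i' : Fin (r + 1) → ι) (J' : Fin (r + 1) → Fin n),
        (Matrix.of fun a b => c (i' a) (J' b)).det = 0 := by
  classical
  let p : ℕ → Prop := fun r => ∃ (i : Fin r → ι) (J : Fin r → Fin n),
    (Matrix.of fun a b => c (i a) (J b)).det ≠ 0
  have hp : ∀ r, p r → r ≤ n := by
    rintro r ⟨i, J, h⟩
    have : Function.Injective J := by
      intro a b hab
      by_contra hne
      exact h (Matrix.det_zero_of_column_eq hne fun k => by simp [hab])
    simpa using Fintype.card_le_of_injective J this
  -- The empty minor equals 1, so a maximal order exists even for an empty or zero family.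
  have h0 : p 0 := ⟨Fin.elim0, Fin.elim0, by simp⟩
  obtain ⟨i, J, h⟩ := Nat.findGreatest_spec (P := p) (Nat.zero_le n) h0
  refine ⟨_, i, J, Nat.findGreatest_le n, h, fun i' J' => ?_⟩
  by_contra hne
  have h' : p (Nat.findGreatest p n + 1) := ⟨i', J', hne⟩
  exact absurd (Nat.le_findGreatest (hp _ h') h') (by omega)

/-- Cramer's rule for the vectors of a family with a given maximal minor. -/
theorem cramer_of_maximal_minor (c : ι → Fin n → ℤ) {r : ℕ} (i : Fin r → ι) (J : Fin r → Fin n)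
    (hD : (Matrix.of fun a b => c (i a) (J b)).det ≠ 0)
    (hmax : ∀ (i' : Fin (r + 1) → ι) (J' : Fin (r + 1) → Fin n),
      (Matrix.of fun a b => c (i' a) (J' b)).det = 0) (k : ι) (j : Fin n) :
    (Matrix.of fun a b => c (i a) (J b)).det * c k j =
      ∑ a, (∑ b, c k (J b) * (Matrix.of fun a b => c (i a) (J b)).adjugate b a) * c (i a) j := by
  set M : Matrix (Fin r) (Fin r) ℤ := Matrix.of fun a b => c (i a) (J b) with hM
  let A : Matrix (Fin r) (Fin r) ℚ := M.map (Int.castRingHom ℚ)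
  have hA : A.det = (M.det : ℚ) := (RingHom.map_det (Int.castRingHom ℚ) M).symm
  have hA0 : A.det ≠ 0 := by rw [hA]; exact_mod_cast hD
  let e : Fin (r + 1) ≃ Fin r ⊕ Unit := (Fintype.equivFinOfCardEq (by simp)).symm
  let i' : Fin r ⊕ Unit → ι := Sum.elim i fun _ => k
  let J' : Fin r ⊕ Unit → Fin n := Sum.elim J fun _ => j
  -- The minor bordered by row `k` and column `j` vanishes by maximality. Over ℚ its Schur
  -- complement with respect to `A` must then vanish, which is the asserted identity after clearing
  -- the determinant.
  have h1 : (Matrix.of fun a b : Fin r ⊕ Unit => (c (i' a) (J' b) : ℚ)).det = 0 := by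
    have h := hmax (i' ∘ e) (J' ∘ e)
    have h2 := Matrix.det_submatrix_equiv_self e
      (Matrix.of fun a b : Fin r ⊕ Unit => c (i' a) (J' b))
    have h3 := RingHom.map_det (Int.castRingHom ℚ)
      (Matrix.of fun a b : Fin r ⊕ Unit => c (i' a) (J' b))
    rw [← h2] at h3
    have h4 : ((Matrix.of fun a b : Fin r ⊕ Unit => c (i' a) (J' b)).submatrix e e).det = 0 := h
    rw [h4, map_zero] at h3
    exact h3.symm
  have h2 : (Matrix.of fun a b : Fin r ⊕ Unit => (c (i' a) (J' b) : ℚ)) =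
      Matrix.fromBlocks A (Matrix.of fun a _ => (c (i a) j : ℚ))
        (Matrix.of fun _ b => (c k (J b) : ℚ)) (Matrix.of fun _ _ => (c k j : ℚ)) := by
    ext a b
    rcases a with a | a <;> rcases b with b | b <;> rfl
  let _ := Matrix.invertibleOfIsUnitDet A (isUnit_iff_ne_zero.mpr hA0)
  rw [h2, Matrix.det_fromBlocks₁₁, mul_eq_zero, or_iff_right hA0, Matrix.det_unique,
    Matrix.sub_apply, Matrix.of_apply, sub_eq_zero, Matrix.invOf_eq_nonsing_inv, Matrix.inv_def,
    Ring.inverse_eq_inv', Matrix.mul_smul, Matrix.smul_mul, Matrix.smul_apply, smul_eq_mul,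
    eq_inv_mul_iff_mul_eq₀ hA0, hA] at h1
  have h3 : A.adjugate = M.adjugate.map (Int.castRingHom ℚ) :=
    (RingHom.map_adjugate (Int.castRingHom ℚ) M).symm
  rw [h3] at h1
  simp only [Matrix.mul_apply, Matrix.of_apply, Matrix.map_apply, eq_intCast] at h1
  exact_mod_cast h1

theorem abs_det_le {r N : ℕ} (hr : r ≤ n) (hN : 1 ≤ N) (A : Matrix (Fin r) (Fin r) ℤ)
    (h : ∀ a b, |A a b| ≤ N) : |A.det| ≤ (n.factorial * N ^ n : ℕ) := by
  have := Matrix.det_le (abv := AbsoluteValue.abs) (A := A) (x := (N : ℤ)) h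
  simp only [Fintype.card_fin, AbsoluteValue.abs_apply, nsmul_eq_mul] at this
  refine this.trans ?_
  push_cast
  have h1 : (r.factorial : ℤ) ≤ n.factorial := by exact_mod_cast Nat.factorial_le hr
  have h2 : (N : ℤ) ^ r ≤ N ^ n := pow_le_pow_right₀ (by exact_mod_cast hN) hr
  gcongr

/-- An entry of the adjugate is the determinant of the matrix with one row replaced by a unit
vector, and `1 ≤ N` keeps the entries bounded by `N`. -/
theorem abs_adjugate_le {r N : ℕ} (hr : r ≤ n) (hN : 1 ≤ N) (A : Matrix (Fin r) (Fin r) ℤ)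
    (h : ∀ a b, |A a b| ≤ N) (a b : Fin r) : |A.adjugate a b| ≤ (n.factorial * N ^ n : ℕ) := by
  rw [Matrix.adjugate_apply]
  refine abs_det_le hr hN _ fun a' b' => ?_
  rw [Matrix.updateRow_apply]
  split_ifs
  · rw [Pi.single_apply]
    split_ifs
    · simpa using hN
    · simp
  · exact h a' b'

/-- A character of `ℤⁿ ⧸ L` that does not vanish on `v`, for a subgroup `L` that contains `dℤⁿ`. -/
theorem exists_character (L : AddSubgroup (Fin n → ℤ)) {d : ℕ} (hd : 0 < d)
    (hL : ∀ z : Fin n → ℤ, (d : ℤ) • z ∈ L) {v : Fin n → ℤ} (hv : v ∉ L) :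
    ∃ χ : Fin n → ℕ, (∀ l, χ l < d) ∧ (∀ z ∈ L, (d : ℤ) ∣ ∑ l, χ l * z l) ∧
      ¬ (d : ℤ) ∣ ∑ l, χ l * v l := by
  -- Characters with values in ℚ/ℤ separate the points of every abelian group.
  obtain ⟨φ, hφ⟩ := CharacterModule.exists_character_apply_ne_zero_of_ne_zero
    (a := (QuotientAddGroup.mk v : (Fin n → ℤ) ⧸ L))
    (by rwa [Ne, QuotientAddGroup.eq_zero_iff])
  let ψ : (Fin n → ℤ) →+ AddCircle (1 : ℚ) := φ.comp (QuotientAddGroup.mk' L)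
  have hψL : ∀ z ∈ L, ψ z = 0 := fun z hz => by
    change φ (QuotientAddGroup.mk z) = 0
    rw [(QuotientAddGroup.eq_zero_iff z).mpr hz, map_zero]
  have hd' : (d : ℚ) ≠ 0 := by exact_mod_cast hd.ne'
  -- The quotient is killed by `d`, so the character takes values in (1/d)ℤ/ℤ. The numerators are
  -- reduced modulo `d` at the end.
  have hm : ∀ l, ∃ m : ℤ, ψ (Pi.single l 1) = ((m / d : ℚ) : AddCircle (1 : ℚ)) := by
    intro l
    obtain ⟨q, hq⟩ := QuotientAddGroup.mk_surjective (ψ (Pi.single l 1))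
    have h := hψL _ (hL (Pi.single l 1))
    rw [map_zsmul, ← hq] at h
    change ((d : ℤ) • ((q : ℚ) : AddCircle (1 : ℚ))) = 0 at h
    rw [← AddCircle.coe_zsmul, AddCircle.coe_eq_zero_iff] at h
    obtain ⟨m, hm⟩ := h
    refine ⟨m, ?_⟩
    rw [← hq]
    change ((q : ℚ) : AddCircle (1 : ℚ)) = _
    congr 1
    simp only [zsmul_eq_mul, mul_one, Int.cast_natCast] at hm
    rw [hm]
    field_simp
  choose m hm using hm
  have hψ : ∀ z, ψ z = 0 ↔ (d : ℤ) ∣ ∑ l, m l * z l := by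
    intro z
    have h1 : z = ∑ l, z l • (Pi.single l (1 : ℤ) : Fin n → ℤ) := by
      ext l
      simp [Finset.sum_apply, Pi.single_apply]
    have h2 : ψ z = (((∑ l, m l * z l : ℤ) / d : ℚ) : AddCircle (1 : ℚ)) := by
      conv_lhs => rw [h1]
      rw [map_sum]
      simp only [map_zsmul, hm, ← AddCircle.coe_zsmul]
      rw [← QuotientAddGroup.mk_sum]
      congr 1
      push_cast
      rw [Finset.sum_div]
      exact Finset.sum_congr rfl fun l _ => by rw [zsmul_eq_mul]; ring
    rw [h2, AddCircle.coe_eq_zero_iff]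
    constructor
    · rintro ⟨t, ht⟩
      refine ⟨t, ?_⟩
      rw [zsmul_eq_mul, mul_one, eq_div_iff hd'] at ht
      rw [mul_comm]
      exact_mod_cast ht.symm
    · rintro ⟨t, ht⟩
      refine ⟨t, ?_⟩
      rw [ht, zsmul_eq_mul, mul_one, eq_div_iff hd']
      push_cast
      ring
  have hmod : ∀ z : Fin n → ℤ, (d : ℤ) ∣ ∑ l, ((m l % d).toNat : ℤ) * z l ↔
      (d : ℤ) ∣ ∑ l, m l * z l := by
    intro z
    have : (∑ l, ((m l % d).toNat : ℤ) * z l) ≡ ∑ l, m l * z l [ZMOD d] := by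
      refine Int.ModEq.sum fun l _ => Int.ModEq.mul_right _ ?_
      rw [Int.toNat_of_nonneg (Int.emod_nonneg _ (by exact_mod_cast hd.ne'))]
      exact Int.mod_modEq _ _
    rw [← Int.modEq_zero_iff_dvd, ← Int.modEq_zero_iff_dvd]
    exact ⟨this.symm.trans, this.trans⟩
  refine ⟨fun l => (m l % d).toNat, fun l => ?_, fun z hz => ?_, fun h => ?_⟩
  · have h1 := Int.emod_nonneg (m l) (b := d) (by exact_mod_cast hd.ne')
    have h2 := Int.emod_lt_of_pos (m l) (b := d) (by exact_mod_cast hd)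
    change (m l % d).toNat < d
    omega
  · exact (hmod z).mpr ((hψ z).mp (hψL z hz))
  · exact hφ ((hψ v).mpr ((hmod v).mp h))

/-- Characters of small order separate small vectors from lattices generated by small vectors. -/
theorem exists_separating_character (c : ι → Fin n → ℤ) {N : ℕ} (hN : 1 ≤ N)
    (hc : ∀ i l, |c i l| ≤ N) {v : Fin n → ℤ} (hv : ∀ l, |v l| ≤ N)
    (hvL : v ∉ AddSubgroup.closure (Set.range c)) :
    ∃ d, 0 < d ∧ d ≤ sepBound n N ∧ ∃ χ : Fin n → ℕ, (∀ l, χ l < d) ∧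
      (∀ i, (d : ℤ) ∣ ∑ l, χ l * c i l) ∧ ¬ (d : ℤ) ∣ ∑ l, χ l * v l := by
  obtain ⟨r, i, J, hr, hD, hmax⟩ := exists_maximal_minor c
  have hcr := cramer_of_maximal_minor c i J hD hmax
  have hDle := abs_det_le hr hN _ (fun a b => hc (i a) (J b))
  have hAle := abs_adjugate_le hr hN (Matrix.of fun a b => c (i a) (J b))
    (fun a b => hc (i a) (J b))
  set K := n.factorial * N ^ n with hK
  set M : Matrix (Fin r) (Fin r) ℤ := Matrix.of fun a b => c (i a) (J b) with hM
  set L := AddSubgroup.closure (Set.range c) with hLdef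
  -- `E` exceeds every entry of `U v`. The map `u` below is the defect in Cramer's rule: it vanishes
  -- on `L`, and the determinant times any element of its kernel lies in `L`.
  let E : ℕ := K * N * (1 + n * n * N) + 1
  let u : (Fin n → ℤ) → Fin n → ℤ := fun z j =>
    M.det * z j - ∑ a, (∑ b, z (J b) * M.adjugate b a) * c (i a) j
  have hu_add : ∀ z w, u (z + w) = u z + u w := by
    intro z w
    ext j
    simp only [u, Pi.add_apply, mul_add, add_mul, Finset.sum_add_distrib]
    ring
  let U : (Fin n → ℤ) →+ (Fin n → ℤ) := AddMonoidHom.mk' u hu_add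
  have hUL : ∀ z ∈ L, U z = 0 := by
    intro z hz
    have : L ≤ U.ker := by
      rw [hLdef, AddSubgroup.closure_le]
      rintro _ ⟨k, rfl⟩
      change U (c k) = 0
      ext j
      change M.det * c k j - _ = 0
      rw [hcr k j, sub_self]
    exact this hz
  have hDL : ∀ z, U z = 0 → M.det • z ∈ L := by
    intro z hz
    have : M.det • z = ∑ a, (∑ b, z (J b) * M.adjugate b a) • c (i a) := by
      ext j
      have h : M.det * z j - ∑ a, (∑ b, z (J b) * M.adjugate b a) * c (i a) j = 0 :=
        congrFun hz j
      simpa [Finset.sum_apply] using sub_eq_zero.mp h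
    rw [this]
    exact sum_mem fun a _ => L.zsmul_mem (AddSubgroup.subset_closure ⟨_, rfl⟩) _
  have hUv : ∀ j, |U v j| < E := by
    intro j
    have h1 : |M.det * v j| ≤ K * N := by
      rw [abs_mul]
      exact mul_le_mul hDle (hv j) (abs_nonneg _) (by positivity)
    have h2 : |∑ a, (∑ b, v (J b) * M.adjugate b a) * c (i a) j| ≤ n * (n * (N * K) * N) := by
      refine (Finset.abs_sum_le_sum_abs _ _).trans ?_
      have h3 : ∀ a ∈ Finset.univ, |(∑ b, v (J b) * M.adjugate b a) * c (i a) j| ≤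
          (n * (N * K) * N : ℤ) := by
        intro a _
        rw [abs_mul]
        refine mul_le_mul ?_ (hc _ _) (abs_nonneg _) (by positivity)
        refine (Finset.abs_sum_le_sum_abs _ _).trans ?_
        have h4 : ∀ b ∈ Finset.univ, |v (J b) * M.adjugate b a| ≤ (N * K : ℤ) := by
          intro b _
          rw [abs_mul]
          exact mul_le_mul (hv _) (hAle b a) (abs_nonneg _) (by positivity)
        refine (Finset.sum_le_card_nsmul _ _ _ h4).trans ?_
        rw [Finset.card_univ, Fintype.card_fin, nsmul_eq_mul]
        have : (r : ℤ) ≤ n := by exact_mod_cast hr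
        gcongr
      refine (Finset.sum_le_card_nsmul _ _ _ h3).trans ?_
      rw [Finset.card_univ, Fintype.card_fin, nsmul_eq_mul]
      have : (r : ℤ) ≤ n := by exact_mod_cast hr
      gcongr
    change |M.det * v j - ∑ a, (∑ b, v (J b) * M.adjugate b a) * c (i a) j| < E
    refine lt_of_le_of_lt ((abs_sub _ _).trans (add_le_add h1 h2)) ?_
    simp only [E]
    push_cast
    nlinarith
  have hE : 0 < E := Nat.succ_pos _
  -- If v = l + d z with l in L, then U v = d U z. Its entries are smaller than E ≤ d, so U z = 0,
  -- hence det · z and with it d z lie in L, and so does v. Thus v remains outside L + dℤⁿ, where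
  -- characters of order dividing `d` suffice.
  let d := M.det.natAbs * E
  have hd : 0 < d := Nat.mul_pos (Int.natAbs_pos.mpr hD) hE
  let L' : AddSubgroup (Fin n → ℤ) := L ⊔ (zsmulAddGroupHom (d : ℤ)).range
  have hvL' : v ∉ L' := by
    intro h
    obtain ⟨l, hl, w, ⟨z, rfl⟩, hlw⟩ := AddSubgroup.mem_sup.mp h
    have hlw : l + (d : ℤ) • z = v := hlw
    have hUz : U z = 0 := by
      have h1 : U v = (d : ℤ) • U z := by rw [← hlw, map_add, hUL l hl, zero_add, map_zsmul]
      ext j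
      have h2 := hUv j
      rw [h1, Pi.smul_apply, smul_eq_mul, abs_mul, Nat.abs_cast] at h2
      by_contra hne
      have h3 : 1 ≤ |U z j| := Int.one_le_abs hne
      have h4 : (E : ℤ) ≤ d := by
        exact_mod_cast Nat.le_mul_of_pos_left E (Int.natAbs_pos.mpr hD)
      nlinarith
    refine hvL ?_
    rw [← hlw]
    refine L.add_mem hl ?_
    have h1 : (d : ℤ) • z = (E * M.det.sign : ℤ) • (M.det • z) := by
      rw [smul_smul]
      congr 1
      simp only [d]
      push_cast
      rw [Int.abs_eq_natAbs, ← Int.sign_mul_self_eq_natAbs]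
      ring
    rw [h1]
    exact L.zsmul_mem (hDL z hUz) _
  obtain ⟨χ, h1, h2, h3⟩ := exists_character L' hd
    (fun z => (le_sup_right : _ ≤ L') ⟨z, rfl⟩) hvL'
  refine ⟨d, hd, ?_, χ, h1, fun i => h2 _ ((le_sup_left : L ≤ L')
    (AddSubgroup.subset_closure ⟨i, rfl⟩)), h3⟩
  have : M.det.natAbs ≤ K := by
    rw [Int.abs_eq_natAbs] at hDle
    exact_mod_cast hDle
  exact Nat.mul_le_mul_right E this

end Lattice

/-! ### Conjugating the factors of a product -/

section Absorption

open scoped commutatorElement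

variable {G : Type*} [Group G]

/-- `p` is the product of the factors before the `i`-th. It is independent of `q`, so the new factor
may be chosen in terms of `p`. -/
theorem List.prod_ofFn_update {m : ℕ} (f : Fin m → G) (K : Subgroup G) (hf : ∀ j, f j ∈ K)
    (i : Fin m) : ∃ p ∈ K, ∀ q, (List.ofFn (Function.update f i q)).prod =
      p * (q * (f i)⁻¹) * p⁻¹ * (List.ofFn f).prod := by
  induction m with
  | zero => exact i.elim0
  | succ m ih =>
    cases i using Fin.cases with
    | zero =>
      refine ⟨1, K.one_mem, fun q => ?_⟩
      simp [List.ofFn_succ, mul_assoc]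
    | succ i =>
      obtain ⟨p, hp, h⟩ := ih (fun j => f j.succ) (fun j => hf _) i
      refine ⟨f 0 * p, K.mul_mem (hf 0) hp, fun q => ?_⟩
      have e : (fun j : Fin m => Function.update f i.succ q j.succ) =
          Function.update (fun j : Fin m => f j.succ) i q := by
        funext j
        simp [Function.update_apply]
      rw [List.ofFn_succ, List.ofFn_succ, List.prod_cons, List.prod_cons, e, h,
        Function.update_of_ne (Fin.succ_ne_zero i).symm]
      group

/-- `y` can be put in front of every product of conjugates of the elements `d i` by elements of `H`
by changing the conjugating elements. -/
def Absorbed {m : ℕ} (H : Subgroup G) (d : Fin m → G) (y : G) : Prop :=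
  ∀ h : Fin m → G, (∀ i, h i ∈ H) → ∃ h' : Fin m → G, (∀ i, h' i ∈ H) ∧
    (List.ofFn fun i => h' i * d i * (h' i)⁻¹).prod =
      y * (List.ofFn fun i => h i * d i * (h i)⁻¹).prod

theorem Absorbed.mul {m : ℕ} {H : Subgroup G} {d : Fin m → G} {y y' : G} (hy : Absorbed H d y)
    (hy' : Absorbed H d y') : Absorbed H d (y * y') := by
  intro h hh
  obtain ⟨h₁, hh₁, e₁⟩ := hy' h hh
  obtain ⟨h₂, hh₂, e₂⟩ := hy h₁ hh₁
  exact ⟨h₂, hh₂, by rw [e₂, e₁, mul_assoc]⟩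

/-- The subgroup of those elements of `D` that can be absorbed together with their inverses. -/
def absorbed {m : ℕ} (D H : Subgroup G) (d : Fin m → G) : Subgroup G where
  carrier := {y | y ∈ D ∧ Absorbed H d y ∧ Absorbed H d y⁻¹}
  one_mem' := ⟨D.one_mem, fun h hh => ⟨h, hh, by simp⟩, fun h hh => ⟨h, hh, by simp⟩⟩
  mul_mem' := fun ha hb => ⟨D.mul_mem ha.1 hb.1, ha.2.1.mul hb.2.1, by
    rw [mul_inv_rev]
    exact hb.2.2.mul ha.2.2⟩
  inv_mem' := fun ha => ⟨D.inv_mem ha.1, ha.2.2, by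
    rw [inv_inv]
    exact ha.2.1⟩

variable {m : ℕ} {D H : Subgroup G} {d : Fin m → G}

/-- Conjugating one factor. -/
theorem exists_conj_factor (hG : ∀ g h : G, ⁅g, h⁆ ∈ D) (hd : ∀ i, d i ∈ H)
    (i : Fin m) (h : Fin m → G) (hh : ∀ i, h i ∈ H) : ∃ e ∈ D, ∀ u ∈ H, ∃ h' : Fin m → G,
      (∀ i, h' i ∈ H) ∧ (List.ofFn fun i => h' i * d i * (h' i)⁻¹).prod =
        ⁅u, d i * e⁆ * (List.ofFn fun i => h i * d i * (h i)⁻¹).prod := by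
  obtain ⟨p, hp, hprod⟩ := List.prod_ofFn_update (fun i => h i * d i * (h i)⁻¹) H
    (fun j => H.mul_mem (H.mul_mem (hh j) (hd j)) (H.inv_mem (hh j))) i
  -- With this `e`, the product `d i * e` is the conjugate of `d i` by `p * h i`. Moreover `e` is a
  -- commutator, hence in `D`, and does not depend on `u`.
  refine ⟨(d i)⁻¹ * (p * h i * d i * (p * h i)⁻¹), ?_, fun u hu => ?_⟩
  · have := hG (d i)⁻¹ (p * h i)
    simpa [commutatorElement_def, mul_assoc] using this
  -- After transport past the prefix `p`, the new factor is the conjugate of `d i * e` by `u`, and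
  -- the old one is `d i * e`.
  refine ⟨Function.update h i (p⁻¹ * u * p * h i), fun j => ?_, ?_⟩
  · rw [Function.update_apply]
    split_ifs
    · exact H.mul_mem (H.mul_mem (H.mul_mem (H.inv_mem hp) hu) hp) (hh i)
    · exact hh j
  · have e : (fun j => Function.update h i (p⁻¹ * u * p * h i) j * d j *
        (Function.update h i (p⁻¹ * u * p * h i) j)⁻¹) =
        Function.update (fun i => h i * d i * (h i)⁻¹) i
          ((p⁻¹ * u * p * h i) * d i * (p⁻¹ * u * p * h i)⁻¹) := by
      funext j
      simp only [Function.update_apply]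
      split_ifs with hj
      · rw [hj]
      · rfl
    rw [e, hprod]
    congr 1
    rw [commutatorElement_def]
    group

/-- For `x` in the abelian subgroup `D` the error `e` of `exists_conj_factor` commutes with `x` and
drops out of the commutator. Inverses are covered because ⁅x, d i⁆⁻¹ = ⁅x⁻¹, d i⁆. -/
theorem comm_mem_absorbed_of_mem (hG : ∀ g h : G, ⁅g, h⁆ ∈ D)
    (hD : ∀ x ∈ D, ∀ y ∈ D, x * y = y * x) (hDH : D ≤ H) (hd : ∀ i, d i ∈ H) (i : Fin m)
    {x : G} (hx : x ∈ D) : ⁅x, d i⁆ ∈ absorbed D H d := by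
  have key : ∀ x ∈ D, Absorbed H d ⁅x, d i⁆ := by
    intro x hx h hh
    obtain ⟨e, he, hu⟩ := exists_conj_factor hG hd i h hh
    obtain ⟨h', hh', e'⟩ := hu x (hDH hx)
    refine ⟨h', hh', ?_⟩
    have : ⁅x, d i * e⁆ = ⁅x, d i⁆ := by
      have h1 := hD e he x⁻¹ (D.inv_mem hx)
      rw [commutatorElement_def, commutatorElement_def, mul_inv_rev]
      calc x * (d i * e) * x⁻¹ * (e⁻¹ * (d i)⁻¹) = x * d i * (e * x⁻¹) * e⁻¹ * (d i)⁻¹ := by group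
        _ = _ := by rw [h1]; group
    rw [e', this]
  refine ⟨hG _ _, key x hx, ?_⟩
  have : ⁅x, d i⁆⁻¹ = ⁅x⁻¹, d i⁆ := by
    have h1 : d i * x * (d i)⁻¹ ∈ D := by
      have := D.mul_mem (hG (d i) x) hx
      simpa [commutatorElement_def] using this
    have h2 := hD _ h1 _ (D.inv_mem hx)
    rw [commutatorElement_def, commutatorElement_def]
    calc (x * d i * x⁻¹ * (d i)⁻¹)⁻¹ = d i * x * (d i)⁻¹ * x⁻¹ := by group
      _ = _ := by rw [h2]; group
  rw [this]
  exact key _ (D.inv_mem hx)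

/-- In a metabelian group, every element of the derived subgroup of the subgroup generated by the
`d i` and the derived subgroup can be absorbed by a product of conjugates of the `d i`. -/
theorem commutator_le_absorbed (hG : ∀ g h : G, ⁅g, h⁆ ∈ D)
    (hD : ∀ x ∈ D, ∀ y ∈ D, x * y = y * x) (hH : H = Subgroup.closure (Set.range d ∪ D)) :
    ⁅H, H⁆ ≤ absorbed D H d := by
  have hDH : D ≤ H := by
    rw [hH]
    exact fun x hx => Subgroup.subset_closure (Or.inr hx)
  have hd : ∀ i, d i ∈ H := by
    rw [hH]
    exact fun i => Subgroup.subset_closure (Or.inl ⟨i, rfl⟩)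
  have conjD : ∀ (g x : G), x ∈ D → g * x * g⁻¹ ∈ D := fun g x hx => by
    have := D.mul_mem (hG g x) hx
    simpa [commutatorElement_def] using this
  -- Commutators with one entry in `D`: induction over the generators of `H`, since elements of `D`
  -- commute with each other and the `d i` have been treated.
  have step2 : ∀ h ∈ H, ∀ x ∈ D, ⁅x, h⁆ ∈ absorbed D H d := by
    intro h hh
    rw [hH] at hh
    induction hh using Subgroup.closure_induction with
    | mem h hh =>
      intro x hx
      rcases hh with ⟨i, rfl⟩ | hh
      · exact comm_mem_absorbed_of_mem hG hD hDH hd i hx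
      · rw [commutatorElement_eq_one_iff_mul_comm.mpr (hD x hx h hh)]
        exact one_mem _
    | one => intro x hx; rw [commutatorElement_one_right]; exact one_mem _
    | mul h k _ _ ihh ihk =>
      intro x hx
      have h1 := hD _ (conjD h _ (hG k x)) _ (conjD h x hx)
      -- The elements `k` and h k h⁻¹ differ by an element of `D`, so they act alike on `D` by
      -- conjugation.
      have : ⁅x, h * k⁆ = ⁅x, h⁆ * ⁅h * x * h⁻¹, k⁆ := by
        have h2 : h * x * h⁻¹ * (k * (h * x * h⁻¹)⁻¹ * k⁻¹) = h * x * h⁻¹ * (h * (k * x⁻¹ * k⁻¹) * h⁻¹) := by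
          congr 1
          have h3 : ⁅k, h⁆ ∈ D := hG k h
          have h4 : k * x⁻¹ * k⁻¹ ∈ D := conjD k _ (D.inv_mem hx)
          have h5 := hD _ h3 _ (conjD h _ h4)
          calc k * (h * x * h⁻¹)⁻¹ * k⁻¹
              = ⁅k, h⁆ * (h * (k * x⁻¹ * k⁻¹) * h⁻¹) * ⁅k, h⁆⁻¹ := by
                rw [commutatorElement_def]; group
            _ = _ := by rw [h5, mul_inv_cancel_right]
        calc ⁅x, h * k⁆ = ⁅x, h⁆ * (h * x * h⁻¹ * (h * (k * x⁻¹ * k⁻¹) * h⁻¹)) := by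
              simp only [commutatorElement_def]; group
          _ = _ := by rw [← h2, commutatorElement_def]; group
      rw [this]
      exact mul_mem (ihh x hx) (ihk _ (conjD h x hx))
    | inv h _ ih =>
      intro x hx
      have hx' : h⁻¹ * x * h ∈ D := by simpa using conjD h⁻¹ x hx
      have h1 := hD _ (D.inv_mem hx') x hx
      have : ⁅x, h⁻¹⁆ = ⁅(h⁻¹ * x * h)⁻¹, h⁆ := by
        calc ⁅x, h⁻¹⁆ = x * (h⁻¹ * x * h)⁻¹ := by rw [commutatorElement_def]; group
          _ = (h⁻¹ * x * h)⁻¹ * x := h1.symm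
          _ = _ := by rw [commutatorElement_def]; group
      rw [this]
      exact ih _ (D.inv_mem hx')
  have conjR : ∀ h ∈ H, ∀ y ∈ absorbed D H d, h * y * h⁻¹ ∈ absorbed D H d := by
    intro h hh y hy
    have : h * y * h⁻¹ = ⁅y, h⁆⁻¹ * y := by rw [commutatorElement_def]; group
    rw [this]
    exact mul_mem (inv_mem (step2 h hh y hy.1)) hy
  -- For general `u` the error `e` contributes a conjugate of ⁅u, e⁆, which `step2` allows to be
  -- absorbed; absorbing its inverse removes it.
  have key3 : ∀ i, ∀ u ∈ H, Absorbed H d ⁅u, d i⁆ := by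
    intro i u hu h hh
    obtain ⟨e, he, hmove⟩ := exists_conj_factor hG hd i h hh
    obtain ⟨h₁, hh₁, e₁⟩ := hmove u hu
    have hj : d i * ⁅u, e⁆ * (d i)⁻¹ ∈ absorbed D H d := by
      refine conjR _ (hd i) _ ?_
      rw [← commutatorElement_inv]
      exact inv_mem (step2 u hu e he)
    obtain ⟨h₂, hh₂, e₂⟩ := hj.2.2 h₁ hh₁
    refine ⟨h₂, hh₂, ?_⟩
    have h3 : ⁅u, d i * e⁆ = ⁅u, d i⁆ * (d i * ⁅u, e⁆ * (d i)⁻¹) := by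
      simp only [commutatorElement_def]; group
    have h4 := hD _ (hG u (d i)) _ hj.1
    rw [e₂, e₁, h3, h4]
    group
  -- The inverse of ⁅u, d i⁆ is ⁅u⁻¹, d i⁆ up to a commutator with an entry in `D`.
  have step3 : ∀ i, ∀ u ∈ H, ⁅u, d i⁆ ∈ absorbed D H d := by
    intro i u hu
    refine ⟨hG _ _, key3 i u hu, ?_⟩
    have : ⁅u, d i⁆⁻¹ = ⁅⁅u⁻¹, d i⁆, u⁆⁻¹ * ⁅u⁻¹, d i⁆ := by
      simp only [commutatorElement_def]; group
    rw [this]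
    exact (step2 u hu _ (hG _ _)).2.2.mul (key3 i _ (H.inv_mem hu))
  rw [Subgroup.commutator_le]
  intro u hu h hh
  rw [hH] at hh
  induction hh using Subgroup.closure_induction with
  | mem h hh =>
    rcases hh with ⟨i, rfl⟩ | hh
    · exact step3 i u hu
    · rw [← commutatorElement_inv]
      exact inv_mem (step2 u hu h hh)
  | one => rw [commutatorElement_one_right]; exact one_mem _
  | mul h k hh _ ihh ihk =>
    have : ⁅u, h * k⁆ = ⁅u, h⁆ * (h * ⁅u, k⁆ * h⁻¹) := by
      simp only [commutatorElement_def]; group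
    rw [this]
    exact mul_mem ihh (conjR h (by rwa [hH]) _ ihk)
  | inv h hh ih =>
    have : ⁅u, h⁻¹⁆ = h⁻¹ * ⁅u, h⁆⁻¹ * h⁻¹⁻¹ := by
      simp only [commutatorElement_def]; group
    rw [this]
    exact conjR _ (by rw [hH]; exact inv_mem hh) _ (inv_mem ih)

end Absorption

/-! ### Solvability of spherical equations and the lattice equation -/

namespace FreeMetab

theorem solvable_sphericalWord_iff {G : Type*} [Group G] {m : ℕ} (c : Fin m → G) :
    Solvable (sphericalWord c) ↔
      ∃ z : Fin m → G, (List.ofFn fun i => z i * c i * (z i)⁻¹).prod = 1 := by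
  have key : ∀ φ : Monoid.Coprod G (FreeGroup (Fin m)) →* G,
      (∀ g, φ (Monoid.Coprod.inl g) = g) → φ (sphericalWord c) =
        (List.ofFn fun i => φ (Monoid.Coprod.inr (FreeGroup.of i)) * c i *
          (φ (Monoid.Coprod.inr (FreeGroup.of i)))⁻¹).prod := by
    intro φ h
    rw [sphericalWord, map_list_prod, List.map_ofFn]
    congr 2
    funext i
    simp [h]
  constructor
  · rintro ⟨φ, h1, h2⟩
    exact ⟨_, (key φ h1).symm.trans h2⟩
  · rintro ⟨z, hz⟩
    have h1 : ∀ g, Monoid.Coprod.lift (MonoidHom.id G) (FreeGroup.lift z)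
        (Monoid.Coprod.inl g) = g := fun g => by simp
    exact ⟨_, h1, by rw [key _ h1]; simpa using hz⟩

/-! ### Words, the epimorphism onto A_n and its kernel. -/

variable {n : ℕ}

theorem wordM_append (w w' : List (Letter n)) : wordM (w ++ w') = wordM w * wordM w' := by
  rw [wordM, ← FreeGroup.mul_mk]
  rfl

theorem wordM_nil : wordM ([] : List (Letter n)) = 1 := by
  rw [wordM, ← FreeGroup.one_eq_mk]
  rfl

theorem wordM_false (i : Fin n) : wordM [(i, false)] = (wordM [(i, true)])⁻¹ := by
  rw [wordM, wordM, ← QuotientGroup.mk_inv, FreeGroup.inv_mk]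
  rfl

theorem wordM_surjective : Function.Surjective (wordM (n := n)) := by
  intro x
  obtain ⟨f, rfl⟩ := QuotientGroup.mk_surjective x
  exact ⟨f.toWord, by rw [wordM, FreeGroup.mk_toWord]⟩

theorem wordA_append (w w' : List (Letter n)) : wordA (w ++ w') = wordA w * wordA w' := by
  rw [wordA, ← FreeGroup.mul_mk, map_mul]
  rfl

theorem wordA_nil : wordA ([] : List (Letter n)) = 1 := by
  rw [wordA, ← FreeGroup.one_eq_mk, map_one]

theorem wordA_true (i : Fin n) : wordA [(i, true)] = genA i := rfl

theorem wordA_false (i : Fin n) : wordA [(i, false)] = (genA i)⁻¹ := by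
  rw [genA, ← map_inv]
  rfl

theorem wordA_surjective : Function.Surjective (wordA (n := n)) := by
  intro x
  obtain ⟨f, rfl⟩ := QuotientGroup.mk_surjective x
  exact ⟨f.toWord, by rw [wordA, FreeGroup.mk_toWord]; rfl⟩

@[simp] theorem bar_wordM (w : List (Letter n)) : bar (wordM w) = wordA w := rfl

theorem bar_surjective : Function.Surjective (bar (n := n)) := fun a =>
  let ⟨w, hw⟩ := wordA_surjective a
  ⟨wordM w, hw⟩

theorem bar_eq_one_iff (x : M n) : bar x = 1 ↔ x ∈ commutator (M n) := by
  constructor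
  · obtain ⟨f, rfl⟩ := QuotientGroup.mk_surjective x
    intro h
    have hf : f ∈ commutator (FreeGroup (Fin n)) := by
      rw [← Abelianization.ker_of]
      exact h
    have : (QuotientGroup.mk' (derivedSeries (FreeGroup (Fin n)) 2)) f ∈
        derivedSeries (M n) 1 := by
      refine map_derivedSeries_le_derivedSeries _ 1 ⟨f, ?_, rfl⟩
      rw [derivedSeries_one]
      exact hf
    rwa [derivedSeries_one] at this
  · exact fun h => Abelianization.commutator_subset_ker (bar (n := n)) h

theorem commutator_comm {x y : M n} (hx : x ∈ commutator (M n)) (hy : y ∈ commutator (M n)) :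
    x * y = y * x := by
  have h : derivedSeries (M n) 2 = ⊥ := by
    rw [eq_bot_iff, ← map_derivedSeries_eq (QuotientGroup.mk'_surjective _) 2]
    rintro _ ⟨f, hf, rfl⟩
    exact (QuotientGroup.eq_one_iff f).mpr hf
  rw [← derivedSeries_one] at hx hy
  rw [← commutatorElement_eq_one_iff_mul_comm, ← Subgroup.mem_bot, ← h]
  exact Subgroup.commutator_mem_commutator hx hy

/-! ### Chains in the quotient graph and the kernel of the chain map. -/

section Chains

variable {L : Subgroup (A n)}

theorem proj_zero : proj L (0 : Chain n) = 0 := Finsupp.mapDomain_zero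

theorem proj_add (s t : Chain n) : proj L (s + t) = proj L s + proj L t := Finsupp.mapDomain_add

theorem proj_neg (s : Chain n) : proj L (-s) = -proj L s := by
  rw [eq_neg_iff_add_eq_zero, ← proj_add, neg_add_cancel, proj_zero]

theorem proj_single (g : A n) (i : Fin n) (k : ℤ) :
    proj L (Finsupp.single (g, i) k) = Finsupp.single ((g : A n ⧸ L), i) k :=
  Finsupp.mapDomain_single

theorem shift_zero (a : A n) : shift a (0 : QuotChain L) = 0 := Finsupp.mapDomain_zero

theorem shift_add (a : A n) (s t : QuotChain L) : shift a (s + t) = shift a s + shift a t :=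
  Finsupp.mapDomain_add

theorem shift_neg (a : A n) (s : QuotChain L) : shift a (-s) = -shift a s := by
  rw [eq_neg_iff_add_eq_zero, ← shift_add, neg_add_cancel, shift_zero]

theorem shift_sum {ι : Type*} (a : A n) (S : Finset ι) (f : ι → QuotChain L) :
    shift a (∑ i ∈ S, f i) = ∑ i ∈ S, shift a (f i) :=
  map_sum (⟨⟨shift a, shift_zero a⟩, shift_add a⟩ : QuotChain L →+ QuotChain L) f S

theorem shift_single (a : A n) (g : A n ⧸ L) (i : Fin n) (k : ℤ) :
    shift a (Finsupp.single (g, i) k) = Finsupp.single ((a : A n ⧸ L) * g, i) k :=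
  Finsupp.mapDomain_single

theorem shift_shift (a b : A n) (s : QuotChain L) : shift a (shift b s) = shift (a * b) s := by
  rw [shift, shift, shift, ← Finsupp.mapDomain_comp]
  congr 1
  funext e
  simp [mul_assoc]

theorem shift_of_mem {a : A n} (ha : a ∈ L) (s : QuotChain L) : shift a s = s := by
  have h : (a : A n ⧸ L) = 1 := (QuotientGroup.eq_one_iff a).mpr ha
  rw [shift]
  simp only [h, one_mul]
  exact Finsupp.mapDomain_id

theorem pathChain_append (g : A n) (w w' : List (Letter n)) :
    pathChain g (w ++ w') = pathChain g w + pathChain (g * wordA w) w' := by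
  induction w generalizing g with
  | nil => simp [pathChain, wordA_nil]
  | cons l w ih =>
    obtain ⟨i, b⟩ := l
    have : wordA ((i, b) :: w) = wordA [(i, b)] * wordA w := wordA_append [(i, b)] w
    cases b with
    | true =>
      rw [wordA_true] at this
      simp only [List.cons_append, pathChain, ih, this, add_assoc, mul_assoc]
    | false =>
      rw [wordA_false] at this
      simp only [List.cons_append, pathChain, ih, this, add_assoc, mul_assoc]

theorem proj_pathChain (a g : A n) (w : List (Letter n)) :
    proj L (pathChain (a * g) w) = shift a (proj L (pathChain g w)) := by
  induction w generalizing g with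
  | nil => simp only [pathChain, proj_zero, shift_zero]
  | cons l w ih =>
    obtain ⟨i, b⟩ := l
    cases b <;>
    · simp only [pathChain, proj_add, shift_add, proj_neg, shift_neg, proj_single, shift_single,
        mul_assoc, ih]
      rfl

/-- The chain in `C₁(Γ_n / L)` of an element of `M_n`. -/
noncomputable def quotSigma (L : Subgroup (A n)) (x : M n) : QuotChain L := proj L (sigma x)

theorem quotSigma_wordM (w : List (Letter n)) :
    quotSigma L (wordM w) = proj L (pathChain 1 w) := by
  rw [quotSigma, sigma_wordM]

/-- The path of `y` is appended at the endpoint `bar x` of the path of `x`, hence the shift. -/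
theorem quotSigma_mul (x y : M n) :
    quotSigma L (x * y) = quotSigma L x + shift (bar x) (quotSigma L y) := by
  obtain ⟨w, rfl⟩ := wordM_surjective x
  obtain ⟨w', rfl⟩ := wordM_surjective y
  rw [← wordM_append, quotSigma_wordM, quotSigma_wordM, quotSigma_wordM, pathChain_append,
    proj_add, bar_wordM, ← proj_pathChain, mul_one, one_mul]

theorem quotSigma_one : quotSigma L (1 : M n) = 0 := by
  have := quotSigma_mul (L := L) (1 : M n) 1
  rwa [mul_one, map_one, shift_of_mem L.one_mem, left_eq_add] at this

/-- In the quotient graph the path of `c` is closed, so the path of `z⁻¹` retraces that of `z` and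
the two cancel. -/
theorem quotSigma_conj (z c : M n) (hc : bar c ∈ L) :
    quotSigma L (z * c * z⁻¹) = shift (bar z) (quotSigma L c) := by
  have h : quotSigma L z + shift (bar z) (quotSigma L z⁻¹) = 0 := by
    rw [← quotSigma_mul, mul_inv_cancel, quotSigma_one]
  have h' : shift (bar (z * c)) (quotSigma L z⁻¹) = shift (bar z) (quotSigma L z⁻¹) := by
    rw [map_mul, ← shift_shift, shift_of_mem hc]
  rw [quotSigma_mul, quotSigma_mul, h', add_right_comm, h, zero_add]

theorem quotSigma_prod {m : ℕ} (x : Fin m → M n) (hx : ∀ i, bar (x i) ∈ L) :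
    quotSigma L (List.ofFn x).prod = ∑ i, quotSigma L (x i) := by
  induction m with
  | zero => simp [quotSigma_one]
  | succ m ih =>
    rw [List.ofFn_succ, List.prod_cons, quotSigma_mul, shift_of_mem (hx 0), Fin.sum_univ_succ,
      ih _ fun i => hx _]

theorem bar_prod_mem {m : ℕ} (x : Fin m → M n) (hx : ∀ i, bar (x i) ∈ L) :
    bar (List.ofFn x).prod ∈ L := by
  rw [map_list_prod]
  refine L.list_prod_mem fun y hy => ?_
  rw [List.map_ofFn, List.mem_ofFn] at hy
  obtain ⟨i, rfl⟩ := hy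
  exact hx i

/-- The kernel of the map from the preimage of `L` in `M_n` to `C₁(Γ_n / L)` is the derived
subgroup. -/
theorem mem_commutator_of_quotSigma {x : M n} (hx : bar x ∈ L) (h : quotSigma L x = 0) :
    x ∈ ⁅L.comap bar, L.comap bar⁆ := by
  classical
  set H : Subgroup (M n) := L.comap bar with hH
  -- Coset representatives in M_n; no normalisation at the trivial coset is imposed.
  have ht : ∀ g : A n ⧸ L, ∃ y : M n, (bar y : A n ⧸ L) = g := fun g => by
    obtain ⟨a, rfl⟩ := QuotientGroup.mk_surjective g
    obtain ⟨y, rfl⟩ := bar_surjective a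
    exact ⟨y, rfl⟩
  choose t ht using ht
  have hmem : ∀ (g : A n ⧸ L) (y : M n), t g * y * (t (g * (bar y : A n ⧸ L)))⁻¹ ∈ H := by
    intro g y
    rw [hH, Subgroup.mem_comap, map_mul, map_mul, map_inv, ← QuotientGroup.eq_one_iff,
      QuotientGroup.mk_mul, QuotientGroup.mk_mul, QuotientGroup.mk_inv, ht, ht, mul_inv_cancel]
  -- The Schreier element that closes up the path of `y` from the coset `g`, taken in the
  -- abelianization of `H`. It is additive under concatenation, so it is determined by its values on
  -- single edges and extends to a homomorphism `φ` on chains. A zero chain therefore has trivial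
  -- value.
  let θ : A n ⧸ L → M n → Additive (Abelianization H) := fun g y =>
    Additive.ofMul (Abelianization.of ⟨_, hmem g y⟩)
  have θ_mul : ∀ g y y', θ g (y * y') = θ g y + θ (g * (bar y : A n ⧸ L)) y' := by
    intro g y y'
    simp only [θ]
    rw [← ofMul_mul, ← map_mul]
    congr 2
    ext
    simp only [Subgroup.coe_mul, map_mul, QuotientGroup.mk_mul, mul_assoc, inv_mul_cancel_left]
  have θ_one : ∀ g, θ g 1 = 0 := by
    intro g
    have := θ_mul g 1 1
    rwa [mul_one, map_one, QuotientGroup.mk_one, mul_one, left_eq_add] at this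
  let a : Fin n → M n := fun i => wordM [(i, true)]
  let φ : QuotChain L →+ Additive (Abelianization H) :=
    Finsupp.liftAddHom fun e => (zmultiplesHom _) (θ e.1 (a e.2))
  have hφ : ∀ e k, φ (Finsupp.single e k) = k • θ e.1 (a e.2) := by
    intro e k
    simp [φ]
  have hinv : ∀ i, wordM [(i, false)] = (a i)⁻¹ := wordM_false
  have key : ∀ (w : List (Letter n)) (g : A n),
      φ (proj L (pathChain g w)) = θ (g : A n ⧸ L) (wordM w) := by
    intro w
    induction w with
    | nil =>
      intro g
      rw [pathChain, proj_zero, map_zero, wordM_nil, θ_one]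
    | cons l w ih =>
      intro g
      obtain ⟨i, b⟩ := l
      have e : wordM ((i, b) :: w) = wordM [(i, b)] * wordM w := wordM_append [(i, b)] w
      rw [e, θ_mul]
      cases b with
      | true =>
        rw [pathChain, proj_add, map_add, ih, proj_single, hφ, one_smul, bar_wordM, wordA_true,
          ← QuotientGroup.mk_mul]
      | false =>
        rw [pathChain, proj_add, map_add, ih, proj_neg, proj_single, map_neg, hφ, one_smul, bar_wordM,
          wordA_false, hinv, ← QuotientGroup.mk_mul]
        congr 1
        have h1 := θ_mul (g : A n ⧸ L) (a i)⁻¹ (a i)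
        rw [inv_mul_cancel, θ_one] at h1
        exact neg_eq_of_add_eq_zero_left h1.symm
  have h1 : θ ((1 : A n) : A n ⧸ L) x = 0 := by
    obtain ⟨w, rfl⟩ := wordM_surjective x
    rw [← key w 1, ← quotSigma_wordM, h, map_zero]
  have h2 : Abelianization.of (⟨_, hmem (1 : A n) x⟩ : H) = 1 := ofMul_eq_zero.mp h1
  -- The representative of the trivial coset lies in `H`, so conjugating `x` by it does not change
  -- the class in the abelianization.
  have ht1 : t ((1 : A n) : A n ⧸ L) ∈ H := by
    change bar _ ∈ L
    rw [← QuotientGroup.eq_one_iff, ht]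
    rfl
  have h3 : Abelianization.of (⟨x, hx⟩ : H) = 1 := by
    have e : (⟨_, hmem (1 : A n) x⟩ : H) = ⟨_, ht1⟩ * ⟨x, hx⟩ * (⟨_, ht1⟩)⁻¹ := by
      have : ((1 : A n) : A n ⧸ L) * (bar x : A n ⧸ L) = ((1 : A n) : A n ⧸ L) := by
        rw [(QuotientGroup.eq_one_iff _).mpr hx, mul_one]
      ext
      simp only [this, Subgroup.coe_mul, Subgroup.coe_inv]
    rw [e, map_mul, map_mul, map_inv, mul_inv_cancel_comm] at h2
    exact h2
  have h4 : (⟨x, hx⟩ : H) ∈ commutator H := by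
    rw [← Abelianization.ker_of]
    exact h3
  rw [← Subgroup.map_subtype_commutator]
  exact ⟨_, h4, rfl⟩

end Chains

/-- The α_i are the images of the z_i. Lifts of a given α only solve the equation modulo [H, H], and
this error is absorbed into the conjugating elements. -/
theorem solvable_iff_exists_latticeEq {m : ℕ} (c : Fin m → M n) :
    Solvable (sphericalWord c) ↔ ∃ α : Fin m → A n, LatticeEq c α := by
  rw [solvable_sphericalWord_iff]
  have hc : ∀ i, bar (c i) ∈ LQ c := fun i => Subgroup.subset_closure ⟨i, rfl⟩
  have hcz : ∀ (z : Fin m → M n) i, bar (z i * c i * (z i)⁻¹) ∈ LQ c := fun z i => by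
    rw [map_mul, map_mul, map_inv, mul_inv_cancel_comm]
    exact hc i
  have key : ∀ z : Fin m → M n, quotSigma (LQ c) (List.ofFn fun i => z i * c i * (z i)⁻¹).prod =
      ∑ i, shift (bar (z i)) (tau c (c i)) := by
    intro z
    rw [quotSigma_prod _ (hcz z)]
    exact Finset.sum_congr rfl fun i _ => quotSigma_conj _ _ (hc i)
  constructor
  · rintro ⟨z, hz⟩
    refine ⟨fun i => bar (z i), ?_⟩
    rw [LatticeEq, ← key z, hz, quotSigma_one]
  · rintro ⟨α, hα⟩
    choose z hz using fun i => bar_surjective (α i)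
    let d : Fin m → M n := fun i => z i * c i * (z i)⁻¹
    have hbar : ∀ i, bar (d i) = bar (c i) := fun i => by
      rw [map_mul, map_mul, map_inv, mul_inv_cancel_comm]
    have h0 : quotSigma (LQ c) (List.ofFn d).prod = 0 := by
      rw [key z]
      simp only [hz]
      exact hα
    have hmem := mem_commutator_of_quotSigma (bar_prod_mem d (hcz z)) h0
    -- The `d i` have the same images as the `c i`, and the kernel of `bar` is the derived subgroup.
    have hH : (LQ c).comap bar = Subgroup.closure (Set.range d ∪ commutator (M n)) := by
      rw [LQ, Subgroup.closure_union, Subgroup.closure_eq]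
      have h1 : (Set.range fun i => bar (c i)) = bar '' Set.range d := by
        rw [← Set.range_comp]
        exact congrArg _ (funext fun i => (hbar i).symm)
      have h2 : (bar (n := n)).ker = commutator (M n) := by
        ext x
        exact bar_eq_one_iff x
      rw [h1, ← MonoidHom.map_closure, Subgroup.comap_map_eq, h2]
    have habs := commutator_le_absorbed (D := commutator (M n)) (d := d)
      (fun g h => Subgroup.commutator_mem_commutator (Subgroup.mem_top g) (Subgroup.mem_top h))
      (fun x hx y hy => commutator_comm hx hy) hH hmem
    -- The inverse of the product is absorbed, starting from trivial conjugating elements.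
    obtain ⟨h', -, e⟩ := habs.2.2 1 fun i => one_mem _
    refine ⟨fun i => h' i * z i, ?_⟩
    have e1 : (fun i => h' i * z i * c i * (h' i * z i)⁻¹) =
        fun i => h' i * d i * (h' i)⁻¹ := by
      funext i
      simp only [d]
      group
    rw [e1, e]
    simp

end FreeMetab

/-! ### Short solutions of the lattice equation -/

namespace FreeMetab

variable {n : ℕ}

theorem lengthA_wordA_le (w : List (Letter n)) : lengthA (wordA w) ≤ w.length :=
  Nat.sInf_le ⟨w, rfl, rfl⟩

theorem exists_wordA_length (a : A n) : ∃ w : List (Letter n), wordA w = a ∧ w.length = lengthA a :=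
  Nat.sInf_mem (s := {k | ∃ w : List (Letter n), wordA w = a ∧ w.length = k})
    ((wordA_surjective a).elim fun w hw => ⟨w.length, w, hw, rfl⟩)

theorem lengthM_wordM_le (w : List (Letter n)) : lengthM (wordM w) ≤ w.length :=
  Nat.sInf_le ⟨w, rfl, rfl⟩

theorem exists_wordM_length (a : M n) : ∃ w : List (Letter n), wordM w = a ∧ w.length = lengthM a :=
  Nat.sInf_mem (s := {k | ∃ w : List (Letter n), wordM w = a ∧ w.length = k})
    ((wordM_surjective a).elim fun w hw => ⟨w.length, w, hw, rfl⟩)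

theorem lengthA_one : lengthA (1 : A n) = 0 := by
  have := lengthA_wordA_le ([] : List (Letter n))
  rwa [wordA_nil, List.length_nil, Nat.le_zero] at this

theorem lengthA_mul_le (a b : A n) : lengthA (a * b) ≤ lengthA a + lengthA b := by
  obtain ⟨w, rfl, hw⟩ := exists_wordA_length a
  obtain ⟨w', rfl, hw'⟩ := exists_wordA_length b
  rw [← wordA_append, ← hw, ← hw', ← List.length_append]
  exact lengthA_wordA_le _

theorem lengthA_inv_le (a : A n) : lengthA a⁻¹ ≤ lengthA a := by
  obtain ⟨w, rfl, hw⟩ := exists_wordA_length a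
  have : (wordA w)⁻¹ = wordA (FreeGroup.invRev w) := by
    rw [wordA, wordA, ← map_inv, FreeGroup.inv_mk]
  rw [this, ← hw, ← FreeGroup.invRev_length (L₁ := w)]
  exact lengthA_wordA_le _

/-- The edges of a path labelled by `w` start at distance at most `|w|` from its start. -/
theorem exists_prefix_of_proj_pathChain_ne_zero {L : Subgroup (A n)} (w : List (Letter n)) (g : A n)
    (e : (A n ⧸ L) × Fin n) (h : proj L (pathChain g w) e ≠ 0) :
    ∃ a : A n, lengthA a ≤ w.length ∧ e.1 = ((g * a : A n) : A n ⧸ L) := by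
  induction w generalizing g with
  | nil => simp [pathChain, proj_zero] at h
  | cons l w ih =>
    obtain ⟨i, b⟩ := l
    have step : ∀ x : A n, lengthA x ≤ 1 → proj L (pathChain (g * x) w) e ≠ 0 →
        ∃ a : A n, lengthA a ≤ ((i, b) :: w).length ∧ e.1 = ((g * a : A n) : A n ⧸ L) := by
      intro x hx hne
      obtain ⟨a, ha, hea⟩ := ih _ hne
      refine ⟨x * a, (lengthA_mul_le x a).trans ?_, by rw [hea, mul_assoc]⟩
      rw [List.length_cons]
      omega
    cases b with
    | true =>
      have hx : lengthA (genA i) ≤ 1 := lengthA_wordA_le [(i, true)]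
      by_cases h' : proj L (pathChain (g * genA i) w) e = 0
      · rw [pathChain, proj_add, proj_single, Finsupp.add_apply, h', add_zero,
          Finsupp.single_apply_ne_zero] at h
        exact ⟨1, by rw [lengthA_one]; exact Nat.zero_le _, by rw [h.1, mul_one]⟩
      · exact step _ hx h'
    | false =>
      have hx : lengthA (genA i)⁻¹ ≤ 1 := by
        rw [← wordA_false]
        exact lengthA_wordA_le [(i, false)]
      by_cases h' : proj L (pathChain (g * (genA i)⁻¹) w) e = 0
      · rw [pathChain, proj_add, proj_neg, proj_single, Finsupp.add_apply, h', add_zero,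
          Finsupp.neg_apply, neg_ne_zero, Finsupp.single_apply_ne_zero] at h
        exact ⟨_, hx.trans (by simp), by rw [h.1]⟩
      · exact step _ hx h'

/-- Solutions of the lattice equation can be chosen short. -/
theorem exists_short_latticeEq {m : ℕ} (c : Fin m → M n) (α : Fin m → A n) (h : LatticeEq c α) :
    ∃ α' : Fin m → A n, (∀ i, lengthA (α' i) ≤ 2 * ∑ j, lengthM (c j)) ∧ LatticeEq c α' := by
  classical
  let k : Fin m → ℕ := fun i => lengthM (c i)
  let f : Fin m → QuotChain (LQ c) := fun i => shift (α i) (tau c (c i))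
  have hf : ∀ i e, f i e ≠ 0 → ∃ a : A n, lengthA a ≤ k i ∧
      e.1 = ((α i * a : A n) : A n ⧸ LQ c) := by
    intro i e he
    obtain ⟨w, hw, hl⟩ := exists_wordM_length (c i)
    have : f i = proj (LQ c) (pathChain (α i) w) := by
      rw [← mul_one (α i), proj_pathChain, ← sigma_wordM, hw]
      rfl
    rw [this] at he
    obtain ⟨a, ha, hea⟩ := exists_prefix_of_proj_pathChain_ne_zero w _ e he
    exact ⟨a, ha.trans_eq hl, hea⟩
  -- Indices are adjacent when their shifted chains have an edge in common.
  let Gr : SimpleGraph (Fin m) :=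
    { Adj := fun i j => i ≠ j ∧ ∃ e, f i e ≠ 0 ∧ f j e ≠ 0
      symm := ⟨fun i j ⟨hne, e, h1, h2⟩ => ⟨hne.symm, e, h2, h1⟩⟩
      loopless := ⟨fun i hi => hi.1 rfl⟩ }
  -- Each step from i to i' costs `k i + k i'`, so each vertex is charged at most twice. The extra
  -- summand `k i` on the left is the unused charge of the initial vertex, which pays for a step
  -- arriving there.
  have hwalk : ∀ {i j : Fin m} (p : Gr.Walk i j), ∃ l ∈ LQ c,
      lengthA ((α i)⁻¹ * α j * l) + k i ≤ 2 * (p.support.map k).sum := by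
    intro i j p
    induction p with
    | nil =>
      refine ⟨1, one_mem _, ?_⟩
      rw [inv_mul_cancel, one_mul, lengthA_one]
      simp
      omega
    | @cons i i' j hadj p ih =>
      obtain ⟨l, hl, hle⟩ := ih
      obtain ⟨-, e, h1, h2⟩ := hadj
      obtain ⟨a, ha, hea⟩ := hf i e h1
      obtain ⟨b, hb, heb⟩ := hf i' e h2
      have hmem : (α i * a)⁻¹ * (α i' * b) ∈ LQ c := by
        rw [← QuotientGroup.eq, ← hea, heb]
      -- The common edge has starts `α i * a` and `α i' * b` that differ by an element of `LQ c`;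
      -- this difference is put into the correction.
      refine ⟨((α i * a)⁻¹ * (α i' * b))⁻¹ * l, mul_mem (inv_mem hmem) hl, ?_⟩
      have e1 : (α i)⁻¹ * α j * (((α i * a)⁻¹ * (α i' * b))⁻¹ * l) =
          a * b⁻¹ * ((α i')⁻¹ * α j * l) := by
        apply Additive.ofMul.injective
        simp only [ofMul_mul, ofMul_inv]
        abel
      have h3 := lengthA_mul_le (a * b⁻¹) ((α i')⁻¹ * α j * l)
      have h4 := lengthA_mul_le a b⁻¹
      have h5 := lengthA_inv_le b
      rw [e1, SimpleGraph.Walk.support_cons, List.map_cons, List.sum_cons]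
      omega
  let r : Fin m → Fin m := fun i => (Gr.connectedComponentMk i).out
  have hr : ∀ i, Gr.Reachable (r i) i := fun i =>
    SimpleGraph.ConnectedComponent.exact (Quot.out_eq (Gr.connectedComponentMk i))
  have hl : ∀ i, ∃ l ∈ LQ c, lengthA ((α (r i))⁻¹ * α i * l) ≤ 2 * ∑ j, k j := by
    intro i
    -- A path visits each index at most once, so its cost is at most twice the full sum.
    obtain ⟨p, hp⟩ := (hr i).exists_isPath
    obtain ⟨l, hl, hle⟩ := hwalk p
    refine ⟨l, hl, (Nat.le_add_right _ _).trans (hle.trans (Nat.mul_le_mul_left 2 ?_))⟩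
    rw [← List.sum_toFinset _ hp.support_nodup]
    exact Finset.sum_le_univ_sum_of_nonneg fun _ => Nat.zero_le _
  choose l hlm hll using hl
  -- All members of a component are shifted by the inverse of the same α; the factor `l i` acts
  -- trivially on chains.
  refine ⟨fun i => (α (r i))⁻¹ * α i * l i, hll, ?_⟩
  -- At a given edge all non-zero contributions come from one component, so the partial sum there
  -- equals either the whole sum or zero.
  have hcomp : ∀ C : Gr.ConnectedComponent,
      ∑ i with Gr.connectedComponentMk i = C, f i = 0 := by
    intro C
    ext e
    rw [Finsupp.finsetSum_apply, Finsupp.coe_zero, Pi.zero_apply]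
    by_cases hC : ∃ i₀, Gr.connectedComponentMk i₀ = C ∧ f i₀ e ≠ 0
    · obtain ⟨i₀, rfl, hi₀⟩ := hC
      have h0 : (∑ i, f i) e = 0 := by
        have h0 : ∑ i, f i = 0 := h
        rw [h0, Finsupp.coe_zero, Pi.zero_apply]
      rw [Finsupp.finsetSum_apply] at h0
      rw [← h0, Finset.sum_filter]
      refine Finset.sum_congr rfl fun i _ => ?_
      split_ifs with hi
      · rfl
      · by_contra hne
        refine hi (SimpleGraph.ConnectedComponent.sound ?_)
        rcases eq_or_ne i i₀ with rfl | hii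
        · exact SimpleGraph.Reachable.refl _
        · have : Gr.Adj i i₀ := ⟨hii, e, fun h => hne h.symm, hi₀⟩
          exact this.reachable
    · push Not at hC
      exact Finset.sum_eq_zero fun i hi => hC i (Finset.mem_filter.mp hi).2
  have e1 : ∀ i, shift ((α (r i))⁻¹ * α i * l i) (tau c (c i)) = shift (α (r i))⁻¹ (f i) := by
    intro i
    rw [← shift_shift, shift_of_mem (hlm i), ← shift_shift]
  rw [LatticeEq, Finset.sum_congr rfl fun i _ => e1 i,
    ← Finset.sum_fiberwise Finset.univ Gr.connectedComponentMk]
  refine Finset.sum_eq_zero fun C _ => ?_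
  have e2 : ∀ i ∈ Finset.univ.filter (fun i => Gr.connectedComponentMk i = C),
      shift (α (r i))⁻¹ (f i) = shift (α C.out)⁻¹ (f i) := by
    intro i hi
    rw [← (Finset.mem_filter.mp hi).2]
  rw [Finset.sum_congr rfl e2, ← shift_sum, hcomp, shift_zero]

theorem solvable_iff_exists_short {m : ℕ} (c : Fin m → M n) :
    Solvable (sphericalWord c) ↔ ∃ α : Fin m → A n,
      (∀ i, lengthA (α i) ≤ 2 * ∑ j, lengthM (c j)) ∧ LatticeEq c α := by
  rw [solvable_iff_exists_latticeEq]
  exact ⟨fun ⟨α, hα⟩ => exists_short_latticeEq c α hα, fun ⟨α, _, hα⟩ => ⟨α, hα⟩⟩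

end FreeMetab

/-! ### Exponents and characters of the free abelian group -/

namespace FreeMetab

variable {n : ℕ}

/-- The vector of exponents of an element of `A_n`. -/
noncomputable def expA : A n →* Multiplicative (Fin n → ℤ) :=
  Abelianization.lift (FreeGroup.lift fun i => Multiplicative.ofAdd (Pi.single i 1))

/-- The exponent of the generator `a_l`. -/
noncomputable def expo (a : A n) (l : Fin n) : ℤ := (expA a).toAdd l

theorem expA_genA (i : Fin n) : expA (genA i) = Multiplicative.ofAdd (Pi.single i 1) := by
  rw [expA, genA, Abelianization.lift_apply_of, FreeGroup.lift_apply_of]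

theorem expo_genA (i l : Fin n) : expo (genA i) l = if l = i then 1 else 0 := by
  rw [expo, expA_genA, toAdd_ofAdd, Pi.single_apply]

theorem expo_mul (a b : A n) (l : Fin n) : expo (a * b) l = expo a l + expo b l := by
  rw [expo, map_mul]
  rfl

theorem expo_one (l : Fin n) : expo (1 : A n) l = 0 := by
  rw [expo, map_one]
  rfl

theorem expo_inv (a : A n) (l : Fin n) : expo a⁻¹ l = -expo a l := by
  rw [expo, map_inv]
  rfl

/-- Homomorphisms from `A_n` are determined by the images of the generators. -/
theorem hom_ext_genA {H : Type*} [CommGroup H] {φ ψ : A n →* H}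
    (h : ∀ i, φ (genA i) = ψ (genA i)) : φ = ψ :=
  Abelianization.hom_ext _ _ (FreeGroup.ext_hom _ _ h)

theorem prod_genA_zpow_expo (a : A n) : ∏ i, genA i ^ expo a i = a := by
  let φ : A n →* A n :=
    { toFun := fun a => ∏ i, genA i ^ expo a i
      map_one' := by simp [expo_one]
      map_mul' := fun a b => by simp only [expo_mul, zpow_add, Finset.prod_mul_distrib] }
  have h : φ = MonoidHom.id (A n) := hom_ext_genA fun i => by
    change ∏ j, genA j ^ expo (genA i) j = genA i
    simp only [expo_genA]
    rw [Finset.prod_eq_single i (fun j _ hj => by rw [if_neg hj, zpow_zero]) (by simp), if_pos rfl,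
      zpow_one]
  exact DFunLike.congr_fun h a

theorem expo_injective {a b : A n} (h : ∀ l, expo a l = expo b l) : a = b := by
  rw [← prod_genA_zpow_expo a, ← prod_genA_zpow_expo b]
  exact Finset.prod_congr rfl fun i _ => by rw [h]

theorem expo_wordA (w : List (Letter n)) (l : Fin n) :
    expo (wordA w) l = ((w.map fun x => if x = (l, true) then 1 else 0).sum : ℕ) -
      ((w.map fun x => if x = (l, false) then 1 else 0).sum : ℕ) := by
  induction w with
  | nil => simp [wordA_nil, expo_one]
  | cons x w ih =>
    obtain ⟨i, b⟩ := x
    have : wordA ((i, b) :: w) = wordA [(i, b)] * wordA w := wordA_append [(i, b)] w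
    rw [this, expo_mul, ih]
    cases b with
    | true =>
      rw [wordA_true, expo_genA]
      by_cases h : l = i
      · subst h; simp; ring
      · have h' : i ≠ l := fun e => h e.symm
        simp [h, h']
    | false =>
      rw [wordA_false, expo_inv, expo_genA]
      by_cases h : l = i
      · subst h; simp; ring
      · have h' : i ≠ l := fun e => h e.symm
        simp [h, h']

theorem sum_abs_expo_wordA_le (w : List (Letter n)) : ∑ l, |expo (wordA w) l| ≤ w.length := by
  induction w with
  | nil => simp [wordA_nil, expo_one]
  | cons x w ih =>
    obtain ⟨i, b⟩ := x
    have : wordA ((i, b) :: w) = wordA [(i, b)] * wordA w := wordA_append [(i, b)] w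
    have h1 : ∑ l, |expo (wordA [(i, b)]) l| = 1 := by
      cases b with
      | true =>
        simp only [wordA_true, expo_genA]
        simp [apply_ite]
      | false =>
        simp only [wordA_false, expo_inv, expo_genA, abs_neg]
        simp [apply_ite]
    calc ∑ l, |expo (wordA ((i, b) :: w)) l|
        ≤ ∑ l, (|expo (wordA [(i, b)]) l| + |expo (wordA w) l|) :=
          Finset.sum_le_sum fun l _ => by rw [this, expo_mul]; exact abs_add_le _ _
      _ ≤ _ := by
          rw [Finset.sum_add_distrib, h1, List.length_cons]
          push_cast
          linarith

theorem lengthA_genA_le (i : Fin n) : lengthA (genA i) ≤ 1 := lengthA_wordA_le [(i, true)]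

theorem lengthA_pow_le (a : A n) (k : ℕ) : lengthA (a ^ k) ≤ k * lengthA a := by
  induction k with
  | zero => simp [lengthA_one]
  | succ k ih =>
    rw [pow_succ, Nat.succ_mul]
    exact (lengthA_mul_le _ _).trans (Nat.add_le_add_right ih _)

theorem lengthA_zpow_genA_le (i : Fin n) (k : ℤ) : lengthA (genA i ^ k) ≤ k.natAbs := by
  have h := lengthA_pow_le (genA i) k.natAbs
  have h' := Nat.mul_le_mul_left k.natAbs (lengthA_genA_le i)
  rw [mul_one] at h'
  rcases Int.natAbs_eq k with e | e
  · conv_lhs => rw [e, zpow_natCast]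
    exact h.trans h'
  · conv_lhs => rw [e, zpow_neg, zpow_natCast]
    exact (lengthA_inv_le _).trans (h.trans h')

theorem lengthA_prod_le {ι : Type*} (S : Finset ι) (f : ι → A n) :
    lengthA (∏ i ∈ S, f i) ≤ ∑ i ∈ S, lengthA (f i) := by
  classical
  induction S using Finset.induction_on with
  | empty => simp [lengthA_one]
  | insert i S hi ih =>
    rw [Finset.prod_insert hi, Finset.sum_insert hi]
    exact (lengthA_mul_le _ _).trans (Nat.add_le_add_left ih _)

/-- The word length in the free abelian group is the sum of the absolute values of the exponents. -/
theorem lengthA_eq (a : A n) : lengthA a = ∑ l, (expo a l).natAbs := by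
  apply le_antisymm
  · conv_lhs => rw [← prod_genA_zpow_expo a]
    exact (lengthA_prod_le _ _).trans (Finset.sum_le_sum fun i _ => lengthA_zpow_genA_le i _)
  · obtain ⟨w, rfl, hw⟩ := exists_wordA_length a
    have := sum_abs_expo_wordA_le w
    rw [← hw]
    zify
    exact this

theorem lengthA_wordA_eq (w : List (Letter n)) :
    lengthA (wordA w) = ∑ l : Fin n,
      (((w.map fun x => if x = (l, true) then 1 else 0).sum -
          (w.map fun x => if x = (l, false) then 1 else 0).sum) +
        ((w.map fun x => if x = (l, false) then 1 else 0).sum -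
          (w.map fun x => if x = (l, true) then 1 else 0).sum)) := by
  rw [lengthA_eq]
  refine Finset.sum_congr rfl fun l _ => ?_
  rw [expo_wordA]
  omega

theorem abs_expo_le (a : A n) (l : Fin n) : |expo a l| ≤ lengthA a := by
  rw [lengthA_eq, Int.abs_eq_natAbs]
  exact_mod_cast Finset.single_le_sum (f := fun l => (expo a l).natAbs) (fun _ _ => Nat.zero_le _)
    (Finset.mem_univ l)

/-- The character of `A_n` with values in `ℤ/d` that maps `a_l` to `χ l`. -/
noncomputable def charA (d : ℕ) (χ : Fin n → ℕ) : A n →* Multiplicative (ZMod d) :=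
  Abelianization.lift (FreeGroup.lift fun i => Multiplicative.ofAdd (χ i : ZMod d))

theorem charA_genA (d : ℕ) (χ : Fin n → ℕ) (i : Fin n) :
    charA d χ (genA i) = Multiplicative.ofAdd (χ i : ZMod d) := by
  rw [charA, genA, Abelianization.lift_apply_of, FreeGroup.lift_apply_of]

/-- A natural number that represents the value of a character at a letter. -/
def weight (d : ℕ) (χ : Fin n → ℕ) (l : Letter n) : ℕ := if l.2 then χ l.1 else d - χ l.1

/-- The bound on `χ` ensures that the truncated difference in `weight` represents the negative of
`χ` modulo `d`, so values of characters can be computed with natural numbers. -/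
theorem charA_wordA {d : ℕ} {χ : Fin n → ℕ} (hχ : ∀ l, χ l < d) (w : List (Letter n)) :
    charA d χ (wordA w) = Multiplicative.ofAdd (((w.map (weight d χ)).sum : ℕ) : ZMod d) := by
  induction w with
  | nil => simp [wordA_nil]
  | cons x w ih =>
    obtain ⟨i, b⟩ := x
    have : wordA ((i, b) :: w) = wordA [(i, b)] * wordA w := wordA_append [(i, b)] w
    rw [this, map_mul, ih, List.map_cons, List.sum_cons, Nat.cast_add, ofAdd_add]
    congr 1
    cases b with
    | true => rw [wordA_true, charA_genA, weight, if_pos rfl]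
    | false =>
      rw [wordA_false, map_inv, charA_genA, weight, if_neg (by simp), Nat.cast_sub (hχ i).le,
        ZMod.natCast_self, zero_sub, ofAdd_neg]

theorem charA_eq (d : ℕ) (χ : Fin n → ℕ) (a : A n) :
    charA d χ a = Multiplicative.ofAdd ((∑ l, χ l * expo a l : ℤ) : ZMod d) := by
  let φ : A n →* Multiplicative (ZMod d) :=
    { toFun := fun a => Multiplicative.ofAdd ((∑ l, χ l * expo a l : ℤ) : ZMod d)
      map_one' := by simp [expo_one]
      map_mul' := fun a b => by
        simp only [expo_mul, mul_add, Finset.sum_add_distrib, Int.cast_add, ofAdd_add] }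
  have h : charA d χ = φ := hom_ext_genA fun i => by
    change _ = Multiplicative.ofAdd ((∑ l, χ l * expo (genA i) l : ℤ) : ZMod d)
    simp [charA_genA, expo_genA]
  exact DFunLike.congr_fun h a

theorem charA_eq_one_iff (d : ℕ) (χ : Fin n → ℕ) (a : A n) :
    charA d χ a = 1 ↔ (d : ℤ) ∣ ∑ l, χ l * expo a l := by
  rw [charA_eq, ofAdd_eq_one, ZMod.intCast_zmod_eq_zero_iff_dvd]

/-- Membership in a subgroup generated by short elements is detected by characters of small
order. -/
theorem mem_closure_iff_charA {ι : Type*} (c : ι → A n) {N : ℕ} (hN : 1 ≤ N)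
    (hc : ∀ i, lengthA (c i) ≤ N) {g : A n} (hg : lengthA g ≤ N) :
    g ∈ Subgroup.closure (Set.range c) ↔ ∀ d, 0 < d → d ≤ Lattice.sepBound n N →
      ∀ χ : Fin n → ℕ, (∀ l, χ l < d) → (∀ i, charA d χ (c i) = 1) → charA d χ g = 1 := by
  constructor
  · intro h d _ _ χ _ hχ
    have : Subgroup.closure (Set.range c) ≤ (charA d χ).ker := by
      rw [Subgroup.closure_le]
      rintro _ ⟨i, rfl⟩
      exact hχ i
    exact this h
  · intro h
    by_contra hne
    -- Non-membership is transferred to exponent vectors, where the separation theorem for lattices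
    -- applies.
    have hv : expo g ∉ AddSubgroup.closure (Set.range fun i => expo (c i)) := by
      intro hv
      have : ∀ v ∈ AddSubgroup.closure (Set.range fun i => expo (c i)),
          ∃ a ∈ Subgroup.closure (Set.range c), expo a = v := by
        intro v hv
        induction hv using AddSubgroup.closure_induction with
        | mem v hv =>
          obtain ⟨i, rfl⟩ := hv
          exact ⟨c i, Subgroup.subset_closure ⟨i, rfl⟩, rfl⟩
        | zero => exact ⟨1, one_mem _, funext expo_one⟩
        | add v w _ _ hv hw =>
          obtain ⟨a, ha, rfl⟩ := hv
          obtain ⟨b, hb, rfl⟩ := hw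
          exact ⟨a * b, mul_mem ha hb, funext fun l => expo_mul a b l⟩
        | neg v _ hv =>
          obtain ⟨a, ha, rfl⟩ := hv
          exact ⟨a⁻¹, inv_mem ha, funext fun l => expo_inv a l⟩
      obtain ⟨a, ha, e⟩ := this _ hv
      rw [expo_injective (fun l => congrFun e l)] at ha
      exact hne ha
    obtain ⟨d, hd, hdle, χ, h1, h2, h3⟩ := Lattice.exists_separating_character
      (fun i => expo (c i)) hN
      (fun i l => (abs_expo_le (c i) l).trans (by exact_mod_cast hc i))
      (fun l => (abs_expo_le g l).trans (by exact_mod_cast hg)) hv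
    have := h d hd hdle χ h1 fun i => (charA_eq_one_iff d χ (c i)).mpr (h2 i)
    exact h3 ((charA_eq_one_iff d χ g).mp this)

end FreeMetab

/-! ### Scanning a string that encodes a tuple of words -/

namespace FreeMetab

variable {n : ℕ} {β : Type} {Z : Type*} [AddCommMonoid Z]

/-- One step of a scan: the state holds the number of commas read and the letters read since the
last comma. The reader `κ` turns symbols into letters and commas, or ignores them. -/
def scanStep (κ : β → Option (Option (Letter n))) (st : ℕ × List (Letter n)) (b : β) :
    ℕ × List (Letter n) :=
  match κ b with
  | none => st
  | some none => (st.1 + 1, [])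
  | some (some l) => (st.1, st.2 ++ [l])

/-- The state after scanning a string. -/
def scan (κ : β → Option (Option (Letter n))) (st : ℕ × List (Letter n)) (s : List β) :
    ℕ × List (Letter n) :=
  s.foldl (scanStep κ) st

/-- The letter at a position. -/
def letterAt (κ : β → Option (Option (Letter n))) (s : List β) (p : ℕ) : Option (Letter n) :=
  (s[p]?.bind κ).join

/-- A sum over the positions of letters that depends on the state of the scan. -/
def posSum (κ : β → Option (Option (Letter n))) (F : ℕ × List (Letter n) → Letter n → Z)
    (st : ℕ × List (Letter n)) (s : List β) : Z :=
  ∑ p ∈ Finset.range s.length, (letterAt κ s p).elim 0 (F (scan κ st (s.take p)))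

/-- A sum over the letters of a word that depends on the prefixes. -/
def wordSum (F : List (Letter n) → Letter n → Z) : List (Letter n) → List (Letter n) → Z
  | _, [] => 0
  | u, l :: w => F u l + wordSum F (u ++ [l]) w

variable {κ : β → Option (Option (Letter n))}

theorem posSum_nil (F : ℕ × List (Letter n) → Letter n → Z) (st) : posSum κ F st [] = 0 := by
  simp [posSum]

theorem posSum_cons (F : ℕ × List (Letter n) → Letter n → Z) (st) (b : β) (s : List β) :
    posSum κ F st (b :: s) = (κ b).join.elim 0 (F st) + posSum κ F (scanStep κ st b) s := by
  rw [posSum, List.length_cons, Finset.sum_range_succ', add_comm]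
  rfl

/-- Ignored symbols neither carry a letter nor change the state of the scan. This permits reading
both tuples from the single string x#y. -/
theorem posSum_filterMap (F : ℕ × List (Letter n) → Letter n → Z) (st) (s : List β) :
    posSum κ F st s = posSum some F st (s.filterMap κ) := by
  induction s generalizing st with
  | nil => simp only [List.filterMap_nil, posSum_nil]
  | cons b s ih =>
    rw [posSum_cons, ih]
    rcases h : κ b with _ | o
    · simp [h, scanStep]
    · rw [List.filterMap_cons_some h, posSum_cons]
      simp [h, scanStep]

theorem posSum_word_append (F : ℕ × List (Letter n) → Letter n → Z) (j : ℕ)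
    (u w : List (Letter n)) (s : List (Option (Letter n))) :
    posSum some F (j, u) (w.map some ++ s) =
      wordSum (fun u => F (j, u)) u w + posSum some F (j, u ++ w) s := by
  induction w generalizing u with
  | nil => simp [wordSum]
  | cons l w ih =>
    rw [List.map_cons, List.cons_append, posSum_cons, wordSum, add_assoc]
    have : scanStep some (j, u) (some l) = (j, u ++ [l]) := rfl
    rw [this, ih, List.append_assoc]
    rfl

theorem encodeWords_cons_cons (w w' : List (Letter n)) (ws : List (List (Letter n))) :
    encodeWords (w :: w' :: ws) = w.map some ++ none :: encodeWords (w' :: ws) := by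
  simp [encodeWords, List.intercalate]

theorem encodeWords_singleton (w : List (Letter n)) : encodeWords [w] = w.map some := by
  simp [encodeWords, List.intercalate]

theorem posSum_encodeWords_aux (F : ℕ × List (Letter n) → Letter n → Z) (m j : ℕ)
    (w : Fin (m + 1) → List (Letter n)) :
    posSum some F (j, []) (encodeWords (List.ofFn w)) =
      ∑ i : Fin (m + 1), wordSum (fun u => F (j + i, u)) [] (w i) := by
  induction m generalizing j with
  | zero =>
    have := posSum_word_append F j [] (w 0) []
    rw [List.append_nil, posSum_nil, add_zero] at this
    simp [List.ofFn_succ, encodeWords_singleton, this]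
  | succ m ih =>
    have h := ih (j + 1) fun i => w i.succ
    rw [List.ofFn_succ] at h
    rw [List.ofFn_succ, List.ofFn_succ, encodeWords_cons_cons, posSum_word_append, posSum_cons]
    have e : scanStep some (j, [] ++ w 0) (none : Option (Letter n)) = (j + 1, []) := rfl
    rw [e, h, Fin.sum_univ_succ (n := m + 1)]
    refine congrArg₂ (· + ·) rfl ((zero_add _).trans (Finset.sum_congr rfl fun i _ => ?_))
    rw [Fin.val_succ, add_assoc, add_comm 1]

/-- Sums over the letters of all words become sums over positions of the input, the form that a
program can evaluate. -/
theorem posSum_encodeWords (F : ℕ × List (Letter n) → Letter n → Z) {m : ℕ} (hm : 0 < m)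
    (w : Fin m → List (Letter n)) (s : List β)
    (hs : s.filterMap κ = encodeWords (List.ofFn w)) :
    posSum κ F (0, []) s = ∑ i : Fin m, wordSum (fun u => F (i, u)) [] (w i) := by
  obtain ⟨m, rfl⟩ := Nat.exists_eq_succ_of_ne_zero hm.ne'
  rw [posSum_filterMap, hs]
  have := posSum_encodeWords_aux F m 0 w
  simpa only [zero_add] using this

theorem wordSum_of_letter (f : Letter n → Z) (u w : List (Letter n)) :
    wordSum (fun _ => f) u w = (w.map f).sum := by
  induction w generalizing u with
  | nil => rfl
  | cons l w ih => rw [wordSum, ih, List.map_cons, List.sum_cons]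

theorem count_encodeWords (m : ℕ) (w : Fin (m + 1) → List (Letter n)) :
    (encodeWords (List.ofFn w)).count none = m := by
  have h0 : ∀ w : List (Letter n), (w.map some).count none = 0 := fun w => by
    rw [List.count_eq_zero]
    simp
  induction m with
  | zero => simp [List.ofFn_succ, encodeWords_singleton, h0]
  | succ m ih =>
    have h := ih fun i => w i.succ
    rw [List.ofFn_succ] at h
    rw [List.ofFn_succ, List.ofFn_succ, encodeWords_cons_cons, List.count_append, h0,
      List.count_cons_self, h, zero_add]

theorem exists_encodeWords (x : List (Option (Letter n))) :
    ∃ (m : ℕ) (w : Fin (m + 1) → List (Letter n)), x = encodeWords (List.ofFn w) := by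
  suffices h : ∃ (w : List (Letter n)) (ws : List (List (Letter n))), x = encodeWords (w :: ws) by
    obtain ⟨w, ws, rfl⟩ := h
    exact ⟨ws.length, (w :: ws).get, by rw [List.ofFn_get]⟩
  induction x with
  | nil => exact ⟨[], [], rfl⟩
  | cons o x ih =>
    obtain ⟨w, ws, rfl⟩ := ih
    cases o with
    | none => exact ⟨[], w :: ws, by rw [encodeWords_cons_cons]; rfl⟩
    | some l =>
      refine ⟨l :: w, ws, ?_⟩
      cases ws with
      | nil => simp [encodeWords_singleton]
      | cons w' ws => simp [encodeWords_cons_cons]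

theorem length_encodeWords_le (ws : List (List (Letter n))) :
    (encodeWords ws).length ≤ (ws.map fun w => w.length + 1).sum := by
  cases ws with
  | nil => simp [encodeWords, List.intercalate]
  | cons w ws =>
    induction ws generalizing w with
    | nil => simp [encodeWords_singleton]
    | cons w' ws ih =>
      have := ih w'
      rw [encodeWords_cons_cons]
      simp only [List.length_append, List.length_map, List.length_cons, List.map_cons,
        List.sum_cons] at this ⊢
      omega

/-- The commas number one less than the words. This bounds both the number of words and their total
length by the input length plus one. -/
theorem sum_length_add_le_length_encodeWords (ws : List (List (Letter n))) :
    (ws.map List.length).sum + ws.length ≤ (encodeWords ws).length + 1 := by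
  cases ws with
  | nil => simp
  | cons w ws =>
    induction ws generalizing w with
    | nil => simp [encodeWords_singleton]
    | cons w' ws ih =>
      have := ih w'
      rw [encodeWords_cons_cons]
      simp only [List.length_append, List.length_map, List.length_cons, List.map_cons,
        List.sum_cons] at this ⊢
      omega

/-! #### Numerical descriptions of the state of the scan -/

/-- Whether there is a comma at a position, as a number. -/
def commaAt (κ : β → Option (Option (Letter n))) (s : List β) (p : ℕ) : ℕ :=
  if s[p]?.bind κ = some none then 1 else 0

/-- The number of commas before a position. -/
def idx (κ : β → Option (Option (Letter n))) (s : List β) (p : ℕ) : ℕ :=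
  ∑ q ∈ Finset.range p, commaAt κ s q

/-- The weight of the letters between the last comma before a position and this position. -/
def preWeight (κ : β → Option (Option (Letter n))) (φ : Letter n → ℕ) (s : List β) (p : ℕ) : ℕ :=
  ∑ q ∈ Finset.range p, if idx κ s q = idx κ s p then (letterAt κ s q).elim 0 φ else 0

/-- The weight of the letters of a word. -/
def blockWeight (κ : β → Option (Option (Letter n))) (φ : Letter n → ℕ) (s : List β) (i : ℕ) : ℕ :=
  ∑ q ∈ Finset.range s.length, if idx κ s q = i then (letterAt κ s q).elim 0 φ else 0

theorem scan_take_succ (st) (s : List β) (p : ℕ) (b : β) (h : s[p]? = some b) :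
    scan κ st (s.take (p + 1)) = scanStep κ (scan κ st (s.take p)) b := by
  rw [scan, List.take_add_one, h, Option.toList_some, List.foldl_append]
  rfl

theorem scan_fst (s : List β) (p : ℕ) (hp : p ≤ s.length) :
    (scan κ (0, []) (s.take p)).1 = idx κ s p := by
  induction p with
  | zero => simp [idx, scan]
  | succ p ih =>
    have h : s[p]? = some (s[p]'hp) := List.getElem?_eq_getElem _
    rw [scan_take_succ _ _ _ _ h, idx, Finset.sum_range_succ, ← idx, ← ih (Nat.le_of_succ_le hp),
      commaAt, h, Option.bind_some, scanStep]
    rcases κ s[p] with _ | _ | l <;> simp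

theorem idx_mono (s : List β) {p q : ℕ} (h : p ≤ q) : idx κ s p ≤ idx κ s q :=
  Finset.sum_le_sum_of_subset (Finset.range_mono h)

/-- The letters kept by the scan are those at the `q < p` with as many commas before `q` as before
`p`; reading a comma raises `idx` and empties this set. -/
theorem scan_snd (φ : Letter n → ℕ) (s : List β) (p : ℕ) (hp : p ≤ s.length) :
    ((scan κ (0, []) (s.take p)).2.map φ).sum = preWeight κ φ s p := by
  induction p with
  | zero => simp [preWeight, scan]
  | succ p ih =>
    have h : s[p]? = some (s[p]'hp) := List.getElem?_eq_getElem _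
    have hi : idx κ s (p + 1) = idx κ s p + commaAt κ s p := Finset.sum_range_succ _ _
    have ih := ih (Nat.le_of_succ_le hp)
    rw [scan_take_succ _ _ _ _ h, preWeight, Finset.sum_range_succ, scanStep, hi]
    rcases hk : κ s[p] with _ | _ | l
    · have hc : commaAt κ s p = 0 := by simp [commaAt, h, hk]
      have hl : letterAt κ s p = none := by simp [letterAt, h, hk]
      rw [hc, hl, add_zero, ← preWeight]
      simpa using ih
    · have hc : commaAt κ s p = 1 := by simp [commaAt, h, hk]
      rw [hc, if_neg (by omega), add_zero]
      refine (Finset.sum_eq_zero fun q hq => if_neg ?_).symm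
      have := idx_mono (κ := κ) s (Finset.mem_range.mp hq).le
      omega
    · have hc : commaAt κ s p = 0 := by simp [commaAt, h, hk]
      have hl : letterAt κ s p = some l := by simp [letterAt, h, hk]
      rw [hc, hl, add_zero, ← preWeight, if_pos rfl, ← ih]
      simp

theorem blockWeight_eq (φ : Letter n → ℕ) {m : ℕ} (w : Fin m → List (Letter n)) (s : List β)
    (hs : s.filterMap κ = encodeWords (List.ofFn w)) (i : Fin m) :
    blockWeight κ φ s i = ((w i).map φ).sum := by
  have h := posSum_encodeWords (κ := κ) (fun st l => if st.1 = i then φ l else 0) i.pos w s hs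
  have h1 : posSum κ (fun st l => if st.1 = i then φ l else 0) (0, []) s = blockWeight κ φ s i := by
    refine Finset.sum_congr rfl fun p hp => ?_
    rw [← scan_fst s p (Finset.mem_range.mp hp).le]
    rcases letterAt κ s p with _ | l
    · simp
    · rfl
  rw [← h1, h, Finset.sum_eq_single i]
  · simpa using wordSum_of_letter φ [] (w i)
  · intro j _ hj
    have : (j : ℕ) ≠ i := fun e => hj (Fin.ext e)
    simp only [this, if_false]
    rw [wordSum_of_letter]
    simp
  · simp

theorem idx_length {m : ℕ} (w : Fin (m + 1) → List (Letter n)) (s : List β)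
    (hs : s.filterMap κ = encodeWords (List.ofFn w)) : idx κ s s.length = m := by
  rw [← count_encodeWords m w, ← hs]
  clear hs
  induction s with
  | nil => simp [idx]
  | cons b s ih =>
    rw [idx, List.length_cons, Finset.sum_range_succ']
    have : ∑ k ∈ Finset.range s.length, commaAt κ (b :: s) (k + 1) = idx κ s s.length := rfl
    rw [this, ih]
    rcases h : κ b with _ | _ | l
    · simp [commaAt, h]
    · rw [List.filterMap_cons_some h]
      simp [commaAt, h]
    · rw [List.filterMap_cons_some h]
      simp [commaAt, h]

theorem length_scan_le (s : List β) (p : ℕ) (hp : p < s.length) :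
    (scan κ (0, []) (s.take p)).2.length ≤ s.length := by
  have h : ∀ (t : List β) (st : ℕ × List (Letter n)),
      (scan κ st t).2.length ≤ st.2.length + t.length := by
    intro t
    induction t with
    | nil => intro st; simp [scan]
    | cons b t ih =>
      intro st
      refine (ih (scanStep κ st b)).trans ?_
      rw [scanStep, List.length_cons]
      rcases κ b with _ | _ | l <;> simp <;> omega
  have := h (s.take p) (0, [])
  rw [List.length_take] at this
  simp only [List.length_nil, zero_add] at this
  omega

theorem scan_fst_lt {m : ℕ} (w : Fin (m + 1) → List (Letter n)) (s : List β)
    (hs : s.filterMap κ = encodeWords (List.ofFn w)) {p : ℕ} (hp : p < s.length) :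
    (scan κ (0, []) (s.take p)).1 < m + 1 := by
  rw [scan_fst s p hp.le, Nat.lt_succ_iff, ← idx_length w s hs]
  exact idx_mono s hp.le

end FreeMetab

/-! ### A numerical criterion for the lattice equation -/

namespace FreeMetab

variable {n : ℕ} {β : Type}

/-- The sign with which a path labelled by a letter traverses an edge. -/
def sgn (l : Letter n) : ℤ := if l.2 then 1 else -1

/-- The word that leads from the start of a letter to the start of the edge it traverses. -/
def edgeStart (l : Letter n) : List (Letter n) := if l.2 then [] else [l]

/-- Each letter contributes one signed edge. For an inverse letter the edge starts where the step
ends, so that letter is included in the word leading to the start. -/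
theorem proj_pathChain_eq_wordSum (L : Subgroup (A n)) (g : A n) (u w : List (Letter n)) :
    proj L (pathChain (g * wordA u) w) = wordSum (fun u l =>
      Finsupp.single (((g * wordA (u ++ edgeStart l) : A n) : A n ⧸ L), l.1) (sgn l)) u w := by
  induction w generalizing u with
  | nil => rw [pathChain, proj_zero, wordSum]
  | cons l w ih =>
    obtain ⟨i, b⟩ := l
    cases b with
    | true =>
      rw [pathChain, proj_add, proj_single, wordSum, ← ih, wordA_append u [(i, true)], wordA_true,
        mul_assoc]
      simp [edgeStart, sgn]
    | false =>
      rw [pathChain, proj_add, proj_neg, proj_single, wordSum, ← ih, wordA_append u [(i, false)],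
        wordA_false, mul_assoc, ← Finsupp.single_neg]
      simp [edgeStart, sgn, wordA_append, wordA_false]

/-- A sum of multiples of basis vectors vanishes if and only if the coefficients of each of the
vectors that occur have sum zero. -/
theorem sum_elim_single_eq_zero_iff {ι B E : Type*} [DecidableEq E] (S : Finset ι)
    (o : ι → Option B) (e : ι → B → E) (ε : B → ℤ) :
    ∑ p ∈ S, (o p).elim 0 (fun l => Finsupp.single (e p l) (ε l)) = 0 ↔
      ∀ p ∈ S, ∀ l, o p = some l →
        ∑ q ∈ S, (o q).elim 0 (fun l' => if e p l = e q l' then ε l' else 0) = 0 := by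
  have key : ∀ x, (∑ p ∈ S, (o p).elim 0 (fun l => Finsupp.single (e p l) (ε l))) x =
      ∑ q ∈ S, (o q).elim 0 (fun l' => if x = e q l' then ε l' else 0) := by
    intro x
    rw [Finsupp.finsetSum_apply]
    refine Finset.sum_congr rfl fun q _ => ?_
    rcases o q with _ | l'
    · rfl
    · simp [Finsupp.single_apply, eq_comm]
  constructor
  · intro h p _ l _
    rw [← key, h, Finsupp.coe_zero, Pi.zero_apply]
  · intro h
    ext x
    rw [key, Finsupp.coe_zero, Pi.zero_apply]
    by_cases hx : ∃ p ∈ S, ∃ l, o p = some l ∧ x = e p l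
    · obtain ⟨p, hp, l, hl, rfl⟩ := hx
      exact h p hp l hl
    · push Not at hx
      refine Finset.sum_eq_zero fun q hq => ?_
      rcases ho : o q with _ | l'
      · rfl
      · simp [hx q hq l' ho]

/-- Programs work with natural numbers, so a vanishing signed count is replaced by equality of the
positive and negative counts. -/
theorem sum_elim_sgn_eq_zero_iff {ι : Type*} (S : Finset ι) (o : ι → Option (Letter n))
    (P : ι → Letter n → Prop) [∀ q l, Decidable (P q l)] :
    ∑ q ∈ S, (o q).elim 0 (fun l => if P q l then sgn l else 0) = 0 ↔
      ∑ q ∈ S, (o q).elim 0 (fun l => if l.2 = true ∧ P q l then 1 else 0) =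
        ∑ q ∈ S, (o q).elim 0 (fun l => if l.2 = false ∧ P q l then 1 else 0) := by
  have : ∑ q ∈ S, (o q).elim 0 (fun l => if P q l then sgn l else 0) =
      ((∑ q ∈ S, (o q).elim 0 (fun l => if l.2 = true ∧ P q l then 1 else 0) : ℕ) : ℤ) -
        ((∑ q ∈ S, (o q).elim 0 (fun l => if l.2 = false ∧ P q l then 1 else 0) : ℕ) : ℤ) := by
    rw [Nat.cast_sum, Nat.cast_sum, ← Finset.sum_sub_distrib]
    refine Finset.sum_congr rfl fun q _ => ?_
    rcases o q with _ | ⟨i, b⟩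
    · simp
    · by_cases h : P q (i, b) <;> cases b <;> simp [h, sgn]
  rw [this, sub_eq_zero, Nat.cast_inj]

/-- The digits of `X` in base `d`. -/
def digit (d X : ℕ) (l : Fin n) : ℕ := X / d ^ (l : ℕ) % d

/-- The digits in base `d` encode a tuple `χ` in one number below `d ^ n`, which turns the
quantifier over characters into a bounded one. -/
theorem forall_digit_iff (d : ℕ) (hd : 0 < d) (P : (Fin n → ℕ) → Prop) :
    (∀ χ : Fin n → ℕ, (∀ l, χ l < d) → P χ) ↔ ∀ X < d ^ n, P (digit d X) := by
  constructor
  · exact fun h X _ => h _ fun l => Nat.mod_lt _ hd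
  · intro h χ hχ
    have h1 := h _ (finFunctionFinEquiv (m := d) (n := n) fun l => ⟨χ l, hχ l⟩).2
    have h2 : digit d (finFunctionFinEquiv (m := d) (n := n) fun l => ⟨χ l, hχ l⟩) = χ := by
      funext l
      have h3 := congrFun (finFunctionFinEquiv.symm_apply_apply
        (fun l : Fin n => (⟨χ l, hχ l⟩ : Fin d))) l
      rw [digit, ← finFunctionFinEquiv_symm_apply_val, h3]
    rwa [h2] at h1

/-- The value modulo `d` of a character at the start of the edge of the letter at position `p`. -/
def edgeValue (κ κ' : β → Option (Option (Letter n))) (s : List β) (φ : Letter n → ℕ) (p : ℕ)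
    (l : Letter n) : ℕ :=
  blockWeight κ' φ s (idx κ s p) + preWeight κ φ s p + if l.2 then 0 else φ l

/-- The letters at the positions `p` and `q` traverse the same edge of the quotient graph. -/
def SameEdge (κ κ' : β → Option (Option (Letter n))) (s : List β) (p : ℕ) (l : Letter n) (q : ℕ)
    (l' : Letter n) : Prop :=
  l.1 = l'.1 ∧ ∀ d < Lattice.sepBound n (4 * s.length + 2) + 1, 0 < d → ∀ X < d ^ n,
    (∀ i < idx κ s s.length + 1, d ∣ blockWeight κ (weight d (digit d X)) s i) →
      edgeValue κ κ' s (weight d (digit d X)) p l ≡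
        edgeValue κ κ' s (weight d (digit d X)) q l' [MOD d]

/-- The lattice equation in terms of the positions of a string. -/
def PosLatticeEq (κ κ' : β → Option (Option (Letter n))) (s : List β) : Prop :=
  open Classical in
  ∀ p < s.length, ∀ l, letterAt κ s p = some l →
    ∑ q ∈ Finset.range s.length, (letterAt κ s q).elim 0 (fun l' =>
        if l'.2 = true ∧ SameEdge κ κ' s p l q l' then 1 else 0) =
      ∑ q ∈ Finset.range s.length, (letterAt κ s q).elim 0 (fun l' =>
        if l'.2 = false ∧ SameEdge κ κ' s p l q l' then 1 else 0)

section

variable {κ κ' : β → Option (Option (Letter n))} {m : ℕ} {w v : Fin (m + 1) → List (Letter n)}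
  {s : List β}

/-- A word that leads to the start of the edge traversed by a letter, in terms of the state of a
scan. -/
def edgeWord (v : Fin (m + 1) → List (Letter n)) (st : ℕ × List (Letter n)) (l : Letter n) :
    List (Letter n) :=
  -- The empty word is a dummy value: by `scan_fst_lt` the first case holds at every position of the
  -- string.
  (if h : st.1 < m + 1 then v ⟨st.1, h⟩ else []) ++ (st.2 ++ edgeStart l)

theorem latticeEq_iff_posSum (hs : s.filterMap κ = encodeWords (List.ofFn w)) :
    LatticeEq (fun i => wordM (w i)) (fun i => wordA (v i)) ↔
      posSum κ (fun st l => (Finsupp.single (((wordA (edgeWord v st l) : A n) :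
        A n ⧸ LQ fun i => wordM (w i)), l.1) (sgn l) : QuotChain (LQ fun i => wordM (w i))))
        (0, []) s = 0 := by
  rw [posSum_encodeWords _ (Nat.succ_pos m) w s hs, LatticeEq]
  refine Eq.congr (Finset.sum_congr rfl fun i _ => ?_) rfl
  have h := proj_pathChain_eq_wordSum (LQ fun i => wordM (w i)) (wordA (v i)) [] (w i)
  rw [wordA_nil, proj_pathChain, ← sigma_wordM] at h
  refine h.trans ?_
  congr 1
  funext u l
  simp only [edgeWord, i.2, dif_pos, wordA_append]

/-- The value splits along the word into the contributions of `v` at the current index, of the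
prefix already read and of `edgeStart`, which are the three terms of `edgeValue`. -/
theorem charA_edgeWord (hs : s.filterMap κ = encodeWords (List.ofFn w))
    (hs' : s.filterMap κ' = encodeWords (List.ofFn v)) {d : ℕ} {χ : Fin n → ℕ}
    (hχ : ∀ l, χ l < d) {p : ℕ} (hp : p < s.length) (l : Letter n) :
    charA d χ (wordA (edgeWord v (scan κ (0, []) (s.take p)) l)) =
      Multiplicative.ofAdd (edgeValue κ κ' s (weight d χ) p l : ZMod d) := by
  have h := scan_fst_lt w s hs hp
  have h1 : (edgeStart l).map (weight d χ) = if l.2 then [] else [weight d χ l] := by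
    rw [edgeStart]
    split_ifs <;> rfl
  have h2 := blockWeight_eq (κ := κ') (weight d χ) v s hs' ⟨_, h⟩
  simp only at h2
  rw [charA_wordA hχ, edgeWord, dif_pos h, List.map_append, List.map_append, List.sum_append,
    List.sum_append, scan_snd _ _ _ hp.le, ← h2, scan_fst _ _ hp.le, h1, edgeValue, add_assoc]
  split_ifs <;> simp

theorem length_word_le (hs : s.filterMap κ = encodeWords (List.ofFn w)) (i : Fin (m + 1)) :
    (w i).length ≤ s.length := by
  have h4 := sum_length_add_le_length_encodeWords (List.ofFn w)
  rw [← hs, List.length_ofFn, List.map_ofFn, List.sum_ofFn] at h4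
  have h5 := List.length_filterMap_le κ s
  have h6 := Finset.single_le_sum (f := fun i => (w i).length) (fun _ _ => Nat.zero_le _)
    (Finset.mem_univ i)
  simp only [Function.comp] at h4 h6
  omega

/-- The word of `v` and the prefix have length at most `s.length` each and `edgeStart` adds at most
one letter. Comparing two such elements gives the constant `4 * s.length + 2` in `SameEdge`. -/
theorem lengthA_edgeWord_le (hs' : s.filterMap κ' = encodeWords (List.ofFn v)) {p : ℕ}
    (hp : p < s.length) (l : Letter n) :
    lengthA (wordA (edgeWord v (scan κ (0, []) (s.take p)) l)) ≤ 2 * s.length + 1 := by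
  refine (lengthA_wordA_le _).trans ?_
  have h1 := length_scan_le (κ := κ) s p hp
  have h2 : (edgeStart l).length ≤ 1 := by
    rw [edgeStart]
    split_ifs <;> simp
  rw [edgeWord, List.length_append, List.length_append]
  split_ifs
  · have := length_word_le hs' ⟨_, ‹_›⟩
    omega
  · rw [List.length_nil]
    omega

/-- Two starts lie in one coset when their difference belongs to `LQ`. This difference and the
generators are short, so `mem_closure_iff_charA` reduces membership to characters of small order. -/
theorem edge_eq_iff (hs : s.filterMap κ = encodeWords (List.ofFn w))
    (hs' : s.filterMap κ' = encodeWords (List.ofFn v)) {p q : ℕ} (hp : p < s.length)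
    (hq : q < s.length) (l l' : Letter n) :
    ((((wordA (edgeWord v (scan κ (0, []) (s.take p)) l) : A n) :
        A n ⧸ LQ fun i => wordM (w i)), l.1) =
      (((wordA (edgeWord v (scan κ (0, []) (s.take q)) l') : A n) :
        A n ⧸ LQ fun i => wordM (w i)), l'.1)) ↔ SameEdge κ κ' s p l q l' := by
  rw [Prod.mk.injEq, and_comm, SameEdge]
  refine and_congr_right fun _ => ?_
  rw [QuotientGroup.eq, LQ]
  have hlen : lengthA ((wordA (edgeWord v (scan κ (0, []) (s.take p)) l))⁻¹ *
      wordA (edgeWord v (scan κ (0, []) (s.take q)) l')) ≤ 4 * s.length + 2 := by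
    refine (lengthA_mul_le _ _).trans ?_
    have h1 := lengthA_inv_le (wordA (edgeWord v (scan κ (0, []) (s.take p)) l))
    have h2 := lengthA_edgeWord_le (κ := κ) hs' hp l
    have h3 := lengthA_edgeWord_le (κ := κ) hs' hq l'
    omega
  rw [mem_closure_iff_charA _ (by omega) (fun i => ?_) hlen]
  · refine forall_congr' fun d => ?_
    rw [Nat.lt_succ_iff, forall_comm]
    refine forall_congr' fun _ => forall_congr' fun hd => ?_
    rw [forall_digit_iff d hd]
    refine forall_congr' fun X => forall_congr' fun _ => ?_
    have hχ : ∀ l : Fin n, digit d X l < d := fun l => Nat.mod_lt _ hd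
    refine imp_congr ?_ ?_
    · rw [idx_length w s hs]
      constructor
      · intro h i hi
        have h1 := h ⟨i, hi⟩
        rw [bar_wordM, charA_wordA hχ, ofAdd_eq_one, ZMod.natCast_eq_zero_iff] at h1
        rw [blockWeight_eq _ w s hs ⟨i, hi⟩]
        exact h1
      · intro h i
        have h1 := h i i.2
        rw [blockWeight_eq _ w s hs i] at h1
        rw [bar_wordM, charA_wordA hχ, ofAdd_eq_one, ZMod.natCast_eq_zero_iff]
        exact h1
    · rw [map_mul, map_inv, inv_mul_eq_one, charA_edgeWord hs hs' hχ hp,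
        charA_edgeWord hs hs' hχ hq, Multiplicative.ofAdd.injective.eq_iff,
        ZMod.natCast_eq_natCast_iff]
  · rw [bar_wordM]
    have := length_word_le hs i
    have := lengthA_wordA_le (w i)
    omega

/-- It suffices to inspect the edges that occur at some position of the string, and to count there
the traversals in each direction. -/
theorem latticeEq_iff_posLatticeEq (hs : s.filterMap κ = encodeWords (List.ofFn w))
    (hs' : s.filterMap κ' = encodeWords (List.ofFn v)) :
    LatticeEq (fun i => wordM (w i)) (fun i => wordA (v i)) ↔ PosLatticeEq κ κ' s := by
  classical
  rw [latticeEq_iff_posSum (v := v) hs, posSum, sum_elim_single_eq_zero_iff, PosLatticeEq]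
  refine forall_congr' fun p => ?_
  rw [Finset.mem_range]
  refine forall_congr' fun hp => forall_congr' fun l => forall_congr' fun _ => ?_
  rw [sum_elim_sgn_eq_zero_iff]
  have h : ∀ b : Bool, ∑ q ∈ Finset.range s.length, (letterAt κ s q).elim 0 (fun l' =>
      if l'.2 = b ∧ (((wordA (edgeWord v (scan κ (0, []) (s.take p)) l) : A n) :
          A n ⧸ LQ fun i => wordM (w i)), l.1) =
        (((wordA (edgeWord v (scan κ (0, []) (s.take q)) l') : A n) :
          A n ⧸ LQ fun i => wordM (w i)), l'.1) then 1 else 0) =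
      ∑ q ∈ Finset.range s.length, (letterAt κ s q).elim 0 (fun l' =>
        if l'.2 = b ∧ SameEdge κ κ' s p l q l' then 1 else 0) := by
    intro b
    refine Finset.sum_congr rfl fun q hq => ?_
    rcases letterAt κ s q with _ | l'
    · rfl
    · simp only [Option.elim, edge_eq_iff hs hs' hp (Finset.mem_range.mp hq)]
  rw [h, h]

end

end FreeMetab

/-! ### The checking relation is decided in polynomial time -/

namespace FreeMetab

open Complexity

section

variable {n : ℕ} {β X ι : Type} {str : X → List β} {V : ι → X → ℕ} {f : X → ℕ}
  {κ κ' : β → Option (Option (Letter n))} {φ : Letter n → X → ℕ}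

theorem rep_weight_digit {d c : X → ℕ} (hd : Rep str V d) (hc : Rep str V c) (l : Letter n) :
    Rep str V fun x => weight (d x) (digit (d x) (c x)) l := by
  have h : Rep str V fun x => digit (d x) (c x) l.1 := (hc.div (hd.pow _)).mod hd
  cases hl : l.2
  · exact (hd.sub h).congr fun x => by simp [weight, hl]
  · exact h.congr fun x => by simp [weight, hl]

theorem rep_sepBound (hf : Rep str V f) : Rep str V fun x => Lattice.sepBound n (f x) := by
  have h : Rep str V fun x => n.factorial * f x ^ n := (Rep.const _).mul (hf.pow n)
  exact h.mul (((h.mul hf).mul ((Rep.const 1).add ((Rep.const (n * n)).mul hf))).add (Rep.const 1))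

variable [Fintype β]

theorem rep_commaAt (hf : Rep str V f) : Rep str V fun x => commaAt κ (str x) (f x) := by
  classical
  refine (RepP.letter (fun a => κ a = some none) hf).indicator.congr fun x => ?_
  simp only [commaAt, Option.bind_eq_some_iff]

theorem rep_idx (hf : Rep str V f) : Rep str V fun x => idx κ (str x) (f x) :=
  Rep.sum (g := fun x q => commaAt κ (str x) q) hf (rep_commaAt Rep.newVar)

theorem repP_letterAt (hf : Rep str V f) (l : Letter n) :
    RepP str V fun x => letterAt κ (str x) (f x) = some l :=
  (RepP.letter (fun a => κ a = some (some l)) hf).congr fun x => by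
    simp only [letterAt, Option.join_eq_some_iff, Option.bind_eq_some_iff]

theorem rep_elim_letterAt (hf : Rep str V f) (hφ : ∀ l, Rep str V (φ l)) :
    Rep str V fun x => (letterAt κ (str x) (f x)).elim 0 fun l => φ l x := by
  classical
  refine (Rep.finsum Finset.univ fun l =>
    Rep.ite (repP_letterAt (κ := κ) hf l) (hφ l) (Rep.const 0)).congr fun x => ?_
  rcases letterAt κ (str x) (f x) with _ | l <;> simp

theorem rep_preWeight (hf : Rep str V f) (hφ : ∀ l, Rep str V (φ l)) :
    Rep str V fun x => preWeight κ (fun l => φ l x) (str x) (f x) := by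
  classical
  refine (Rep.sum hf (g := fun x q => if idx κ (str x) q = idx κ (str x) (f x) then
    (letterAt κ (str x) q).elim 0 fun l => φ l x else 0) ?_).congr fun x => rfl
  exact (Rep.ite (RepP.eq (rep_idx Rep.newVar) (rep_idx hf).weaken)
    (rep_elim_letterAt Rep.newVar fun l => (hφ l).weaken) (Rep.const 0)).congr fun x => by congr

theorem rep_blockWeight (hf : Rep str V f) (hφ : ∀ l, Rep str V (φ l)) :
    Rep str V fun x => blockWeight κ (fun l => φ l x) (str x) (f x) := by
  classical
  refine (Rep.sum Rep.length (g := fun x q => if idx κ (str x) q = f x then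
    (letterAt κ (str x) q).elim 0 fun l => φ l x else 0) ?_).congr fun x => rfl
  exact (Rep.ite (RepP.eq (rep_idx Rep.newVar) hf.weaken)
    (rep_elim_letterAt Rep.newVar fun l => (hφ l).weaken) (Rep.const 0)).congr fun x => by congr

theorem rep_edgeValue (hf : Rep str V f) (hφ : ∀ l, Rep str V (φ l)) (l : Letter n) :
    Rep str V fun x => edgeValue κ κ' (str x) (fun l => φ l x) (f x) l := by
  refine ((rep_blockWeight (rep_idx hf) hφ).add (rep_preWeight hf hφ)).add ?_
  cases l.2
  · exact (hφ l).congr fun x => by simp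
  · exact (Rep.const 0).congr fun x => by simp

/-- The formula is assembled quantifier by quantifier: each one adds a variable, read by
`Rep.newVar`, and `weaken` carries the outer ones along. For fixed `n` both `sepBound` and `d ^ n`
are polynomially bounded. -/
theorem repP_sameEdge {p q : X → ℕ} (hp : Rep str V p) (hq : Rep str V q) (l l' : Letter n) :
    RepP str V fun x => SameEdge κ κ' (str x) (p x) l (q x) l' := by
  refine (RepP.const _).and (RepP.forall_lt ((rep_sepBound (((Rep.const 4).mul Rep.length).add
    (Rep.const 2))).add (Rep.const 1)) (RepP.imp (RepP.lt (Rep.const 0) Rep.newVar)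
    (RepP.forall_lt (Rep.newVar.pow n) (RepP.imp (RepP.forall_lt
      ((rep_idx Rep.length).weaken.weaken.add (Rep.const 1)) ?_) ?_))))
  · exact RepP.dvd Rep.newVar.weaken.weaken (rep_blockWeight Rep.newVar
      (rep_weight_digit Rep.newVar.weaken.weaken Rep.newVar.weaken))
  · have hw := rep_weight_digit (n := n) (Rep.newVar (str := str) (V := V)).weaken Rep.newVar
    exact RepP.modEq Rep.newVar.weaken (rep_edgeValue hp.weaken.weaken hw l)
      (rep_edgeValue hq.weaken.weaken hw l')

theorem repP_posLatticeEq : RepP str V fun x => PosLatticeEq κ κ' (str x) := by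
  classical
  refine RepP.forall_lt Rep.length (RepP.forall_fin fun l =>
    RepP.imp (repP_letterAt Rep.newVar l) ?_)
  have h : ∀ b : Bool, Rep (str ∘ Prod.fst) (consVar V) fun x : X × ℕ =>
      ∑ q ∈ Finset.range (str x.1).length, (letterAt κ (str x.1) q).elim 0 (fun l' =>
        if l'.2 = b ∧ SameEdge κ κ' (str x.1) x.2 l q l' then 1 else 0) := fun b =>
    Rep.sum (g := fun x q => (letterAt κ (str x.1) q).elim 0 (fun l' =>
      if l'.2 = b ∧ SameEdge κ κ' (str x.1) x.2 l q l' then 1 else 0)) Rep.length.weaken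
      (rep_elim_letterAt Rep.newVar fun l' =>
        (RepP.and (RepP.const _) (repP_sameEdge Rep.newVar.weaken Rep.newVar l l')).indicator)
  exact RepP.eq (h true) (h false)

end

/-- The certificate relation in terms of the positions of a string from which the two tuples of
words are read. -/
def PosCertificate {n : ℕ} {β : Type} (κ κ' : β → Option (Option (Letter n))) (s : List β) : Prop :=
  idx κ s s.length = idx κ' s s.length ∧
  (∀ i < idx κ s s.length + 1, ∑ l : Fin n,
    ((blockWeight κ' (fun x => if x = (l, true) then 1 else 0) s i -
        blockWeight κ' (fun x => if x = (l, false) then 1 else 0) s i) +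
      (blockWeight κ' (fun x => if x = (l, false) then 1 else 0) s i -
        blockWeight κ' (fun x => if x = (l, true) then 1 else 0) s i)) ≤
    2 * ∑ j ∈ Finset.range (idx κ s s.length + 1), blockWeight κ (fun _ => 1) s j) ∧
  PosLatticeEq κ κ' s

theorem posCertificate_iff {n m : ℕ} {β : Type} {κ κ' : β → Option (Option (Letter n))}
    {s : List β} {w v : Fin (m + 1) → List (Letter n)}
    (hs : s.filterMap κ = encodeWords (List.ofFn w))
    (hs' : s.filterMap κ' = encodeWords (List.ofFn v)) :
    PosCertificate κ κ' s ↔ (∀ i, lengthA (wordA (v i)) ≤ 2 * ∑ j, (w j).length) ∧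
      LatticeEq (fun i => wordM (w i)) (fun i => wordA (v i)) := by
  rw [PosCertificate, idx_length w s hs, idx_length v s hs', latticeEq_iff_posLatticeEq hs hs',
    eq_self_iff_true, true_and, Fin.forall_iff]
  refine and_congr_left fun _ => forall_congr' fun i => forall_congr' fun hi => ?_
  have h1 : ∑ j ∈ Finset.range (m + 1), blockWeight κ (fun _ => 1) s j = ∑ j, (w j).length := by
    rw [Finset.sum_range]
    refine Finset.sum_congr rfl fun j _ => ?_
    rw [blockWeight_eq _ w s hs, List.map_const', List.sum_replicate, smul_eq_mul, mul_one]
  have h2 := fun l => blockWeight_eq (fun x => if x = l then 1 else 0) v s hs' ⟨i, hi⟩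
  simp only [h1, lengthA_wordA_eq, ← h2]

/-- Every string encodes a non-empty tuple of words, so the format imposes only that both tuples
have equal length, that is, equally many commas. -/
theorem certificate_iff {n : ℕ} {β : Type} {κ κ' : β → Option (Option (Letter n))}
    {s : List β} : certificate n (s.filterMap κ) (s.filterMap κ') ↔ PosCertificate κ κ' s := by
  constructor
  · rintro ⟨m, w, v, hm, hs, hs', h⟩
    obtain ⟨m, rfl⟩ := Nat.exists_eq_succ_of_ne_zero hm.ne'
    exact (posCertificate_iff hs hs').mpr h
  · intro h
    obtain ⟨m, w, hs⟩ := exists_encodeWords (s.filterMap κ)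
    obtain ⟨m', v, hs'⟩ := exists_encodeWords (s.filterMap κ')
    have hm := h.1
    rw [idx_length w s hs, idx_length v s hs'] at hm
    subst hm
    exact ⟨m + 1, w, v, Nat.succ_pos m, hs, hs', (posCertificate_iff hs hs').mp h⟩

theorem repP_posCertificate {n : ℕ} {β X ι : Type} [Fintype β] {str : X → List β}
    {V : ι → X → ℕ} {κ κ' : β → Option (Option (Letter n))} :
    RepP str V fun x => PosCertificate κ κ' (str x) := by
  have h0 : Rep str V fun x => idx κ (str x) (str x).length + 1 :=
    (rep_idx Rep.length).add (Rep.const 1)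
  refine (RepP.eq (rep_idx Rep.length) (rep_idx Rep.length)).and
    ((RepP.forall_lt h0 (RepP.le (Rep.finsum _ fun l => ?_) ((Rep.const 2).mul ?_))).and
      repP_posLatticeEq)
  · have h : ∀ b : Bool, Rep (str ∘ Prod.fst) (consVar V) fun p : X × ℕ =>
        blockWeight κ' (fun x => if x = (l, b) then 1 else 0) (str p.1) p.2 := fun b =>
      rep_blockWeight Rep.newVar fun x => Rep.const _
    exact ((h true).sub (h false)).add ((h false).sub (h true))
  · exact Rep.weaken (Rep.sum (g := fun x j => blockWeight κ (fun _ => 1) (str x) j) h0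
      (rep_blockWeight Rep.newVar fun _ => Rep.const 1))

end FreeMetab

/-! ### Recognising and reading pairs of strings. -/

namespace Complexity

variable {Γ Δ : Type}

/-- The reader of the first string of a pair. -/
def readFst : Option (Γ ⊕ Δ) → Option Γ
  | some (Sum.inl a) => some a
  | _ => none

/-- The reader of the second string of a pair. -/
def readSnd : Option (Γ ⊕ Δ) → Option Δ
  | some (Sum.inr b) => some b
  | _ => none

theorem filterMap_readFst (x : List Γ) (y : List Δ) :
    (pairString x y).filterMap readFst = x := by
  have h1 : (readFst : Option (Γ ⊕ Δ) → _) ∘ (fun a => some (Sum.inl a)) = some := rfl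
  have h2 : (readFst : Option (Γ ⊕ Δ) → _) ∘ (fun b => some (Sum.inr b)) = fun _ => none := rfl
  rw [pairString, List.filterMap_append, List.filterMap_map, h1, List.filterMap_some,
    List.filterMap_cons_none rfl, List.filterMap_map, h2]
  simp

theorem filterMap_readSnd (x : List Γ) (y : List Δ) :
    (pairString x y).filterMap readSnd = y := by
  have h1 : (readSnd : Option (Γ ⊕ Δ) → _) ∘ (fun a => some (Sum.inl a)) = fun _ => none := rfl
  have h2 : (readSnd : Option (Γ ⊕ Δ) → _) ∘ (fun b => some (Sum.inr b)) = some := rfl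
  rw [pairString, List.filterMap_append, List.filterMap_map, h1,
    List.filterMap_cons_none rfl, List.filterMap_map, h2, List.filterMap_some]
  simp

/-- Being a pair is expressed by bounded quantifiers over positions with a condition on one letter
at a time, as `RepP.letter` requires. -/
theorem exists_pairString_iff (s : List (Option (Γ ⊕ Δ))) :
    (∃ x y, s = pairString x y) ↔ ∃ q < s.length, (∃ c, s[q]? = some c ∧ c = none) ∧
      (∀ p < q, ∃ c, s[p]? = some c ∧ ∃ a, some (Sum.inl a) = c) ∧
      ∀ p < s.length, q < p → ∃ c, s[p]? = some c ∧ ∃ b, some (Sum.inr b) = c := by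
  constructor
  · rintro ⟨x, y, rfl⟩
    refine ⟨x.length, by simp [pairString], ⟨none, by simp [pairString], rfl⟩, fun p hp => ?_,
      fun p hp hxp => ?_⟩
    · refine ⟨_, ?_, x[p], rfl⟩
      rw [pairString, List.getElem?_append_left (by simpa using hp)]
      simp [hp]
    · obtain ⟨k, rfl⟩ := Nat.exists_eq_add_of_lt hxp
      have hk : k < y.length := by
        simp only [pairString, List.length_append, List.length_map, List.length_cons] at hp
        omega
      refine ⟨_, ?_, y[k], rfl⟩
      rw [pairString, List.getElem?_append_right (by simp; omega), List.length_map,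
        show x.length + k + 1 - x.length = k + 1 by omega, List.getElem?_cons_succ]
      simp [hk]
  · rintro ⟨q, hq, ⟨_, hc, rfl⟩, h1, h2⟩
    have hx : s.take q ∈ Set.range (List.map fun a : Γ => (some (Sum.inl a) : Option (Γ ⊕ Δ))) := by
      rw [Set.range_list_map]
      intro c hcs
      obtain ⟨p, hp, rfl⟩ := List.mem_take_iff_getElem.mp hcs
      obtain ⟨c', hc', a, rfl⟩ := h1 p (by omega)
      exact ⟨a, (Option.some.inj ((List.getElem?_eq_getElem _).symm.trans hc')).symm⟩
    have hy : s.drop (q + 1) ∈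
        Set.range (List.map fun b : Δ => (some (Sum.inr b) : Option (Γ ⊕ Δ))) := by
      rw [Set.range_list_map]
      intro c hcs
      obtain ⟨p, hp, rfl⟩ := List.mem_drop_iff_getElem.mp hcs
      obtain ⟨c', hc', b, rfl⟩ := h2 (q + 1 + p) (by omega) (by omega)
      exact ⟨b, (Option.some.inj ((List.getElem?_eq_getElem _).symm.trans hc')).symm⟩
    obtain ⟨x, hx⟩ := hx
    obtain ⟨y, hy⟩ := hy
    refine ⟨x, y, ?_⟩
    rw [pairString, hx, hy]
    have := Option.some.inj ((List.getElem?_eq_getElem hq).symm.trans hc)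
    rw [← this, ← List.drop_eq_getElem_cons, List.take_append_drop]

theorem repP_exists_pairString [Fintype Γ] [Fintype Δ] {X ι : Type}
    {str : X → List (Option (Γ ⊕ Δ))} {V : ι → X → ℕ} :
    RepP str V fun z => ∃ x y, str z = pairString x y := by
  refine RepP.congr ?_ fun z => exists_pairString_iff (str z)
  refine RepP.exists_lt Rep.length ((RepP.letter (fun c => c = none) Rep.newVar).and
    ((RepP.forall_lt Rep.newVar (RepP.letter (fun c => ∃ a, some (Sum.inl a) = c) Rep.newVar)).and
      (RepP.forall_lt Rep.length.weaken ((RepP.lt Rep.newVar.weaken Rep.newVar).imp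
        (RepP.letter (fun c => ∃ b, some (Sum.inr b) = c) Rep.newVar)))))

end Complexity

namespace FreeMetab

open Complexity

theorem mem_pairLanguage_certificate_iff {n : ℕ}
    (s : List (Option (Option (Letter n) ⊕ Option (Letter n)))) :
    s ∈ pairLanguage (certificate n) ↔
      (∃ x y, s = pairString x y) ∧ PosCertificate (n := n) readFst readSnd s := by
  rw [← certificate_iff]
  constructor
  · rintro ⟨x, y, h, rfl⟩
    rw [filterMap_readFst, filterMap_readSnd]
    exact ⟨⟨x, y, rfl⟩, h⟩
  · rintro ⟨⟨x, y, rfl⟩, h⟩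
    rw [filterMap_readFst, filterMap_readSnd] at h
    exact ⟨x, y, h, rfl⟩

theorem inP_pairLanguage_certificate (n : ℕ) : InP (pairLanguage (certificate n)) :=
  InP.of_rep (V := fun i : Empty => i.elim)
    ((repP_exists_pairString.and repP_posCertificate).congr mem_pairLanguage_certificate_iff)

end FreeMetab

/-! ### The certificates are polynomially bounded -/

namespace FreeMetab

open Complexity

theorem mem_sphericalProblem_iff {n : ℕ} (x : List (Option (Letter n))) :
    x ∈ sphericalProblem n ↔ ∃ (m : ℕ) (w : Fin m → List (Letter n)), 0 < m ∧
      x = encodeWords (List.ofFn w) ∧ Solvable (sphericalWord fun i => wordM (w i)) := by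
  constructor
  · rintro ⟨ws, hws, rfl, h⟩
    exact ⟨ws.length, ws.get, List.length_pos_iff.mpr hws, by rw [List.ofFn_get], h⟩
  · rintro ⟨m, w, hm, rfl, h⟩
    refine ⟨List.ofFn w, fun e => hm.ne' (List.ofFn_eq_nil_iff.mp e), rfl, ?_⟩
    -- The length of `List.ofFn w` is only propositionally equal to `m`; a variable length allows
    -- the equality to be eliminated.
    have key : ∀ (k : ℕ) (e : k = m),
        Solvable (sphericalWord fun i : Fin k => wordM (w (Fin.cast e i))) := by
      rintro k rfl
      exact h
    convert key _ List.length_ofFn using 4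
    simp only [List.get_eq_getElem, List.getElem_ofFn]
    rfl

/-- For an input of length N there are at most N + 1 words, of total length at most N + 1. Shortest
words for a short solution then have length at most 2(N + 1) each, and allowing one separator per
word gives the polynomial. Conversely any solution of the lattice equation, short or not, implies
solvability, so measuring by the given words instead of `lengthM` is harmless. -/
theorem isNPVerifier_certificate (n : ℕ) : IsNPVerifier (sphericalProblem n) (certificate n) := by
  refine ⟨inP_pairLanguage_certificate n,
    (Polynomial.X + 1) * (2 * (Polynomial.X + 1) + 1), fun x => ?_⟩
  rw [mem_sphericalProblem_iff]
  constructor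
  · rintro ⟨m, w, hm, rfl, h⟩
    obtain ⟨α, hα, h⟩ := (solvable_iff_exists_short _).mp h
    choose v hv hvα using fun i => exists_wordA_length (α i)
    have hα' : ∀ i, lengthA (α i) ≤ 2 * ∑ j, (w j).length := fun i =>
      (hα i).trans (Nat.mul_le_mul_left 2 (Finset.sum_le_sum fun j _ => lengthM_wordM_le (w j)))
    refine ⟨encodeWords (List.ofFn v), ?_, m, w, v, hm, rfl, rfl, fun i => ?_, ?_⟩
    · have h1 := sum_length_add_le_length_encodeWords (List.ofFn w)
      rw [List.length_ofFn, List.map_ofFn, List.sum_ofFn] at h1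
      simp only [Function.comp] at h1
      generalize (encodeWords (List.ofFn w)).length = N at h1 ⊢
      calc _ ≤ ∑ i, ((v i).length + 1) := by
            refine (length_encodeWords_le _).trans_eq ?_
            rw [List.map_ofFn, List.sum_ofFn]
            rfl
        _ ≤ ∑ _i : Fin m, (2 * (N + 1) + 1) := by
            refine Finset.sum_le_sum fun i _ => ?_
            have := hα' i
            rw [hvα]
            omega
        _ = m * (2 * (N + 1) + 1) := by simp
        _ ≤ (N + 1) * (2 * (N + 1) + 1) := Nat.mul_le_mul_right _ (by omega)
        _ = _ := by simp
    · rw [hv]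
      exact hα' i
    · simpa only [hv] using h
  · rintro ⟨y, -, m, w, v, hm, rfl, -, -, h⟩
    exact ⟨m, w, hm, rfl, (solvable_iff_exists_latticeEq _).mpr ⟨_, h⟩⟩

end FreeMetab

theorem mainTheorem3 (n : ℕ) :
    Complexity.InNP (FreeMetab.sphericalProblem n) ∧
    (∀ (m : ℕ) (c : Fin m → FreeMetab.M n),
      FreeMetab.Solvable (FreeMetab.sphericalWord c) ↔
        ∃ α : Fin m → FreeMetab.A n,
          (∀ i, FreeMetab.lengthA (α i) ≤ 2 * ∑ j, FreeMetab.lengthM (c j)) ∧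
          FreeMetab.LatticeEq c α) ∧
    Complexity.IsNPVerifier (FreeMetab.sphericalProblem n) (FreeMetab.certificate n) :=
  ⟨⟨Option (FreeMetab.Letter n), inferInstance, FreeMetab.certificate n,
      FreeMetab.isNPVerifier_certificate n⟩,
    fun _ c => FreeMetab.solvable_iff_exists_short c, FreeMetab.isNPVerifier_certificate n⟩
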